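/- Let $k$ be a field of characteristic different from $2$ and $G=\{1,\sigma\}$ the group of order two. Let $\mathcal S$ be a compact oriented smooth surface with non-empty boundary, $M\subset\partial\mathcal S$ a finite set meeting every boundary component, $P$ a finite set of interior points, and let $\sigma$ be an orientation-preserving diffeomorphism of $\mathcal S$ of order two with $\sigma(M)=M$, $\sigma(P)=P$ and finitely many fixed points, none of them in $P$. Let $D$ be a $G$-dissection: a finite, globally $\sigma$-invariant collection of arcs with endpoints in $M\cup P$ and pairwise disjoint interiors, cutting $\mathcal S$ into polygons with exactly one side being a boundary segment. The gentle algebra $A(D)=kQ/I$ has as vertices of $Q$ the arcs of $D$; there is an arrow $i\to j$ whenever (an end of) $i$ is immediately followed by (an end of) $j$ in the counterclockwise order around a point of $M\cup P$, and $I$ is generated by the paths $\beta\alpha$ (first $\alpha$) coming from three consecutive ends around the same point. The group $G$ acts on $A(D)$ through $\sigma$, and the skew-group algebra $A(D)G=A(D)\otimes kG$ has the product $(\lambda\otimes g)(\mu\otimes h)=\lambda g(\mu)\otimes gh$. Let $p:\mathcal S\to\bar{\mathcal S}=\mathcal S/\sigma$ be the quotient map and $X$ the set of images of the fixed points (orbifold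 points). Let $\bar D$ be the set of images of the arcs of $D$; the image of an arc $\gamma$ with $\sigma(\gamma)=\gamma^{-1}$ is the image of one half of $\gamma$, and it joins a marked point to a point of $X$. The skew-gentle algebra $\bar A(\bar D)$ is the quotient of the path algebra of the following quiver. Its vertices are the arcs of $\bar D$; it has one arrow $i\to j$ whenever (an end of) $i$ is immediately followed counterclockwise by (an end of) $j$ around a point of $p(M\cup P)$, and one special loop $x$ at each arc ending in $X$. The relations are $\beta\alpha=0$ for three consecutive ends around the same point of $p(M\cup P)$, and $x^2=x$ for each special loop $x$. If $j$ is an arc ending in $X$, with special loop $x$, put $\bar e_{j_0}=x$ and $\bar e_{j_1}=\bar e_j-x$. Then $\bar A(\bar D)$ is isomorphic, as a $k$-algebra, to the basic algebra of $A(D)G$. More precisely, choose a set of representatives of the $\sigma$-orbits in $M\cup P$ and a representative $i^+$ in each orbit $\{i^+,i^-\}$ of two arcs of $D$, and let $$\eta=\sum_{i^+}e_{i^+}\otimes 1+\sum_{\sigma(j)=j}e_j\otimes 1 .$$ Then $\eta$ is the sum of representatives of the isomorphism classes in a complete set of primitive pairwise orthogonal idempotents of $A(D)G$, and there is an isomorphism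 of $k$-algebras $\Phi:\bar A(\bar D)\to\eta\,A(D)G\,\eta$ with the following values. For an arc of $\bar D$ not ending in $X$ the arcs above it are $i^\pm$, and for one ending in $X$ the arc above it is again denoted by $i$. Of the two arrows $\alpha^+$, $\alpha^-=\sigma(\alpha^+)$ over an arrow $\alpha$, the arrow $\alpha^+$ is the one at a chosen representative. For $\epsilon,\epsilon'\in\{0,1\}$: - $\Phi(\bar e_i)=e_{i^+}\otimes1$ if $i$ does not end in $X$, and $\Phi(\bar e_{i_\epsilon})=e_i\otimes\frac{1+(-1)^\epsilon\sigma}{2}$ if $i$ ends in $X$. - For $\alpha:i\to j$ with neither $i$ nor $j$ ending in $X$: $\Phi(\alpha)=(e_{j^+}\otimes1)\big((\alpha^++\alpha^-)\otimes(1+\sigma)\big)(e_{i^+}\otimes1)$. - For $\alpha:i\to j$ with only $i$ ending in $X$: $\Phi(\alpha\,\bar e_{i_\epsilon})=(e_{j^+}\otimes1)(\alpha^+\otimes1+(-1)^\epsilon\alpha^-\otimes1)\big(e_i\otimes\tfrac{1+(-1)^\epsilon\sigma}{2}\big)$. - For $\alpha:i\to j$ with only $j$ ending in $X$: $\Phi(\bar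 e_{j_\epsilon}\alpha)=\big(e_j\otimes\tfrac{1+(-1)^\epsilon\sigma}{2}\big)(\alpha^+\otimes1+(-1)^\epsilon\alpha^-\otimes1)(e_{i^+}\otimes1)$. - For $\alpha:i\to j$ with both $i$ and $j$ ending in $X$: $\Phi(\bar e_{j_{\epsilon'}}\alpha\,\bar e_{i_\epsilon})=\big(e_j\otimes\tfrac{1+(-1)^{\epsilon'}\sigma}{2}\big)(\alpha^+\otimes1)\big(e_i\otimes\tfrac{1+(-1)^\epsilon\sigma}{2}\big)$. -/

import Mathlib

open scoped Manifold ContDiff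

noncomputable section

universe u

namespace GSurf

/-! ## Algebras given by a quiver with quadratic relations and special loops -/

/-- A triple `(Q, I, Sp)`: a quiver `Q` with finitely many vertices, a set `I` of paths of length
two, and a set `Sp` of loops.  `rel β α` says that the path `βα` (first `α`, then `β`)
belongs to `I`. -/
structure QuiverTriple where
  Vert : Type u
  Arr : Type u
  finite_vert : Finite Vert
  src : Arr → Vert
  tgt : Arr → Vert
  rel : Arr → Arr → Prop
  rel_comp : ∀ {b a}, rel b a → tgt a = src b
  Sp : Set Arr
  sp_loop : ∀ {a}, a ∈ Sp → src a = tgt a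

namespace QuiverTriple

variable (k : Type*) [Field k] (Q : QuiverTriple.{u})

/-- The trivial path (lazy path) at the vertex `i`, in the free algebra on vertices and arrows. -/
def preE (i : Q.Vert) : FreeAlgebra k (Q.Vert ⊕ Q.Arr) := FreeAlgebra.ι k (Sum.inl i)

/-- The arrow `a`, in the free algebra on vertices and arrows. -/
def preA (a : Q.Arr) : FreeAlgebra k (Q.Vert ⊕ Q.Arr) := FreeAlgebra.ι k (Sum.inr a)

/-- The first five families present the path algebra `kQ` by the trivial paths and the arrows
(products are composed from right to left); the last two are `βα = 0` for `βα ∈ I` and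
`e² = e` for `e ∈ Sp`. -/
inductive Rel : FreeAlgebra k (Q.Vert ⊕ Q.Arr) → FreeAlgebra k (Q.Vert ⊕ Q.Arr) → Prop
  | idem (i : Q.Vert) : Rel (Q.preE k i * Q.preE k i) (Q.preE k i)
  | orth (i j : Q.Vert) (h : i ≠ j) : Rel (Q.preE k i * Q.preE k j) 0
  | one : Rel (∑ᶠ i, Q.preE k i) 1
  | tgt (a : Q.Arr) : Rel (Q.preE k (Q.tgt a) * Q.preA k a) (Q.preA k a)
  | src (a : Q.Arr) : Rel (Q.preA k a * Q.preE k (Q.src a)) (Q.preA k a)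
  | quad (b a : Q.Arr) (h : Q.rel b a) : Rel (Q.preA k b * Q.preA k a) 0
  | special (a : Q.Arr) (h : a ∈ Q.Sp) : Rel (Q.preA k a * Q.preA k a) (Q.preA k a)

/-- The algebra `kQ / ⟨I ∪ {e² - e, e ∈ Sp}⟩`. -/
abbrev Alg : Type _ := RingQuot (Rel k Q)

/-- The quotient map from the free algebra. -/
def toAlg : FreeAlgebra k (Q.Vert ⊕ Q.Arr) →ₐ[k] Q.Alg k := RingQuot.mkAlgHom k (Rel k Q)

/-- The class of the trivial path at `i`. -/
def e (i : Q.Vert) : Q.Alg k := Q.toAlg k (Q.preE k i)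

/-- The class of the arrow `a`. -/
def arr (a : Q.Arr) : Q.Alg k := Q.toAlg k (Q.preA k a)

/-- The two idempotents into which the trivial path at the vertex of a special loop `x` splits:
`ē₀ = x` and `ē₁ = e - x`. -/
def eSp (x : Q.Arr) (ε : Fin 2) : Q.Alg k :=
  if ε = 0 then Q.arr k x else Q.e k (Q.src x) - Q.arr k x

/-- An automorphism of order at most two of a triple `(Q, I, Sp)`. -/
structure Involution where
  onV : Q.Vert → Q.Vert
  onA : Q.Arr → Q.Arr
  onV_onV : ∀ i, onV (onV i) = i
  onA_onA : ∀ a, onA (onA a) = a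
  src_onA : ∀ a, Q.src (onA a) = onV (Q.src a)
  tgt_onA : ∀ a, Q.tgt (onA a) = onV (Q.tgt a)
  rel_onA : ∀ {b a}, Q.rel b a → Q.rel (onA b) (onA a)
  sp_onA : ∀ {a}, a ∈ Q.Sp → onA a ∈ Q.Sp

variable {Q}

/-- The algebra endomorphism induced by an automorphism of order at most two. -/
def Involution.hom (s : Q.Involution) : Q.Alg k →ₐ[k] Q.Alg k :=
  RingQuot.liftAlgHom k
    ⟨FreeAlgebra.lift k (Sum.elim (fun i => Q.e k (s.onV i)) (fun a => Q.arr k (s.onA a))), by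
      have hE : ∀ i, FreeAlgebra.lift k
          (Sum.elim (fun i => Q.e k (s.onV i)) (fun a => Q.arr k (s.onA a))) (Q.preE k i)
          = Q.toAlg k (Q.preE k (s.onV i)) := fun i => by simp [preE, e]
      have hA : ∀ i, FreeAlgebra.lift k
          (Sum.elim (fun i => Q.e k (s.onV i)) (fun a => Q.arr k (s.onA a))) (Q.preA k i)
          = Q.toAlg k (Q.preA k (s.onA i)) := fun i => by simp [preA, arr]
      have hmk : ∀ {x y}, Rel k Q x y → Q.toAlg k x = Q.toAlg k y := fun h =>
        RingQuot.mkAlgHom_rel k h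
      intro x y h
      cases h with
      | idem i => simp only [map_mul, hE]; rw [← map_mul]; exact hmk (Rel.idem _)
      | orth i j h =>
        simp only [map_mul, hE, map_zero]
        rw [← map_mul, ← map_zero (Q.toAlg k)]
        exact hmk (Rel.orth _ _ fun h' => h (by rw [← s.onV_onV i, h', s.onV_onV]))
      | one =>
        have := Q.finite_vert
        have h1 := hmk (Rel.one (k := k) (Q := Q))
        have hb : Function.Bijective s.onV :=
          ⟨fun a b h => by rw [← s.onV_onV a, h, s.onV_onV], fun a => ⟨_, s.onV_onV a⟩⟩
        rw [map_one] at h1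
        rw [map_one, ← h1, map_finsum _ (Set.toFinite _), map_finsum _ (Set.toFinite _)]
        simp only [hE]
        exact finsum_eq_of_bijective s.onV hb fun _ => rfl
      | tgt a =>
        simp only [map_mul, hE, hA]; rw [← s.tgt_onA, ← map_mul]; exact hmk (Rel.tgt _)
      | src a =>
        simp only [map_mul, hE, hA]; rw [← s.src_onA, ← map_mul]; exact hmk (Rel.src _)
      | quad b a h =>
        simp only [map_mul, hA, map_zero]
        rw [← map_mul, ← map_zero (Q.toAlg k)]
        exact hmk (Rel.quad _ _ (s.rel_onA h))
      | special a h =>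
        simp only [map_mul, hA]; rw [← map_mul]; exact hmk (Rel.special _ (s.sp_onA h))⟩

theorem Involution.hom_e (s : Q.Involution) (i : Q.Vert) :
    s.hom k (Q.e k i) = Q.e k (s.onV i) := by
  simp only [Involution.hom, e, toAlg]
  rw [RingQuot.liftAlgHom_mkAlgHom_apply]
  simp [preE]

theorem Involution.hom_arr (s : Q.Involution) (a : Q.Arr) :
    s.hom k (Q.arr k a) = Q.arr k (s.onA a) := by
  simp only [Involution.hom, arr, toAlg]
  rw [RingQuot.liftAlgHom_mkAlgHom_apply]
  simp [preA]

theorem Involution.hom_hom (s : Q.Involution) (x : Q.Alg k) : s.hom k (s.hom k x) = x := by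
  have he : ∀ i, s.hom k (s.hom k (Q.e k i)) = Q.e k i := fun i => by
    rw [s.hom_e k, s.hom_e k, s.onV_onV]
  have ha : ∀ a, s.hom k (s.hom k (Q.arr k a)) = Q.arr k a := fun a => by
    rw [s.hom_arr k, s.hom_arr k, s.onA_onA]
  have h : (s.hom k).comp (s.hom k) = AlgHom.id k (Q.Alg k) := by
    apply RingQuot.ringQuot_ext'
    apply FreeAlgebra.hom_ext
    funext z
    cases z with
    | inl i => exact he i
    | inr a => exact ha a
  exact DFunLike.congr_fun h x

end QuiverTriple

/-! ## Basic algebras -/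

section Basic

variable {B : Type*} [Ring B]

/-- A primitive idempotent: nonzero, and not a sum of two nonzero orthogonal idempotents. -/
def IsPrimitiveIdem (f : B) : Prop :=
  IsIdempotentElem f ∧ f ≠ 0 ∧ ∀ a b : B, IsIdempotentElem a → IsIdempotentElem b →
    a * b = 0 → b * a = 0 → a + b = f → a = 0 ∨ b = 0

/-- Isomorphism of idempotents: left multiplications by `b` and `a` are mutually inverse
isomorphisms between the projective right modules `fB` and `gB`. -/
def IdemIso (f g : B) : Prop :=
  ∃ a b : B, f * a * g = a ∧ g * b * f = b ∧ a * b = f ∧ b * a = g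

/-- `η` is the sum of representatives of the isomorphism classes in some complete set of
primitive pairwise orthogonal idempotents. -/
def IsBasicIdem (η : B) : Prop :=
  ∃ (n : ℕ) (f : Fin n → B) (s : Finset (Fin n)),
    CompleteOrthogonalIdempotents f ∧ (∀ i, IsPrimitiveIdem (f i)) ∧
    (∀ i ∈ s, ∀ j ∈ s, IdemIso (f i) (f j) → i = j) ∧
    (∀ i, ∃ j ∈ s, IdemIso (f i) (f j)) ∧
    η = ∑ i ∈ s, f i

/-- The corner `ηBη` of a `k`-algebra `B` is a `k`-algebra, with unit `η`. -/
instance cornerAlgebra {k : Type*} [CommRing k] [Algebra k B] {η : B}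
    (hη : IsIdempotentElem η) : Algebra k hη.Corner :=
  RingHom.toAlgebra'
    { toFun := fun r => ⟨η * algebraMap k B r * η, _, rfl⟩
      map_one' := Subtype.ext (by
        change η * algebraMap k B 1 * η = η
        rw [map_one, mul_one, hη.eq])
      map_mul' := fun r s => Subtype.ext (by
        change η * algebraMap k B (r * s) * η
          = (η * algebraMap k B r * η) * (η * algebraMap k B s * η)
        rw [← Algebra.commutes r η, ← Algebra.commutes s η, ← Algebra.commutes (r * s) η, map_mul]
        simp only [mul_assoc, hη.eq]
        rw [← mul_assoc η (algebraMap k B s), ← Algebra.commutes s η, mul_assoc, hη.eq])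
      map_zero' := Subtype.ext (by
        change η * algebraMap k B 0 * η = 0
        simp)
      map_add' := fun r s => Subtype.ext (by
        change η * algebraMap k B (r + s) * η = η * algebraMap k B r * η + η * algebraMap k B s * η
        rw [map_add, mul_add, add_mul]) }
    (fun r x => Subtype.ext (by
      obtain ⟨x, y, rfl⟩ := x
      change (η * algebraMap k B r * η) * (η * y * η) = (η * y * η) * (η * algebraMap k B r * η)
      have h := Algebra.commutes r η
      have h1 : η * algebraMap k B r * η = algebraMap k B r * η := by rw [← h, mul_assoc, hη.eq]
      rw [h1]
      calc algebraMap k B r * η * (η * y * η) = algebraMap k B r * (η * η * y * η) := by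
            simp only [mul_assoc]
        _ = (η * y * η) * algebraMap k B r := by rw [hη.eq, Algebra.commutes]
        _ = (η * y * η) * (η * algebraMap k B r) := by
            rw [← mul_assoc, mul_assoc (η * y) η η, hη.eq]
        _ = _ := by rw [h]))

variable (k : Type*) [Field k]

/-- `C` is (isomorphic to) the basic algebra of `B`. -/
def IsBasicAlgebraOf (B C : Type*) [Ring B] [Algebra k B] [Ring C] [Algebra k C] : Prop :=
  ∃ (η : B) (hη : IsIdempotentElem η), IsBasicIdem η ∧ Nonempty (C ≃ₐ[k] hη.Corner)

end Basic

/-! ## Arcs and the triple of a system of arcs -/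

/-- The oriented plane, the source of local parametrizations. -/
abbrev Plane := EuclideanSpace ℝ (Fin 2)

section Curves

variable {T T' : Type*} [TopologicalSpace T] [TopologicalSpace T']

/-- The reversed curve `t ↦ γ (1 - t)`. -/
def rev (γ : C(unitInterval, T)) : C(unitInterval, T) :=
  γ.comp ⟨unitInterval.symm, unitInterval.continuous_symm⟩

/-- The first half `t ↦ γ (t / 2)` of a curve. -/
def half (γ : C(unitInterval, T)) : C(unitInterval, T) :=
  γ.comp ⟨fun t => ⟨(t : ℝ) / 2, by linarith [t.2.1], by linarith [t.2.2]⟩, by fun_prop⟩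

theorem rev_rev (γ : C(unitInterval, T)) : rev (rev γ) = γ := by
  ext t; simp [rev]

theorem comp_rev (f : C(T, T')) (γ : C(unitInterval, T)) : f.comp (rev γ) = rev (f.comp γ) := rfl

/-- A finite system of arcs on a surface `T` with a set `V` of marked points and a set `X` of
orbifold points.  Every arc is listed with both of its orientations; an element `h` of `E` thus
also stands for the end of an arc at the point `h 0`, and `rev h` for the other end.
The predicate `posAt g z` records the oriented smooth structure: it says that `g` is a
smooth orientation-preserving local parametrization near `z`. -/
structure ArcSystem (T : Type*) [TopologicalSpace T] where
  V : Set T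
  X : Set T
  E : Set C(unitInterval, T)
  finite : E.Finite
  rev_mem : ∀ γ ∈ E, rev γ ∈ E
  posAt : (Plane → T) → Plane → Prop

namespace ArcSystem

variable (D : ArcSystem T)

/-- Two oriented arcs are the same arc if they are equal up to reversal. -/
def arcSetoid : Setoid D.E where
  r γ δ := δ = γ ∨ (δ : C(unitInterval, T)) = rev γ
  iseqv := by
    refine ⟨fun γ => Or.inl rfl, ?_, ?_⟩
    · rintro γ δ (h | h)
      · exact Or.inl h.symm
      · exact Or.inr (by rw [h, rev_rev])
    · rintro γ δ ε (rfl | h) (rfl | h')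
      · exact Or.inl rfl
      · exact Or.inr h'
      · exact Or.inr h
      · exact Or.inl (Subtype.ext (by rw [h', h, rev_rev]))

/-- The (unoriented) arcs of the system. -/
def Arcs : Type _ := Quotient D.arcSetoid

/-- The arc underlying an oriented arc. -/
def arc (h : D.E) : D.Arcs := Quotient.mk D.arcSetoid h

/-- The end `h` is immediately followed by the end `h'` in the counterclockwise order around
their common endpoint, which is a marked point: there is a sector at this point, parametrized by
polar coordinates `(r, θ)`, whose sides `θ = 0` and `θ = 1` run along `h` and `h'` and whose
interior is embedded with the positive orientation and meets no arc of the system. -/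
def Follows (h h' : C(unitInterval, T)) : Prop :=
  h 0 ∈ D.V ∧ ∃ ε : ℝ, 0 < ε ∧ ε ≤ 1 ∧ ∃ g : Plane → T,
    ContinuousOn g {z | z 0 ∈ Set.Icc 0 ε ∧ z 1 ∈ Set.Icc 0 1} ∧
    (∀ θ ∈ Set.Icc (0 : ℝ) 1, g !₂[0, θ] = h 0) ∧
    (∀ r : unitInterval, (r : ℝ) ≤ ε → g !₂[(r : ℝ), 0] = h r ∧ g !₂[(r : ℝ), 1] = h' r) ∧
    Set.InjOn g {z | z 0 ∈ Set.Ioo 0 ε ∧ z 1 ∈ Set.Ioo 0 1} ∧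
    ∀ z : Plane, z 0 ∈ Set.Ioo 0 ε → z 1 ∈ Set.Ioo 0 1 →
      D.posAt g z ∧ ∀ γ ∈ D.E, g z ∉ Set.range γ

/-- Arrows given by two consecutive ends at a marked point. -/
abbrev Corner := {q : D.E × D.E // D.Follows q.1 q.2}

/-- The triple `(Q, I, Sp)` of a system of arcs.  Vertices are the arcs.  There is an arrow
`i ⟶ j` whenever (an end of) `i` is immediately followed by (an end of) `j` in the
counterclockwise order around a marked point, and a loop for each end of an arc at a point of `X`.
The latter are the special loops.  A path `βα` is in `I` when `α` and `β` come from three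
consecutive ends around the same marked point. -/
def triple : QuiverTriple where
  Vert := D.Arcs
  Arr := D.Corner ⊕ {h : D.E // (h : C(unitInterval, T)) 0 ∈ D.X}
  finite_vert := by
    have := D.finite.to_subtype
    exact inferInstanceAs (Finite (Quotient D.arcSetoid))
  src := Sum.elim (fun q => D.arc q.1.1) (fun h => D.arc h.1)
  tgt := Sum.elim (fun q => D.arc q.1.2) (fun h => D.arc h.1)
  rel b a := ∃ q q' : D.Corner, a = Sum.inl q ∧ b = Sum.inl q' ∧ q.1.2 = q'.1.1
  rel_comp := by
    rintro b a ⟨q, q', rfl, rfl, h⟩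
    simp [h]
  Sp := Set.range Sum.inr
  sp_loop := by
    rintro a ⟨h, rfl⟩
    rfl

end ArcSystem

end Curves

/-! ## Oriented smooth surfaces, marked surfaces, dissections -/

section Surface

variable (S : Type*) [TopologicalSpace S] [ChartedSpace (EuclideanHalfSpace 2) S]

/-- An orientation of a smooth surface with boundary: a covering set of charts of the smooth
structure whose transition maps have positive Jacobian. -/
structure SurfaceOrientation where
  charts : Set (OpenPartialHomeomorph S (EuclideanHalfSpace 2))
  subset : charts ⊆ IsManifold.maximalAtlas (𝓡∂ 2) ∞ S
  cover : ∀ s, ∃ φ ∈ charts, s ∈ φ.source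
  compat : ∀ φ ∈ charts, ∀ ψ ∈ charts, ∀ s ∈ φ.source, s ∈ ψ.source →
    0 < (fderivWithin ℝ (ψ.extend (𝓡∂ 2) ∘ (φ.extend (𝓡∂ 2)).symm) (Set.range (𝓡∂ 2))
      (φ.extend (𝓡∂ 2) s)).det

variable {S}

/-- `g` is, near `z`, a smooth map to the surface with positive Jacobian at `z`. -/
def SurfaceOrientation.PosAt (O : SurfaceOrientation S) (g : Plane → S) (z : Plane) : Prop :=
  ContinuousAt g z ∧ ∃ φ ∈ O.charts, g z ∈ φ.source ∧
    ContDiffAt ℝ ∞ (φ.extend (𝓡∂ 2) ∘ g) z ∧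
    0 < (fderiv ℝ (φ.extend (𝓡∂ 2) ∘ g) z).det

variable (S)

/-- A marked surface: an oriented smooth surface (compact, when used) with non-empty boundary,
a finite set `M` of points on the boundary meeting every boundary component, and a finite set `P`
of points in the interior. -/
structure MarkedSurface where
  orient : SurfaceOrientation S
  boundary_nonempty : ((𝓡∂ 2).boundary S).Nonempty
  M : Set S
  P : Set S
  M_finite : M.Finite
  P_finite : P.Finite
  M_subset : M ⊆ (𝓡∂ 2).boundary S
  P_subset : P ⊆ (𝓡∂ 2).interior S
  M_meets : ∀ b ∈ (𝓡∂ 2).boundary S, ∃ m ∈ M, m ∈ connectedComponentIn ((𝓡∂ 2).boundary S) b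

/-- A marked surface with a diffeomorphism of order two that preserves the orientation, `M` and `P`
and has finitely many fixed points, none of which is in `P`. -/
structure GMarkedSurface extends MarkedSurface S where
  σ : S ≃ₘ^∞⟮𝓡∂ 2, 𝓡∂ 2⟯ S
  σ_σ : ∀ s, σ (σ s) = s
  σ_ne : ∃ s, σ s ≠ s
  σ_orient : ∀ φ ∈ orient.charts, ∀ ψ ∈ orient.charts, ∀ s ∈ φ.source, σ s ∈ ψ.source →
    0 < (fderivWithin ℝ (ψ.extend (𝓡∂ 2) ∘ σ ∘ (φ.extend (𝓡∂ 2)).symm) (Set.range (𝓡∂ 2))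
      (φ.extend (𝓡∂ 2) s)).det
  σ_M : ∀ m ∈ M, σ m ∈ M
  σ_P : ∀ m ∈ P, σ m ∈ P
  fixed_finite : {s | σ s = s}.Finite
  fixed_P : ∀ s, σ s = s → s ∉ P

variable {S}

/-- Points of the unit circle; the point with parameter `x` lies on the side number `⌊x⌋` of the
unit disc, seen as a polygon with `n + 1` sides numbered counterclockwise from `0` to `n`. -/
def circlePt (n : ℕ) (x : ℝ) : Plane :=
  !₂[Real.cos (2 * Real.pi * x / (n + 1)), Real.sin (2 * Real.pi * x / (n + 1))]

/-- The arcs in `E` (each listed with both orientations) cut the surface into polygons with exactly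
one side being a boundary segment: the surface is covered by closed polygons `f c`, which are
embedded and disjoint from each other and from the arcs in their interiors.  The sides number
`0, …, n c - 1` of `f c` run along arcs, such that each arc is a side of a polygon exactly once on
each of its two sides, and the last side of `f c` is a boundary segment. -/
structure PolygonCutting (𝒮 : MarkedSurface S) (E : Set C(unitInterval, S)) where
  N : ℕ
  n : Fin N → ℕ
  f : Fin N → Plane → S
  side : (Σ c, Fin (n c)) → E
  continuousOn : ∀ c, ContinuousOn (f c) (Metric.closedBall 0 1)
  pos : ∀ c, ∀ z ∈ Metric.ball (0 : Plane) 1, 𝒮.orient.PosAt (f c) z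
  inj : ∀ c c', ∀ z ∈ Metric.ball (0 : Plane) 1, ∀ z' ∈ Metric.ball (0 : Plane) 1,
    f c z = f c' z' → c = c' ∧ z = z'
  avoid : ∀ c, ∀ z ∈ Metric.ball (0 : Plane) 1, f c z ∉ 𝒮.M ∪ 𝒮.P ∧ ∀ γ ∈ E, f c z ∉ Set.range γ
  cover : ∀ s, ∃ c, ∃ z ∈ Metric.closedBall (0 : Plane) 1, f c z = s
  side_bij : Function.Bijective side
  side_eq : ∀ c (i : Fin (n c)) (t : unitInterval),
    f c (circlePt (n c) ((i : ℝ) + t)) = (side ⟨c, i⟩ : C(unitInterval, S)) t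
  last_mem : ∀ c (t : unitInterval), f c (circlePt (n c) (n c + t)) ∈ (𝓡∂ 2).boundary S
  last_M : ∀ c (t : unitInterval), f c (circlePt (n c) (n c + t)) ∈ 𝒮.M ↔ t = 0 ∨ t = 1
  last_inj : ∀ c c' (t t' : unitInterval), t ∈ Set.Ioo 0 1 → t' ∈ Set.Ioo 0 1 →
    f c (circlePt (n c) (n c + t)) = f c' (circlePt (n c') (n c' + t')) → c = c' ∧ t = t'

/-- A dissection of a marked surface: a finite collection of arcs with endpoints in `M ∪ P` and
with disjoint interiors, which cuts the surface into polygons with exactly one side being a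
boundary segment.  Arcs are parametrized and are listed with both orientations. -/
structure Dissection (𝒮 : MarkedSurface S) where
  E : Set C(unitInterval, S)
  finite : E.Finite
  rev_mem : ∀ γ ∈ E, rev γ ∈ E
  start_mem : ∀ γ ∈ E, γ 0 ∈ 𝒮.M ∪ 𝒮.P
  injOn : ∀ γ ∈ E, Set.InjOn γ (Set.Ioo 0 1)
  interior : ∀ γ ∈ E, ∀ t ∈ Set.Ioo (0 : unitInterval) 1,
    γ t ∈ (𝓡∂ 2).interior S ∧ γ t ∉ 𝒮.P
  disjoint : ∀ γ ∈ E, ∀ δ ∈ E, ∀ t ∈ Set.Ioo (0 : unitInterval) 1,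
    ∀ u ∈ Set.Ioo (0 : unitInterval) 1, γ t = δ u → δ = γ ∨ δ = rev γ
  cut : Nonempty (PolygonCutting 𝒮 E)

/-- The diffeomorphism of a `G`-marked surface, as a continuous map. -/
def GMarkedSurface.σC (𝒮 : GMarkedSurface S) : C(S, S) := ⟨𝒮.σ, 𝒮.σ.continuous⟩

/-- A `G`-dissection: a dissection that is globally fixed by `σ`. -/
structure GDissection (𝒮 : GMarkedSurface S) extends Dissection 𝒮.toMarkedSurface where
  σ_mem : ∀ γ ∈ E, 𝒮.σC.comp γ ∈ E

/-- `σ` preserves positively oriented local parametrizations. -/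
theorem GMarkedSurface.posAt_σ [IsManifold (𝓡∂ 2) ∞ S] (𝒮 : GMarkedSurface S) {g : Plane → S}
    {z : Plane} (h : 𝒮.orient.PosAt g z) : 𝒮.orient.PosAt (𝒮.σ ∘ g) z := by
  obtain ⟨hc, φ, hφ, hs, hd, hdet⟩ := h
  obtain ⟨ψ, hψ, hs'⟩ := 𝒮.orient.cover (𝒮.σ (g z))
  have hcσ : ContinuousAt (𝒮.σ ∘ g) z := (𝒮.σ.continuous.continuousAt).comp hc
  set F := ψ.extend (𝓡∂ 2) ∘ 𝒮.σ ∘ (φ.extend (𝓡∂ 2)).symm with hF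
  have hev : (ψ.extend (𝓡∂ 2) ∘ 𝒮.σ ∘ g) =ᶠ[nhds z] F ∘ (φ.extend (𝓡∂ 2) ∘ g) := by
    filter_upwards [hc.preimage_mem_nhds (φ.open_source.mem_nhds hs)] with w hw
    have : (φ.extend (𝓡∂ 2)).symm ((φ.extend (𝓡∂ 2)) (g w)) = g w :=
      φ.extend_left_inv hw
    simp only [hF, Function.comp_apply, this]
  have hFs : ContDiffWithinAt ℝ ∞ F (Set.range (𝓡∂ 2)) (φ.extend (𝓡∂ 2) (g z)) := by
    have h1 : ContMDiffAt (𝓡∂ 2) (𝓡∂ 2) ∞ 𝒮.σ (g z) := 𝒮.σ.contMDiff.contMDiffAt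
    have h2 := (contMDiffWithinAt_iff_of_mem_maximalAtlas (s := Set.univ)
      (𝒮.orient.subset hφ) (𝒮.orient.subset hψ) hs hs').1 h1
    have h3 := h2.2
    rwa [Set.preimage_univ, Set.univ_inter] at h3
  have hmaps : Set.MapsTo (φ.extend (𝓡∂ 2) ∘ g) Set.univ (Set.range (𝓡∂ 2)) := by
    intro w _
    exact ⟨φ (g w), rfl⟩
  have hcomp : ContDiffAt ℝ ∞ (F ∘ (φ.extend (𝓡∂ 2) ∘ g)) z := by
    rw [← contDiffWithinAt_univ] at hd ⊢
    exact hFs.comp z hd hmaps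
  have hder : fderiv ℝ (F ∘ (φ.extend (𝓡∂ 2) ∘ g)) z =
      (fderivWithin ℝ F (Set.range (𝓡∂ 2)) (φ.extend (𝓡∂ 2) (g z))).comp
        (fderiv ℝ (φ.extend (𝓡∂ 2) ∘ g) z) := by
    have h1 := (hFs.differentiableWithinAt (by simp)).hasFDerivWithinAt
    have h2 := (hd.differentiableAt (by simp)).hasFDerivAt.hasFDerivWithinAt (s := Set.univ)
    have h3 := HasFDerivWithinAt.comp z h1 h2 hmaps
    exact (hasFDerivWithinAt_univ.1 h3).fderiv
  refine ⟨hcσ, ψ, hψ, hs', hcomp.congr_of_eventuallyEq hev, ?_⟩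
  rw [hev.fderiv_eq, hder]
  have h1 := 𝒮.σ_orient φ hφ ψ hψ (g z) hs hs'
  have h2 := mul_pos h1 hdet
  have h3 : ((fderivWithin ℝ F (Set.range (𝓡∂ 2)) (φ.extend (𝓡∂ 2) (g z))).comp
      (fderiv ℝ (φ.extend (𝓡∂ 2) ∘ g) z)).det =
      (fderivWithin ℝ F (Set.range (𝓡∂ 2)) (φ.extend (𝓡∂ 2) (g z))).det *
      (fderiv ℝ (φ.extend (𝓡∂ 2) ∘ g) z).det := LinearMap.det_comp _ _
  rw [h3]
  exact h2

/-! ## The quotient orbifold -/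

namespace GMarkedSurface

variable (𝒮 : GMarkedSurface S)

/-- The equivalence relation whose classes are the orbits of `σ`. -/
def orbitSetoid : Setoid S where
  r s t := t = s ∨ t = 𝒮.σ s
  iseqv := by
    refine ⟨fun s => Or.inl rfl, ?_, ?_⟩
    · rintro s t (h | h)
      · exact Or.inl h.symm
      · exact Or.inr (by rw [h, 𝒮.σ_σ])
    · rintro s t u (rfl | rfl) (rfl | rfl)
      · exact Or.inl rfl
      · exact Or.inr rfl
      · exact Or.inr rfl
      · exact Or.inl (𝒮.σ_σ s)

/-- The quotient `S / σ`, with the quotient topology. -/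
def Quot : Type _ := Quotient 𝒮.orbitSetoid

instance : TopologicalSpace 𝒮.Quot := inferInstanceAs (TopologicalSpace (Quotient 𝒮.orbitSetoid))

/-- The quotient map `p : S → S / σ`. -/
def p : C(S, 𝒮.Quot) := ⟨Quotient.mk 𝒮.orbitSetoid, continuous_quotient_mk'⟩

end GMarkedSurface

/-! ## The gentle algebra with its action, and the skew-gentle algebra of the quotient -/

/-- The group `G` of order two. -/
abbrev G := Multiplicative (ZMod 2)

/-- The generator of `G`. -/
def gen : G := Multiplicative.ofAdd 1

namespace GDissection

variable {𝒮 : GMarkedSurface S} (D : GDissection 𝒮)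

/-- The arc system of a dissection (there are no orbifold points upstairs). -/
def arcs : ArcSystem S where
  V := 𝒮.M ∪ 𝒮.P
  X := ∅
  E := D.E
  finite := D.finite
  rev_mem := D.rev_mem
  posAt := 𝒮.orient.PosAt

/-- The image of an oriented arc in the quotient: if `σ` reverses `γ` this is the image of the
first half of `γ`, which runs from a marked point to an orbifold point; otherwise it is the
image of `γ`. -/
def proj (γ : C(unitInterval, S)) : C(unitInterval, 𝒮.Quot) :=
  open Classical in
  if 𝒮.σC.comp γ = rev γ then half (𝒮.p.comp γ) else 𝒮.p.comp γ

/-- The arc system on the quotient orbifold: marked points are the images of the marked points,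
orbifold points are the images of the fixed points, and arcs are the images of the arcs.
The oriented smooth structure, off the orbifold points, is the one for which the quotient map
is an orientation-preserving local diffeomorphism. -/
def quotArcs : ArcSystem 𝒮.Quot where
  V := 𝒮.p '' (𝒮.M ∪ 𝒮.P)
  X := 𝒮.p '' {s | 𝒮.σ s = s}
  E := proj '' D.E ∪ rev '' (proj '' D.E)
  finite := (D.finite.image _).union ((D.finite.image _).image _)
  rev_mem := by
    rintro γ (h | ⟨δ, h, rfl⟩)
    · exact Or.inr ⟨γ, h, rfl⟩
    · exact Or.inl (by rwa [rev_rev])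
  posAt := fun g z => ∃ g' : Plane → S, 𝒮.orient.PosAt g' z ∧ 𝒮.σ (g' z) ≠ g' z ∧
    ∀ᶠ w in nhds z, g w = 𝒮.p (g' w)

/-- `σ` acting on oriented arcs. -/
def σE (γ : D.arcs.E) : D.arcs.E := ⟨𝒮.σC.comp γ.1, D.σ_mem γ.1 γ.2⟩

theorem σC_σC (γ : C(unitInterval, S)) : 𝒮.σC.comp (𝒮.σC.comp γ) = γ := by
  ext t; exact 𝒮.σ_σ _

theorem σE_σE (γ : D.arcs.E) : D.σE (D.σE γ) = γ := Subtype.ext (σC_σC _)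

/-- `σ` acting on arcs. -/
def σArc : D.arcs.Arcs → D.arcs.Arcs :=
  Quotient.map D.σE (by
    rintro γ δ (rfl | h)
    · exact Or.inl rfl
    · refine Or.inr ?_
      simp only [σE, h]
      exact comp_rev _ _)

theorem follows_σ [IsManifold (𝓡∂ 2) ∞ S] {h h' : C(unitInterval, S)} (H : D.arcs.Follows h h') :
    D.arcs.Follows (𝒮.σC.comp h) (𝒮.σC.comp h') := by
  obtain ⟨hV, ε, h0, h1, g, gc, gt, gs, gi, gp⟩ := H
  refine ⟨?_, ε, h0, h1, 𝒮.σ ∘ g, 𝒮.σ.continuous.comp_continuousOn gc, ?_, ?_, ?_, ?_⟩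
  · rcases hV with hV | hV
    · exact Or.inl (𝒮.σ_M _ hV)
    · exact Or.inr (𝒮.σ_P _ hV)
  · intro θ hθ
    exact congrArg 𝒮.σ (gt θ hθ)
  · intro r hr
    exact ⟨congrArg 𝒮.σ (gs r hr).1, congrArg 𝒮.σ (gs r hr).2⟩
  · exact 𝒮.σ.injective.injOn.comp gi (Set.mapsTo_univ _ _)
  · intro z hz hz'
    refine ⟨𝒮.posAt_σ (gp z hz hz').1, ?_⟩
    rintro γ hγ ⟨t, ht⟩
    refine (gp z hz hz').2 _ (D.σ_mem γ hγ) ⟨t, ?_⟩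
    change 𝒮.σ (γ t) = g z
    rw [ht]
    exact 𝒮.σ_σ _

variable [IsManifold (𝓡∂ 2) ∞ S]

/-- `σ` acting on the arrows of the quiver of `D`. -/
def σCorner (q : D.arcs.Corner) : D.arcs.Corner := ⟨(D.σE q.1.1, D.σE q.1.2), D.follows_σ q.2⟩

theorem σCorner_σCorner (q : D.arcs.Corner) : D.σCorner (D.σCorner q) = q :=
  Subtype.ext (Prod.ext (D.σE_σE _) (D.σE_σE _))

/-- The automorphism of the quiver of `D` induced by `σ`. -/
def σQ : D.arcs.triple.Involution where
  onV := D.σArc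
  onA := Sum.map D.σCorner (fun h => ⟨D.σE h.1, h.2.elim⟩)
  onV_onV := by
    rintro ⟨γ⟩
    exact congrArg (Quotient.mk _) (D.σE_σE γ)
  onA_onA := by
    rintro (q | ⟨h, hh⟩)
    · exact congrArg Sum.inl (D.σCorner_σCorner q)
    · exact hh.elim
  src_onA := by
    rintro (q | ⟨h, hh⟩)
    · rfl
    · exact hh.elim
  tgt_onA := by
    rintro (q | ⟨h, hh⟩)
    · rfl
    · exact hh.elim
  rel_onA := by
    rintro b a ⟨q, q', rfl, rfl, h⟩
    exact ⟨_, _, rfl, rfl, congrArg D.σE h⟩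
  sp_onA := by
    rintro a ⟨⟨h, hh⟩, rfl⟩
    exact hh.elim

end GDissection

variable (k : Type*) [Field k] {𝒮 : GMarkedSurface S}

/-- The gentle algebra `A(D) = kQ/I` of a `G`-dissection. -/
def GentleAlg (D : GDissection 𝒮) : Type _ := D.arcs.triple.Alg k

/-- The skew-gentle algebra `Ā(D̄)` of the image of a `G`-dissection in the quotient orbifold. -/
def SkewGentleAlg (D : GDissection 𝒮) : Type _ := D.quotArcs.triple.Alg k

instance (D : GDissection 𝒮) : Ring (GentleAlg k D) :=
  inferInstanceAs (Ring (D.arcs.triple.Alg k))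
instance (D : GDissection 𝒮) : Algebra k (GentleAlg k D) :=
  inferInstanceAs (Algebra k (D.arcs.triple.Alg k))
instance (D : GDissection 𝒮) : Ring (SkewGentleAlg k D) :=
  inferInstanceAs (Ring (D.quotArcs.triple.Alg k))
instance (D : GDissection 𝒮) : Algebra k (SkewGentleAlg k D) :=
  inferInstanceAs (Algebra k (D.quotArcs.triple.Alg k))

variable [IsManifold (𝓡∂ 2) ∞ S]

/-- The automorphism of `A(D)` induced by `σ`. -/
def σAlg (D : GDissection 𝒮) : GentleAlg k D →ₐ[k] GentleAlg k D := D.σQ.hom k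

theorem σAlg_σAlg (D : GDissection 𝒮) (x : GentleAlg k D) : σAlg k D (σAlg k D x) = x :=
  D.σQ.hom_hom k x

/-- The action of `G` on `A(D)` by algebra automorphisms: the generator acts by `σ`. -/
instance gentleAction (D : GDissection 𝒮) : MulSemiringAction G (GentleAlg k D) where
  smul g x := if g = 1 then x else σAlg k D x
  one_smul x := if_pos rfl
  mul_smul g h x := by
    change (if g * h = 1 then x else σAlg k D x) =
      if g = 1 then (if h = 1 then x else σAlg k D x)
        else σAlg k D (if h = 1 then x else σAlg k D x)
    have hG : ∀ a b : G, a ≠ 1 → b ≠ 1 → a * b = 1 := by decide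
    by_cases hg : g = 1
    · simp [hg]
    · by_cases hh : h = 1
      · simp [hg, hh]
      · simp [hg, hh, hG g h hg hh, σAlg_σAlg]
  smul_zero g := by
    change (if g = 1 then (0 : GentleAlg k D) else σAlg k D 0) = 0
    simp
  smul_add g x y := by
    change (if g = 1 then x + y else σAlg k D (x + y)) =
      (if g = 1 then x else σAlg k D x) + (if g = 1 then y else σAlg k D y)
    split_ifs <;> simp
  smul_one g := by
    change (if g = 1 then (1 : GentleAlg k D) else σAlg k D 1) = 1
    simp
  smul_mul g x y := by
    change (if g = 1 then x * y else σAlg k D (x * y)) =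
      (if g = 1 then x else σAlg k D x) * (if g = 1 then y else σAlg k D y)
    split_ifs <;> simp

instance (D : GDissection 𝒮) : SMulCommClass G k (GentleAlg k D) where
  smul_comm g c x := by
    change (if g = 1 then c • x else σAlg k D (c • x)) = c • (if g = 1 then x else σAlg k D x)
    split_ifs <;> simp

/-- The skew-group algebra `A(D)G`: as a vector space `A(D) ⊗ kG`, with
`(λ ⊗ g)(μ ⊗ h) = λ g(μ) ⊗ gh`. -/
abbrev SkewGroupAlg (D : GDissection 𝒮) : Type _ := SkewMonoidAlgebra (GentleAlg k D) G

namespace GDissection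

/-- The element `a ⊗ g` of the skew-group algebra. -/
def tens {k : Type*} [Field k] {D : GDissection 𝒮} (a : GentleAlg k D) (g : G) :
    SkewGroupAlg k D :=
  SkewMonoidAlgebra.single g a

variable (D : GDissection 𝒮)

/-- The trivial path `e_i` in `A(D)`. -/
def eA (i : D.arcs.Arcs) : GentleAlg k D := D.arcs.triple.e k i

/-- The arrow `α` in `A(D)`. -/
def arrA (α : D.arcs.Corner) : GentleAlg k D := D.arcs.triple.arr k (Sum.inl α)

/-- The idempotent `e_i ⊗ (1 + (-1)^ε σ) / 2`. -/
def eHalf (i : D.arcs.Arcs) (ε : Fin 2) : SkewGroupAlg k D :=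
  (2 : k)⁻¹ • (tens (D.eA k i) 1 + (-1 : k) ^ (ε : ℕ) • tens (D.eA k i) gen)

/-- A choice of a representative in each `σ`-orbit of marked points. -/
def IsPointChoice (𝒮 : GMarkedSurface S) (Vp : Set S) : Prop :=
  Vp ⊆ 𝒮.M ∪ 𝒮.P ∧ ∀ v ∈ 𝒮.M ∪ 𝒮.P, v ∈ Vp ↔ 𝒮.σ v ∉ Vp

/-- A choice of a representative in each `σ`-orbit of two arcs. -/
def IsArcChoice (Qp : Set D.arcs.Arcs) : Prop :=
  (∀ i ∈ Qp, D.σArc i ≠ i) ∧ ∀ i, D.σArc i ≠ i → (i ∈ Qp ↔ D.σArc i ∉ Qp)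

/-- The sum of all `e_i ⊗ 1` where `i` is a chosen representative or an arc fixed by `σ`. -/
def eta (Qp : Set D.arcs.Arcs) : SkewGroupAlg k D :=
  ∑ᶠ i ∈ {i | i ∈ Qp ∨ D.σArc i = i}, tens (D.eA k i) 1

/-- The arc `i` of `D` lies over the arc `j` of the quotient. -/
def ArcOver (i : D.arcs.Arcs) (j : D.quotArcs.Arcs) : Prop :=
  ∃ (γ : D.arcs.E) (δ : D.quotArcs.E), proj γ.1 = δ.1 ∧ i = D.arcs.arc γ ∧ j = D.quotArcs.arc δ

/-- The arrow `α` of the quiver of `D` lies over the arrow `a` of the quiver of the quotient. -/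
def CornerOver (α : D.arcs.Corner) (a : D.quotArcs.Corner) : Prop :=
  proj α.1.1.1 = a.1.1.1 ∧ proj α.1.2.1 = a.1.2.1

/-- The trivial path `ē_i` in the skew-gentle algebra. -/
def eBar (i : D.quotArcs.Arcs) : SkewGentleAlg k D := D.quotArcs.triple.e k i

/-- An arrow in the skew-gentle algebra that is not a special loop. -/
def arrBar (a : D.quotArcs.Corner) : SkewGentleAlg k D := D.quotArcs.triple.arr k (Sum.inl a)

/-- Ends of arcs of the quotient at orbifold points; they index the special loops. -/
abbrev SpEnd := {h : D.quotArcs.E // (h : C(unitInterval, 𝒮.Quot)) 0 ∈ D.quotArcs.X}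

/-- For the arc `j` ending at an orbifold point by `x`, the idempotent `ē_{j_ε}`: it is the
special loop at `j` for `ε = 0`, and `ē_j` minus this loop for `ε = 1`. -/
def eBarSp (x : D.SpEnd) (ε : Fin 2) : SkewGentleAlg k D :=
  D.quotArcs.triple.eSp k (Sum.inr x) ε

/-- The explicit formulas for the map from the skew-gentle algebra of the quotient to the
skew-group algebra.  For an arrow `a : i ⟶ j`, `α` is the arrow over `a` at a
point of the chosen set `Vp`, and `σ α` is the other arrow over `a`.  If `i` (or `j`) ends at an
orbifold point by `x` (or `y`), then `a` is split into `a ē_{i_ε}` (or `ē_{j_ε} a`,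
or `ē_{j_ε'} a ē_{i_ε}`). -/
structure IsExplicit (Vp : Set S) (Qp : Set D.arcs.Arcs)
    (Φ : SkewGentleAlg k D → SkewGroupAlg k D) : Prop where
  idem : ∀ i j, D.ArcOver i j → i ∈ Qp → Φ (D.eBar k j) = tens (D.eA k i) 1
  idem_sp : ∀ i (x : D.SpEnd) ε, D.ArcOver i (D.quotArcs.arc x.1) →
    Φ (D.eBarSp k x ε) = D.eHalf k i ε
  arrow : ∀ a α i j, D.CornerOver α a → α.1.1.1 0 ∈ Vp →
    D.ArcOver i (D.quotArcs.arc a.1.1) → i ∈ Qp →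
    D.ArcOver j (D.quotArcs.arc a.1.2) → j ∈ Qp →
    Φ (D.arrBar k a) = tens (D.eA k j) 1 *
      (tens (D.arrA k α + D.arrA k (D.σCorner α)) 1 +
        tens (D.arrA k α + D.arrA k (D.σCorner α)) gen) * tens (D.eA k i) 1
  arrow_sp_src : ∀ a α i j (x : D.SpEnd) ε, D.CornerOver α a → α.1.1.1 0 ∈ Vp →
    D.ArcOver i (D.quotArcs.arc a.1.1) → D.quotArcs.arc x.1 = D.quotArcs.arc a.1.1 →
    D.ArcOver j (D.quotArcs.arc a.1.2) → j ∈ Qp →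
    Φ (D.arrBar k a * D.eBarSp k x ε) = tens (D.eA k j) 1 *
      (tens (D.arrA k α) 1 + (-1 : k) ^ (ε : ℕ) • tens (D.arrA k (D.σCorner α)) 1) *
      D.eHalf k i ε
  arrow_sp_tgt : ∀ a α i j (y : D.SpEnd) ε, D.CornerOver α a → α.1.1.1 0 ∈ Vp →
    D.ArcOver i (D.quotArcs.arc a.1.1) → i ∈ Qp →
    D.ArcOver j (D.quotArcs.arc a.1.2) → D.quotArcs.arc y.1 = D.quotArcs.arc a.1.2 →
    Φ (D.eBarSp k y ε * D.arrBar k a) = D.eHalf k j ε *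
      (tens (D.arrA k α) 1 + (-1 : k) ^ (ε : ℕ) • tens (D.arrA k (D.σCorner α)) 1) *
      tens (D.eA k i) 1
  arrow_sp_sp : ∀ a α i j (x y : D.SpEnd) ε ε', D.CornerOver α a → α.1.1.1 0 ∈ Vp →
    D.ArcOver i (D.quotArcs.arc a.1.1) → D.quotArcs.arc x.1 = D.quotArcs.arc a.1.1 →
    D.ArcOver j (D.quotArcs.arc a.1.2) → D.quotArcs.arc y.1 = D.quotArcs.arc a.1.2 →
    Φ (D.eBarSp k y ε' * D.arrBar k a * D.eBarSp k x ε) =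
      D.eHalf k j ε' * tens (D.arrA k α) 1 * D.eHalf k i ε

end GDissection
end Surface
end GSurf
end

open GSurf

noncomputable section

set_option linter.unusedSectionVars false

universe u

/-! ### Universal property of the algebra of a quiver triple. -/

namespace GSurf

namespace QuiverTriple

variable {k : Type*} [Field k] (Q : QuiverTriple.{u})

/-! The topology serves to show that `σ` acts freely on the ends of arcs at marked points. A fixed
point on the boundary is impossible: in a half-plane chart the derivative of `σ` there is an
involution of positive determinant preserving the half plane, hence the identity, and the mean value
inequality then makes `σ` the identity nearby, against the finiteness of the fixed points
(`GMarkedSurface.σ_ne_of_mem_boundary`). So no marked point is fixed, `p` is a local homeomorphism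
there, and the sectors that define arrows project and lift (`sector_quot`, `sector_lift`). An arrow
of the quotient other than a special loop therefore has exactly two lifts, exchanged by `σ`, one of
which starts at a chosen point. An arc of the quotient comes from two exchanged arcs or from one arc
reversed by `σ`, and the latter case is that of the arcs with an end in `X`. The structure `Folding`
records this combinatorics; the rest is algebra.

In the skew-group algebra, `σ` makes `e_i` and `e_{σ i}` isomorphic idempotents. For a fixed `i` it
commutes with `e_i`, which splits into two eigenidempotents of `σ` because `2` is invertible. Let `u
i` and `v i` be the mutually inverse elements that carry `i` to the representative of its orbit. An
arrow is sent to `v α u` for its chosen lift `α`, and a special loop to the half of `e_i` with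
eigenvalue `+1`. A quadratic relation lifts to the chosen lifts and the factor `u v` between them
cancels, so the relations hold (`isRep_corner`).

For surjectivity, the elements `b` such that every `v j * b * u i` is a value of `Φ` are closed
under products, since the `u l * v l` sum to `1`, and they include the generators (`exists_Φ_eq`).
For injectivity, the skew-group algebra is made to act on the sum over all vertices `i` upstairs of
the right ideals generated by the trivial paths at the images of `i`; the value of `Φ` at `x` then
acts on the vectors `vec y` as left multiplication by `x`, so `x` is recovered from the vector of
`1` (`action_Φ_vec`).

That `η` is basic follows from the grading by path length. An idempotent whose degree-zero part
vanishes is zero, so primitivity and non-isomorphism can be tested in degree zero, where only the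
`e_i` and `e_i σ` survive (`eB_mul_zeroPart`). -/

theorem toAlg_rel {x y : FreeAlgebra k (Q.Vert ⊕ Q.Arr)} (h : Rel k Q x y) :
    Q.toAlg k x = Q.toAlg k y :=
  RingQuot.mkAlgHom_rel k h

theorem e_mul_self (i : Q.Vert) : Q.e k i * Q.e k i = Q.e k i := by
  simpa [e] using Q.toAlg_rel (Rel.idem (k := k) i)

theorem e_mul_of_ne {i j : Q.Vert} (h : i ≠ j) : Q.e k i * Q.e k j = 0 := by
  simpa [e] using Q.toAlg_rel (Rel.orth (k := k) i j h)

theorem finsum_e : ∑ᶠ i, Q.e k i = 1 := by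
  have := Q.finite_vert
  have h := Q.toAlg_rel (Rel.one (k := k) (Q := Q))
  rwa [map_finsum _ (Set.toFinite _), map_one] at h

theorem e_tgt_mul_arr (a : Q.Arr) : Q.e k (Q.tgt a) * Q.arr k a = Q.arr k a := by
  simpa [e, arr] using Q.toAlg_rel (Rel.tgt (k := k) a)

theorem arr_mul_e_src (a : Q.Arr) : Q.arr k a * Q.e k (Q.src a) = Q.arr k a := by
  simpa [e, arr] using Q.toAlg_rel (Rel.src (k := k) a)

theorem arr_mul_arr {b a : Q.Arr} (h : Q.rel b a) : Q.arr k b * Q.arr k a = 0 := by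
  simpa [arr] using Q.toAlg_rel (Rel.quad (k := k) b a h)

theorem arr_mul_self {a : Q.Arr} (h : a ∈ Q.Sp) : Q.arr k a * Q.arr k a = Q.arr k a := by
  simpa [arr] using Q.toAlg_rel (Rel.special (k := k) a h)

/-- Families of elements of an algebra that satisfy the defining relations of `Q.Alg k`. -/
structure IsRep {C : Type*} [Ring C] (E : Q.Vert → C) (F : Q.Arr → C) : Prop where
  idem : ∀ i, E i * E i = E i
  orth : ∀ i j, i ≠ j → E i * E j = 0
  one : ∑ᶠ i, E i = 1
  tgt : ∀ a, E (Q.tgt a) * F a = F a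
  src : ∀ a, F a * E (Q.src a) = F a
  quad : ∀ b a, Q.rel b a → F b * F a = 0
  special : ∀ a ∈ Q.Sp, F a * F a = F a

variable {Q}

/-- The universal property of `Q.Alg k`. -/
def IsRep.lift {C : Type*} [Ring C] [Algebra k C] {E : Q.Vert → C} {F : Q.Arr → C}
    (h : Q.IsRep E F) : Q.Alg k →ₐ[k] C :=
  RingQuot.liftAlgHom k ⟨FreeAlgebra.lift k (Sum.elim E F), by
    have := Q.finite_vert
    have hE : ∀ i, FreeAlgebra.lift k (Sum.elim E F) (Q.preE k i) = E i := fun i => by simp [preE]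
    have hF : ∀ a, FreeAlgebra.lift k (Sum.elim E F) (Q.preA k a) = F a := fun a => by simp [preA]
    intro x y r
    cases r with
    | idem i => simp only [map_mul, hE, h.idem]
    | orth i j hij => simp only [map_mul, hE, h.orth i j hij, map_zero]
    | one => rw [map_finsum _ (Set.toFinite _), map_one]; simp only [hE, h.one]
    | tgt a => simp only [map_mul, hE, hF, h.tgt]
    | src a => simp only [map_mul, hE, hF, h.src]
    | quad b a hr => simp only [map_mul, hF, h.quad b a hr, map_zero]
    | special a ha => simp only [map_mul, hF, h.special a ha]⟩

section

variable {C : Type*} [Ring C] [Algebra k C] {E : Q.Vert → C} {F : Q.Arr → C} (h : Q.IsRep E F)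

theorem IsRep.lift_e (i : Q.Vert) : h.lift (Q.e k i) = E i := by
  simp only [IsRep.lift, e, toAlg]
  rw [RingQuot.liftAlgHom_mkAlgHom_apply]
  simp [preE]

theorem IsRep.lift_arr (a : Q.Arr) : h.lift (Q.arr k a) = F a := by
  simp only [IsRep.lift, arr, toAlg]
  rw [RingQuot.liftAlgHom_mkAlgHom_apply]
  simp [preA]

end

/-- Induction over the trivial paths and the arrows; the unit is a sum of trivial paths. -/
theorem Alg.induction {p : Q.Alg k → Prop} (smul : ∀ (c : k) x, p x → p (c • x))
    (add : ∀ x y, p x → p y → p (x + y)) (mul : ∀ x y, p x → p y → p (x * y))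
    (zero : p 0) (e : ∀ i, p (Q.e k i)) (arr : ∀ a, p (Q.arr k a)) (x : Q.Alg k) : p x := by
  have := Q.finite_vert
  have hone : p 1 := by
    rw [← Q.finsum_e]
    exact finsum_induction p zero (fun _ _ => add _ _) e
  obtain ⟨y, rfl⟩ := RingQuot.mkAlgHom_surjective k (Rel k Q) x
  induction y using FreeAlgebra.induction with
  | grade0 r => rw [AlgHom.commutes, Algebra.algebraMap_eq_smul_one]; exact smul _ _ hone
  | grade1 z =>
    cases z with
    | inl i => exact e i
    | inr a => exact arr a
  | mul a b ha hb => rw [map_mul]; exact mul _ _ ha hb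
  | add a b ha hb => rw [map_add]; exact add _ _ ha hb

/-- The trivial paths are nonzero. -/
theorem e_ne_zero (i : Q.Vert) : Q.e k i ≠ 0 := by
  classical
  have := Q.finite_vert
  have := Fintype.ofFinite Q.Vert
  -- Killing all arrows respects every relation, including `x² = x`, and leaves a product of copies
  -- of `k` in which the trivial paths are the coordinate idempotents.
  have h : Q.IsRep (C := Q.Vert → k) (fun i => Pi.single i 1) (fun _ => 0) := by
    refine ⟨fun i => ?_, fun i j h => ?_, ?_, fun a => ?_, fun a => ?_, fun b a h => ?_,
      fun a h => ?_⟩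
    · simp [← Pi.single_mul]
    · ext l
      by_cases hl : l = i
      · subst hl; simp [h]
      · simp [hl]
    · rw [finsum_eq_sum_of_fintype]
      exact Finset.univ_sum_single (1 : Q.Vert → k)
    all_goals simp
  intro h0
  have h1 := h.lift_e (k := k) i
  rw [h0, map_zero] at h1
  simpa using congrFun h1 i

end QuiverTriple

/-! ## Skew group algebras of the group of order two -/

section Skew

theorem eq_one_or_gen (g : G) : g = 1 ∨ g = gen := by
  revert g; decide

theorem gen_mul_gen : gen * gen = 1 := by decide

theorem gen_ne_one : gen ≠ 1 := by decide

variable {k A C : Type*} [Field k] [Ring A] [Algebra k A] [MulSemiringAction G A]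
  [SMulCommClass G k A] [Ring C] [Algebra k C]

/-- The homomorphism from the group of order two that is given by an involution. -/
def involutionHom {t : C} (ht : t * t = 1) : G →* C where
  toFun g := if g = 1 then 1 else t
  map_one' := if_pos rfl
  map_mul' g h := by
    rcases eq_one_or_gen g with rfl | rfl <;> rcases eq_one_or_gen h with rfl | rfl <;>
      simp [gen_ne_one, gen_mul_gen, ht]

/-- The universal property of the skew group algebra of a group of order two. -/
theorem exists_skewLift (f : A →ₐ[k] C) {t : C} (ht : t * t = 1)
    (h : ∀ a, t * f a = f (gen • a) * t) :
    ∃ F : SkewMonoidAlgebra A G →ₐ[k] C,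
      (∀ a, F (SkewMonoidAlgebra.single 1 a) = f a) ∧ F (SkewMonoidAlgebra.single gen 1) = t := by
  refine ⟨SkewMonoidAlgebra.liftNCAlgHom f (involutionHom ht) ?_, fun a => ?_, ?_⟩
  · intro x y
    rcases eq_one_or_gen y with rfl | rfl
    · simp [involutionHom]
    · simp [involutionHom, gen_ne_one, h]
  · change SkewMonoidAlgebra.liftNC _ _ _ = _
    rw [SkewMonoidAlgebra.liftNC_single]
    simp [involutionHom]
  · change SkewMonoidAlgebra.liftNC _ _ _ = _
    rw [SkewMonoidAlgebra.liftNC_single]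
    simp [involutionHom, gen_ne_one]

theorem single_eq_mul_gen (a : A) :
    (SkewMonoidAlgebra.single gen a : SkewMonoidAlgebra A G) =
      SkewMonoidAlgebra.single 1 a * SkewMonoidAlgebra.single gen 1 := by
  rw [SkewMonoidAlgebra.single_mul_single]; simp

theorem single_one_mul_single_one (a b : A) :
    (SkewMonoidAlgebra.single 1 a * SkewMonoidAlgebra.single 1 b : SkewMonoidAlgebra A G) =
      SkewMonoidAlgebra.single 1 (a * b) := by
  rw [SkewMonoidAlgebra.single_mul_single]; simp

theorem gen_mul_single_one (a : A) :
    (SkewMonoidAlgebra.single gen 1 * SkewMonoidAlgebra.single 1 a : SkewMonoidAlgebra A G) =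
      SkewMonoidAlgebra.single 1 (gen • a) * SkewMonoidAlgebra.single gen 1 := by
  simp only [SkewMonoidAlgebra.single_mul_single]; simp

theorem single_gen_mul_self :
    (SkewMonoidAlgebra.single gen 1 * SkewMonoidAlgebra.single gen 1 : SkewMonoidAlgebra A G)
      = 1 := by
  rw [SkewMonoidAlgebra.single_mul_single, gen_mul_gen]; simp

/-- Every element of the skew group algebra is `a ⊗ 1 + a' ⊗ σ`. -/
theorem exists_eq_add_mul_gen (b : SkewMonoidAlgebra A G) :
    ∃ a a', b = SkewMonoidAlgebra.single 1 a +
      SkewMonoidAlgebra.single 1 a' * SkewMonoidAlgebra.single gen 1 := by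
  induction b using SkewMonoidAlgebra.induction_on' with
  | single g a =>
    rcases eq_one_or_gen g with rfl | rfl
    · exact ⟨a, 0, by simp⟩
    · exact ⟨0, a, by rw [← single_eq_mul_gen]; simp⟩
  | add x y hx hy =>
    obtain ⟨a, a', rfl⟩ := hx
    obtain ⟨b, b', rfl⟩ := hy
    refine ⟨a + b, a' + b', ?_⟩
    simp only [SkewMonoidAlgebra.single_add, add_mul]
    abel

theorem single_one_injective {a a' b b' : A}
    (h : (SkewMonoidAlgebra.single 1 a + SkewMonoidAlgebra.single 1 a' *
      SkewMonoidAlgebra.single gen 1 : SkewMonoidAlgebra A G) = SkewMonoidAlgebra.single 1 b +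
      SkewMonoidAlgebra.single 1 b' * SkewMonoidAlgebra.single gen 1) : a = b := by
  rw [← single_eq_mul_gen, ← single_eq_mul_gen] at h
  have := congrArg (fun x => SkewMonoidAlgebra.coeff x 1) h
  simpa [SkewMonoidAlgebra.coeff_single, Finsupp.single_apply, gen_ne_one] using this

end Skew

end GSurf

/-! ### The quotient of a quiver by an involution, and transport between the vertices of an orbit.
-/

namespace GSurf

open QuiverTriple

/-- A presentation of the quiver of `R` as the quotient of the quiver of `Q` by the involution `s`.
The arrows of `R` are split into ordinary ones, over each of which there is a chosen arrow
`up c` of `Q`, and special loops, one at the image of each vertex fixed by `s`. -/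
structure Folding (Q : QuiverTriple.{u}) (s : Q.Involution) (R : QuiverTriple.{u}) where
  Ord : Type u
  Loop : Type u
  arrEquiv : Ord ⊕ Loop ≃ R.Arr
  mem_sp : ∀ a, a ∈ R.Sp ↔ ∃ l, a = arrEquiv (Sum.inr l)
  sp_empty : ∀ a, a ∉ Q.Sp
  down : Q.Vert → R.Vert
  sec : R.Vert → Q.Vert
  down_sec : ∀ j, down (sec j) = j
  down_onV : ∀ i, down (s.onV i) = down i
  eq_or : ∀ i, i = sec (down i) ∨ i = s.onV (sec (down i))
  loop_fixed : ∀ l, s.onV (sec (R.src (arrEquiv (Sum.inr l)))) = sec (R.src (arrEquiv (Sum.inr l)))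
  loop_injective : ∀ l l', R.src (arrEquiv (Sum.inr l)) = R.src (arrEquiv (Sum.inr l')) → l = l'
  exists_loop : ∀ i, s.onV i = i → ∃ l, R.src (arrEquiv (Sum.inr l)) = down i
  up : Ord → Q.Arr
  down_src_up : ∀ c, down (Q.src (up c)) = R.src (arrEquiv (Sum.inl c))
  down_tgt_up : ∀ c, down (Q.tgt (up c)) = R.tgt (arrEquiv (Sum.inl c))
  base : Q.Arr → Ord
  pos : Q.Arr → Prop
  pos_up : ∀ c, pos (up c)
  base_up : ∀ c, base (up c) = c
  -- This is the freeness of the involution on arrows: the two arrows over an ordinary arrow are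
  -- told apart by `pos`.
  pos_onA : ∀ a, pos (s.onA a) ↔ ¬ pos a
  base_onA : ∀ a, base (s.onA a) = base a
  up_base : ∀ a, pos a → up (base a) = a
  rel_up : ∀ b a, R.rel b a → ∃ c d, b = arrEquiv (Sum.inl c) ∧ a = arrEquiv (Sum.inl d) ∧
    Q.rel (up c) (up d)
  -- The two arrows of a relation lie on the same side of `pos`, since in the application they start
  -- at the same marked point.
  rel_base : ∀ b a, Q.rel b a → (pos b ↔ pos a) ∧
    R.rel (arrEquiv (Sum.inl (base b))) (arrEquiv (Sum.inl (base a)))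

namespace Folding

variable {Q R : QuiverTriple.{u}} {s : Q.Involution} (φ : Folding Q s R)

/-- The ordinary arrow of `R` with index `c`. -/
abbrev ord (c : φ.Ord) : R.Arr := φ.arrEquiv (Sum.inl c)

/-- The special loop of `R` with index `l`. -/
abbrev loop (l : φ.Loop) : R.Arr := φ.arrEquiv (Sum.inr l)

theorem sec_injective : Function.Injective φ.sec := Function.LeftInverse.injective φ.down_sec

theorem sec_down_onV {i : Q.Vert} (h : φ.sec (φ.down i) ≠ i) : φ.sec (φ.down i) = s.onV i := by
  rcases φ.eq_or i with h' | h'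
  · exact absurd h'.symm h
  · conv_rhs => rw [h', s.onV_onV]

theorem sec_down_of_fixed {i : Q.Vert} (h : s.onV i = i) : φ.sec (φ.down i) = i := by
  by_contra h'
  rw [φ.sec_down_onV h', h] at h'
  exact h' rfl

section Skew

variable {k A : Type*} [Field k] [Ring A] [Algebra k A] [MulSemiringAction G A]
  [SMulCommClass G k A] (π : Q.Alg k ≃ₐ[k] A)

/-- The skew group algebra of the path algebra of `Q`. -/
local notation "𝔹" => SkewMonoidAlgebra A G

/-- The trivial path `e_i ⊗ 1`. -/
def eB (i : Q.Vert) : 𝔹 := SkewMonoidAlgebra.single 1 (π (Q.e k i))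

/-- The arrow `α ⊗ 1`. -/
def aB (a : Q.Arr) : 𝔹 := SkewMonoidAlgebra.single 1 (π (Q.arr k a))

/-- The group element `1 ⊗ σ`. -/
def σB (A : Type*) [Ring A] : SkewMonoidAlgebra A G := SkewMonoidAlgebra.single gen 1

theorem eB_mul_self (i : Q.Vert) : (eB π i * eB π i : 𝔹) = eB π i := by
  rw [eB, single_one_mul_single_one, ← map_mul, Q.e_mul_self]

theorem eB_mul_of_ne {i j : Q.Vert} (h : i ≠ j) : (eB π i * eB π j : 𝔹) = 0 := by
  rw [eB, eB, single_one_mul_single_one, ← map_mul, Q.e_mul_of_ne h, map_zero, SkewMonoidAlgebra.single_zero]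

theorem finsum_eB : ∑ᶠ i, (eB π i : 𝔹) = 1 := by
  have := Q.finite_vert
  have h := map_finsum ((SkewMonoidAlgebra.singleAddHom (k := A) (1 : G)).comp
    (π : Q.Alg k →+ A)) (Set.toFinite (Function.support (Q.e k)))
  rw [Q.finsum_e, AddMonoidHom.comp_apply, AddMonoidHom.coe_coe, map_one] at h
  exact h.symm

theorem eB_tgt_mul_aB (a : Q.Arr) : (eB π (Q.tgt a) * aB π a : 𝔹) = aB π a := by
  rw [eB, aB, single_one_mul_single_one, ← map_mul, Q.e_tgt_mul_arr]

theorem aB_mul_eB_src (a : Q.Arr) : (aB π a * eB π (Q.src a) : 𝔹) = aB π a := by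
  rw [eB, aB, single_one_mul_single_one, ← map_mul, Q.arr_mul_e_src]

theorem eB_mul_aB_of_ne {i : Q.Vert} {a : Q.Arr} (h : i ≠ Q.tgt a) : (eB π i * aB π a : 𝔹) = 0 := by
  rw [← eB_tgt_mul_aB, ← mul_assoc, eB_mul_of_ne π h, zero_mul]

theorem aB_mul_eB_of_ne {i : Q.Vert} {a : Q.Arr} (h : Q.src a ≠ i) : (aB π a * eB π i : 𝔹) = 0 := by
  rw [← aB_mul_eB_src, mul_assoc, eB_mul_of_ne π h, mul_zero]

theorem aB_mul_aB {b a : Q.Arr} (h : Q.rel b a) : (aB π b * aB π a : 𝔹) = 0 := by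
  rw [aB, aB, single_one_mul_single_one, ← map_mul, Q.arr_mul_arr h, map_zero, SkewMonoidAlgebra.single_zero]

theorem σB_mul_σB : (σB A * σB A : 𝔹) = 1 := single_gen_mul_self

theorem σB_mul_σB_assoc (x : 𝔹) : σB A * (σB A * x) = x := by rw [← mul_assoc, σB_mul_σB, one_mul]

/-- The generator of the group acts through `s`. -/
def ActsBy (s : Q.Involution) : Prop :=
  ∀ a : Q.Alg k, gen • π a = π (s.hom k a)

variable {π}

theorem σB_mul_eB (hs : ActsBy π s) (i : Q.Vert) : (σB A * eB π i : 𝔹) = eB π (s.onV i) * σB A := by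
  rw [σB, eB, gen_mul_single_one, hs (Q.e k i), s.hom_e k]; rfl

theorem σB_mul_aB (hs : ActsBy π s) (a : Q.Arr) : (σB A * aB π a : 𝔹) = aB π (s.onA a) * σB A := by
  rw [σB, aB, gen_mul_single_one, hs (Q.arr k a), s.hom_arr k]; rfl

variable (π) in
/-- An induction principle for the skew group algebra. -/
theorem skew_induction {p : 𝔹 → Prop} (smul : ∀ (c : k) x, p x → p (c • x))
    (add : ∀ x y, p x → p y → p (x + y)) (mul : ∀ x y, p x → p y → p (x * y))
    (zero : p 0) (e : ∀ i, p (eB π i)) (a : ∀ a, p (aB π a)) (σ : p (σB A)) (x : 𝔹) : p x := by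
  have h : ∀ a : Q.Alg k, p (SkewMonoidAlgebra.single 1 (π a)) := fun y => by
    induction y using Alg.induction with
    | smul c x hx => rw [map_smul, ← SkewMonoidAlgebra.smul_single]; exact smul _ _ hx
    | add x y hx hy => rw [map_add, SkewMonoidAlgebra.single_add]; exact add _ _ hx hy
    | mul x y hx hy => rw [map_mul, ← single_one_mul_single_one]; exact mul _ _ hx hy
    | zero => rw [map_zero, SkewMonoidAlgebra.single_zero]; exact zero
    | e i => exact e i
    | arr b => exact a b
  obtain ⟨y, z, rfl⟩ := exists_eq_add_mul_gen x
  obtain ⟨y, rfl⟩ := π.surjective y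
  obtain ⟨z, rfl⟩ := π.surjective z
  exact add _ _ (h y) (mul _ _ (h z) σ)

variable (π)

open Classical in
/-- The element of `e_i 𝔹 e_{i⁺}` that identifies `i` with the representative `i⁺` of its orbit. -/
def u (i : Q.Vert) : 𝔹 := if φ.sec (φ.down i) = i then eB π i else eB π i * σB A

open Classical in
/-- The inverse of `u i`. -/
def v (i : Q.Vert) : 𝔹 := if φ.sec (φ.down i) = i then eB π i else σB A * eB π i

theorem eB_mul_u (i : Q.Vert) : (eB π i * φ.u π i : 𝔹) = φ.u π i := by
  unfold u; split_ifs <;> simp only [← mul_assoc, eB_mul_self]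

theorem v_mul_eB (i : Q.Vert) : (φ.v π i * eB π i : 𝔹) = φ.v π i := by
  unfold v; split_ifs <;> simp only [mul_assoc, eB_mul_self]

/-- Together with `v_mul_u`, this makes `u i` and `v i` inverse isomorphisms between the idempotents
at `i` and at its representative. The cancellation lets the images of consecutive arrows multiply as
their lifts do. -/
theorem u_mul_v (i : Q.Vert) : (φ.u π i * φ.v π i : 𝔹) = eB π i := by
  unfold u v; split_ifs <;> simp only [mul_assoc, eB_mul_self, σB_mul_σB_assoc]

variable {π}

theorem u_mul_eB (hs : ActsBy π s) (i : Q.Vert) :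
    (φ.u π i * eB π (φ.sec (φ.down i)) : 𝔹) = φ.u π i := by
  unfold u; split_ifs with h
  · rw [h, eB_mul_self]
  · rw [φ.sec_down_onV h, mul_assoc, σB_mul_eB hs, s.onV_onV, ← mul_assoc, eB_mul_self]

theorem eB_mul_v (hs : ActsBy π s) (i : Q.Vert) :
    (eB π (φ.sec (φ.down i)) * φ.v π i : 𝔹) = φ.v π i := by
  unfold v; split_ifs with h
  · rw [h, eB_mul_self]
  · rw [φ.sec_down_onV h, σB_mul_eB hs, ← mul_assoc, eB_mul_self]

theorem v_mul_u (hs : ActsBy π s) (i : Q.Vert) :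
    (φ.v π i * φ.u π i : 𝔹) = eB π (φ.sec (φ.down i)) := by
  unfold u v; split_ifs with h
  · rw [h, eB_mul_self]
  · rw [mul_assoc, ← mul_assoc (eB π i), eB_mul_self, ← mul_assoc, σB_mul_eB hs, mul_assoc,
      σB_mul_σB, mul_one, φ.sec_down_onV h]

theorem u_sec (j : R.Vert) : (φ.u π (φ.sec j) : 𝔹) = eB π (φ.sec j) := by
  rw [u, if_pos (by rw [φ.down_sec])]

theorem v_sec (j : R.Vert) : (φ.v π (φ.sec j) : 𝔹) = eB π (φ.sec j) := by
  rw [v, if_pos (by rw [φ.down_sec])]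

variable (π)

/-- The idempotent `e_i ⊗ (1 + (-1)^ε σ) / 2`. -/
def half (i : Q.Vert) (ε : Fin 2) : 𝔹 :=
  (2 : k)⁻¹ • (eB π i + (-1 : k) ^ (ε : ℕ) • (eB π i * σB A))

variable {π}

theorem half_add_half (h2 : (2 : k) ≠ 0) (i : Q.Vert) :
    (half π i 0 + half π i 1 : 𝔹) = eB π i := by
  simp only [half, ← smul_add]
  rw [inv_smul_eq_iff₀ h2, two_smul]
  simp only [Fin.val_zero, pow_zero, one_smul, Fin.val_one, pow_one]
  rw [neg_smul, one_smul]
  abel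

theorem eB_mul_half (i : Q.Vert) (ε : Fin 2) : (eB π i * half π i ε : 𝔹) = half π i ε := by
  simp only [half, mul_smul_comm, mul_add, ← mul_assoc, eB_mul_self]

theorem eB_mul_σB (hs : ActsBy π s) {i : Q.Vert} (hi : s.onV i = i) :
    (eB π i * σB A : 𝔹) = σB A * eB π i := by
  rw [σB_mul_eB hs, hi]

theorem half_mul_eB (hs : ActsBy π s) {i : Q.Vert} (hi : s.onV i = i) (ε : Fin 2) :
    (half π i ε * eB π i : 𝔹) = half π i ε := by
  simp only [half, smul_mul_assoc, add_mul, eB_mul_σB hs hi, mul_assoc, eB_mul_self]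

theorem neg_one_pow_mul_self {k : Type*} [Field k] (ε : Fin 2) : (-1 : k) ^ (ε : ℕ) * (-1) ^ (ε : ℕ) = 1 := by
  rw [← mul_pow]; simp

/-- Right multiplication by `σ` exchanges the two summands up to the sign, at any vertex. The left
version below also needs the vertex to be fixed. -/
theorem half_mul_σB (i : Q.Vert) (ε : Fin 2) :
    (half π i ε * σB A : 𝔹) = (-1 : k) ^ (ε : ℕ) • half π i ε := by
  simp only [half, smul_mul_assoc, add_mul, mul_assoc, σB_mul_σB, mul_one]
  rw [smul_comm, smul_add ((-1 : k) ^ (ε : ℕ)), smul_smul ((-1 : k) ^ (ε : ℕ)),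
    neg_one_pow_mul_self, one_smul, add_comm]

theorem σB_mul_half (hs : ActsBy π s) {i : Q.Vert} (hi : s.onV i = i) (ε : Fin 2) :
    (σB A * half π i ε : 𝔹) = (-1 : k) ^ (ε : ℕ) • half π i ε := by
  rw [← half_mul_σB]
  simp only [half, mul_smul_comm, smul_mul_assoc, add_mul, mul_add, ← mul_assoc,
    ← eB_mul_σB hs hi]

theorem half_mul_half (h2 : (2 : k) ≠ 0) (hs : ActsBy π s) {i : Q.Vert} (hi : s.onV i = i)
    (ε ε' : Fin 2) : (half π i ε * half π i ε' : 𝔹) = if ε = ε' then half π i ε else 0 := by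
  -- Since `σ` acts on a half by its sign, the product is the half times `(1 ± 1) / 2`, which is `1`
  -- for equal signs and `0` for opposite ones.
  have h : (half π i ε * half π i ε' : 𝔹) =
      ((2 : k)⁻¹ * (1 + (-1) ^ (ε' : ℕ) * (-1) ^ (ε : ℕ))) • half π i ε := by
    conv_lhs => rw [half.eq_1 π i ε']
    rw [mul_smul_comm, mul_add, half_mul_eB hs hi, mul_smul_comm, ← mul_assoc, half_mul_eB hs hi,
      half_mul_σB, mul_smul, add_smul, one_smul, mul_smul]
  rw [h]
  fin_cases ε <;> fin_cases ε' <;> norm_num <;> rw [inv_mul_cancel₀ h2, one_smul]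

end Skew
end Folding
end GSurf

/-! ### The comparison homomorphism into the corner. -/

namespace GSurf

open QuiverTriple

section Corner

variable {k B : Type*} [Field k] [Ring B] [Algebra k B] {η : B} (hη : IsIdempotentElem η)

theorem corner_coe_smul (c : k) (x : hη.Corner) : (c • x).1 = c • x.1 := by
  have hx := ((Subsemigroup.mem_corner_iff hη).1 x.2).1
  change η * algebraMap k B c * η * x.1 = c • x.1
  rw [mul_assoc, hx, ← Algebra.commutes, mul_assoc, hx, Algebra.smul_def]

/-- The inclusion of a corner, as an additive homomorphism. -/
def cornerVal : hη.Corner →+ B where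
  toFun x := x.1
  map_zero' := rfl
  map_add' _ _ := rfl

end Corner

namespace Folding

variable {Q R : QuiverTriple.{u}} {s : Q.Involution} (φ : Folding Q s R)

variable {k A : Type*} [Field k] [Ring A] [Algebra k A] [MulSemiringAction G A]
  [SMulCommClass G k A] (π : Q.Alg k ≃ₐ[k] A)

local notation "𝔹" => SkewMonoidAlgebra A G

/-- The sum of the idempotents of the chosen representatives of the vertices. -/
def η : 𝔹 := ∑ᶠ j, eB π (φ.sec j)

theorem eB_sec_mul_η (j : R.Vert) : (eB π (φ.sec j) * φ.η π : 𝔹) = eB π (φ.sec j) := by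
  have := R.finite_vert
  have := Fintype.ofFinite R.Vert
  rw [η, finsum_eq_sum_of_fintype, Finset.mul_sum, Finset.sum_eq_single j, eB_mul_self]
  · exact fun i _ hi => eB_mul_of_ne π fun h => hi (φ.sec_injective h).symm
  · simp

theorem η_mul_eB_sec (j : R.Vert) : (φ.η π * eB π (φ.sec j) : 𝔹) = eB π (φ.sec j) := by
  have := R.finite_vert
  have := Fintype.ofFinite R.Vert
  rw [η, finsum_eq_sum_of_fintype, Finset.sum_mul, Finset.sum_eq_single j, eB_mul_self]
  · exact fun i _ hi => eB_mul_of_ne π fun h => hi (φ.sec_injective h)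
  · simp

theorem η_idem : IsIdempotentElem (φ.η π : 𝔹) := by
  have := R.finite_vert
  have := Fintype.ofFinite R.Vert
  rw [IsIdempotentElem]
  have h : φ.η π = ∑ j, eB π (φ.sec j) := finsum_eq_sum_of_fintype _
  conv_lhs => rw [h, Finset.sum_mul, ← h]
  rw [h, ← h]
  simp only [eB_sec_mul_η]
  exact h.symm

/-- The image of an arrow in the skew group algebra. -/
def arrowImage (a : R.Arr) : 𝔹 :=
  Sum.elim (fun c => φ.v π (Q.tgt (φ.up c)) * aB π (φ.up c) * φ.u π (Q.src (φ.up c)))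
    (fun l => half π (φ.sec (R.src (φ.loop l))) 0) (φ.arrEquiv.symm a)

theorem arrowImage_ord (c : φ.Ord) : (φ.arrowImage π (φ.ord c) : 𝔹) =
    φ.v π (Q.tgt (φ.up c)) * aB π (φ.up c) * φ.u π (Q.src (φ.up c)) := by
  simp [arrowImage]

theorem arrowImage_loop (l : φ.Loop) : (φ.arrowImage π (φ.loop l) : 𝔹) =
    half π (φ.sec (R.src (φ.loop l))) 0 := by
  simp [arrowImage]

variable {π}

theorem arr_cases {p : R.Arr → Prop} (ord : ∀ c, p (φ.ord c)) (loop : ∀ l, p (φ.loop l))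
    (a : R.Arr) : p a := by
  obtain ⟨c | l, rfl⟩ := φ.arrEquiv.surjective a
  exacts [ord c, loop l]

theorem tgt_loop (l : φ.Loop) : R.tgt (φ.loop l) = R.src (φ.loop l) :=
  (R.sp_loop ((φ.mem_sp _).2 ⟨l, rfl⟩)).symm

theorem eB_mul_arrowImage (hs : ActsBy π s) (a : R.Arr) :
    (eB π (φ.sec (R.tgt a)) * φ.arrowImage π a : 𝔹) = φ.arrowImage π a := by
  induction a using φ.arr_cases with
  | ord c => rw [arrowImage_ord, ← φ.down_tgt_up, ← mul_assoc, ← mul_assoc, φ.eB_mul_v hs]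
  | loop l => rw [arrowImage_loop, tgt_loop, eB_mul_half]

theorem arrowImage_mul_eB (hs : ActsBy π s) (a : R.Arr) :
    (φ.arrowImage π a * eB π (φ.sec (R.src a)) : 𝔹) = φ.arrowImage π a := by
  induction a using φ.arr_cases with
  | ord c => rw [arrowImage_ord, ← φ.down_src_up, mul_assoc, φ.u_mul_eB hs]
  | loop l => rw [arrowImage_loop, half_mul_eB hs (φ.loop_fixed l)]

/-- The chosen lifts of the two arrows already compose to a relation upstairs. The middle factor `u
v` is the trivial path at the common vertex, which the first arrow absorbs. -/
theorem arrowImage_mul_arrowImage {b a : R.Arr} (h : R.rel b a) :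
    (φ.arrowImage π b * φ.arrowImage π a : 𝔹) = 0 := by
  obtain ⟨c, d, rfl, rfl, hr⟩ := φ.rel_up _ _ h
  rw [arrowImage_ord, arrowImage_ord, ← Q.rel_comp hr]
  have h1 : (φ.u π (Q.tgt (φ.up d)) * (φ.v π (Q.tgt (φ.up d)) * (aB π (φ.up d) *
      φ.u π (Q.src (φ.up d)))) : 𝔹) = aB π (φ.up d) * φ.u π (Q.src (φ.up d)) := by
    rw [← mul_assoc, u_mul_v, ← mul_assoc, eB_tgt_mul_aB]
  simp only [mul_assoc, h1]
  rw [← mul_assoc (aB π (φ.up c)), aB_mul_aB π hr, zero_mul, mul_zero]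

theorem isRep_corner (h2 : (2 : k) ≠ 0) (hs : ActsBy π s) :
    R.IsRep (C := (φ.η_idem π).Corner)
      (fun j => ⟨eB π (φ.sec j), (Subsemigroup.mem_corner_iff (φ.η_idem π)).2
        ⟨φ.η_mul_eB_sec π j, φ.eB_sec_mul_η π j⟩⟩)
      (fun a => ⟨φ.arrowImage π a, (Subsemigroup.mem_corner_iff (φ.η_idem π)).2 ⟨by
        rw [← φ.eB_mul_arrowImage hs, ← mul_assoc, η_mul_eB_sec], by
        rw [← φ.arrowImage_mul_eB hs, mul_assoc, eB_sec_mul_η]⟩⟩) where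
  idem i := Subtype.ext (eB_mul_self π _)
  orth i j h := Subtype.ext (eB_mul_of_ne π fun h' => h (φ.sec_injective h'))
  one := by
    have := R.finite_vert
    refine Subtype.ext ?_
    exact map_finsum (cornerVal (φ.η_idem π)) (Set.toFinite _)
  tgt a := Subtype.ext (φ.eB_mul_arrowImage hs a)
  src a := Subtype.ext (φ.arrowImage_mul_eB hs a)
  quad b a h := Subtype.ext (φ.arrowImage_mul_arrowImage h)
  special a h := by
    obtain ⟨l, rfl⟩ := (φ.mem_sp a).1 h
    refine Subtype.ext ?_
    change φ.arrowImage π (φ.loop l) * φ.arrowImage π (φ.loop l) = φ.arrowImage π (φ.loop l)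
    rw [arrowImage_loop, half_mul_half h2 hs (φ.loop_fixed l), if_pos rfl]

/-- The comparison homomorphism from the algebra of `R` to the corner of the skew group algebra. -/
def Φ (h2 : (2 : k) ≠ 0) (hs : ActsBy π s) : R.Alg k →ₐ[k] (φ.η_idem π).Corner :=
  (φ.isRep_corner h2 hs).lift

section

variable (h2 : (2 : k) ≠ 0) (hs : ActsBy π s)

theorem Φ_e (j : R.Vert) : (φ.Φ h2 hs (R.e k j)).1 = eB π (φ.sec j) :=
  congrArg Subtype.val ((φ.isRep_corner h2 hs).lift_e j)

theorem Φ_arr (a : R.Arr) : (φ.Φ h2 hs (R.arr k a)).1 = φ.arrowImage π a :=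
  congrArg Subtype.val ((φ.isRep_corner h2 hs).lift_arr a)

theorem Φ_mul (x y : R.Alg k) : (φ.Φ h2 hs (x * y)).1 = (φ.Φ h2 hs x).1 * (φ.Φ h2 hs y).1 := by
  rw [map_mul]; rfl

theorem Φ_add (x y : R.Alg k) : (φ.Φ h2 hs (x + y)).1 = (φ.Φ h2 hs x).1 + (φ.Φ h2 hs y).1 := by
  rw [map_add]; rfl

theorem Φ_sub (x y : R.Alg k) : (φ.Φ h2 hs (x - y)).1 = (φ.Φ h2 hs x).1 - (φ.Φ h2 hs y).1 := by
  rw [map_sub]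
  exact map_sub (cornerVal (φ.η_idem π)) _ _

theorem Φ_smul (c : k) (x : R.Alg k) : (φ.Φ h2 hs (c • x)).1 = c • (φ.Φ h2 hs x).1 := by
  rw [map_smul, corner_coe_smul]

theorem Φ_zero : (φ.Φ h2 hs 0).1 = 0 := by
  rw [map_zero]; rfl

theorem Φ_eSp (l : φ.Loop) (ε : Fin 2) :
    (φ.Φ h2 hs (R.eSp k (φ.loop l) ε)).1 = half π (φ.sec (R.src (φ.loop l))) ε := by
  fin_cases ε
  · simp only [eSp, Fin.zero_eta, if_true, Φ_arr, arrowImage_loop]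
  · simp only [eSp, Fin.mk_one, Fin.isValue, one_ne_zero, if_false, Φ_sub, Φ_arr, arrowImage_loop,
      Φ_e]
    rw [← half_add_half h2, add_sub_cancel_left]

/-! ### Surjectivity -/

/-- The case of a trivial path in the proof that every `v j * b * u i` is a value of `Φ`. The
product vanishes unless `i`, `j`, `l` coincide, and is then the idempotent of the representative. -/
theorem v_mul_eB_mul_u (l i j : Q.Vert) :
    ∃ x, (φ.Φ h2 hs x).1 = φ.v π j * eB π l * φ.u π i := by
  by_cases hj : j = l
  · subst hj
    rw [v_mul_eB]
    by_cases hi : j = i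
    · subst hi
      exact ⟨R.e k (φ.down j), by rw [Φ_e, φ.v_mul_u hs]⟩
    · exact ⟨0, by rw [Φ_zero, ← v_mul_eB, ← eB_mul_u, mul_assoc, ← mul_assoc (eB π j),
        eB_mul_of_ne π hi, zero_mul, mul_zero]⟩
  · exact ⟨0, by rw [Φ_zero, ← v_mul_eB, mul_assoc (φ.v π j), eB_mul_of_ne π hj, mul_zero,
      zero_mul]⟩

theorem v_mul_up_mul_u (c : φ.Ord) (i j : Q.Vert) :
    ∃ x, (φ.Φ h2 hs x).1 = φ.v π j * aB π (φ.up c) * φ.u π i := by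
  by_cases hj : j = Q.tgt (φ.up c)
  · by_cases hi : Q.src (φ.up c) = i
    · subst hi hj
      exact ⟨R.arr k (φ.ord c), by rw [Φ_arr, arrowImage_ord]⟩
    · exact ⟨0, by rw [Φ_zero, ← eB_mul_u, mul_assoc, ← mul_assoc (aB π _),
        aB_mul_eB_of_ne π hi, zero_mul, mul_zero]⟩
  · exact ⟨0, by rw [Φ_zero, ← v_mul_eB, mul_assoc (φ.v π j), eB_mul_aB_of_ne π hj, mul_zero,
      zero_mul]⟩

/-- At a moved vertex `σ` is absorbed into the transport element, so there it needs no preimage of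
its own. -/
theorem σB_mul_u (hs : ActsBy π s) {i : Q.Vert} (hi : s.onV i ≠ i) :
    (σB A * φ.u π i : 𝔹) = φ.u π (s.onV i) := by
  unfold u
  rw [φ.down_onV]
  split_ifs with h h' h'
  · exact absurd (h'.symm.trans h) hi
  · rw [σB_mul_eB hs]
  · rw [← mul_assoc, σB_mul_eB hs, mul_assoc, σB_mul_σB, mul_one]
  · exact absurd (φ.sec_down_onV h) h'

/-- At a moved vertex this reduces to the case of a trivial path. At a fixed vertex `e σ` is the
difference of its two eigenidempotents, both of which are values of `Φ` thanks to the special loop.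
-/
theorem v_mul_σB_mul_u (i j : Q.Vert) :
    ∃ x, (φ.Φ h2 hs x).1 = φ.v π j * σB A * φ.u π i := by
  by_cases hi : s.onV i = i
  · by_cases hj : j = i
    · subst hj
      obtain ⟨l, hl⟩ := φ.exists_loop j hi
      refine ⟨R.eSp k (φ.loop l) 0 - R.eSp k (φ.loop l) 1, ?_⟩
      have hu : φ.u π j = eB π j := if_pos (φ.sec_down_of_fixed hi)
      have hv : φ.v π j = eB π j := if_pos (φ.sec_down_of_fixed hi)
      rw [Φ_sub, Φ_eSp, Φ_eSp, hl, φ.sec_down_of_fixed hi, hu, hv, mul_assoc, σB_mul_eB hs, hi,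
        ← mul_assoc, eB_mul_self, ← half_add_half h2, add_mul, half_mul_σB, half_mul_σB,
        Fin.val_zero, Fin.val_one, pow_zero, pow_one, one_smul, neg_smul, one_smul, sub_eq_add_neg]
    · refine ⟨0, ?_⟩
      rw [Φ_zero, ← eB_mul_u, ← v_mul_eB, mul_assoc, ← mul_assoc (σB A), σB_mul_eB hs, hi,
        mul_assoc (φ.v π j), ← mul_assoc (eB π j), ← mul_assoc (eB π j), eB_mul_of_ne π hj,
        zero_mul, zero_mul, mul_zero]
  · obtain ⟨x, hx⟩ := φ.v_mul_eB_mul_u h2 hs (s.onV i) (s.onV i) j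
    refine ⟨x, ?_⟩
    rw [hx, mul_assoc, mul_assoc, φ.σB_mul_u hs hi, eB_mul_u]

/-- The unit, written as the sum of all `u l * v l`, is inserted between `x` and `y`. -/
theorem exists_Φ_eq_mul {x y : 𝔹} (hx : ∀ i j, ∃ z, (φ.Φ h2 hs z).1 = φ.v π j * x * φ.u π i)
    (hy : ∀ i j, ∃ z, (φ.Φ h2 hs z).1 = φ.v π j * y * φ.u π i) (i j : Q.Vert) :
    ∃ z, (φ.Φ h2 hs z).1 = φ.v π j * (x * y) * φ.u π i := by
  have := Q.finite_vert
  have := Fintype.ofFinite Q.Vert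
  choose f hf using fun l => hx l j
  choose g hg using fun l => hy i l
  refine ⟨∑ l, f l * g l, ?_⟩
  have h1 : (φ.Φ h2 hs (∑ l, f l * g l)).1 = ∑ l, (φ.Φ h2 hs (f l * g l)).1 := by
    rw [map_sum]
    exact map_sum (cornerVal (φ.η_idem π)) _ _
  have h3 : ∀ l, (φ.Φ h2 hs (f l * g l)).1 = φ.v π j * x * eB π l * (y * φ.u π i) := fun l => by
    rw [Φ_mul, hf, hg, ← φ.u_mul_v]
    simp only [mul_assoc]
  rw [h1]
  simp only [h3]
  rw [← Finset.sum_mul, ← Finset.mul_sum, ← finsum_eq_sum_of_fintype, finsum_eB, mul_one]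
  simp only [mul_assoc]

/-- Only the chosen arrows have a direct preimage; the others are their conjugates under `σ`. -/
theorem aB_of_not_pos (hs : ActsBy π s) {a : Q.Arr} (ha : ¬ φ.pos a) :
    aB π a = σB A * aB π (φ.up (φ.base a)) * σB A := by
  have h := φ.up_base _ ((φ.pos_onA a).2 ha)
  rw [φ.base_onA] at h
  rw [σB_mul_aB hs, mul_assoc, σB_mul_σB, mul_one, h, s.onA_onA]

theorem exists_Φ_eq (b : 𝔹) (i j : Q.Vert) :
    ∃ x, (φ.Φ h2 hs x).1 = φ.v π j * b * φ.u π i := by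
  induction b using skew_induction π generalizing i j with
  | smul c x hx =>
    obtain ⟨y, hy⟩ := hx i j
    exact ⟨c • y, by rw [Φ_smul, hy, mul_smul_comm, smul_mul_assoc]⟩
  | add x y hx hy =>
    obtain ⟨x', hx⟩ := hx i j
    obtain ⟨y', hy⟩ := hy i j
    exact ⟨x' + y', by rw [Φ_add, hx, hy, mul_add, add_mul]⟩
  | mul x y hx hy => exact φ.exists_Φ_eq_mul h2 hs hx hy i j
  | zero => exact ⟨0, by rw [Φ_zero, mul_zero, zero_mul]⟩
  | e l => exact φ.v_mul_eB_mul_u h2 hs l i j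
  | a a =>
    by_cases ha : φ.pos a
    · rw [← φ.up_base a ha]
      exact φ.v_mul_up_mul_u h2 hs _ i j
    · rw [φ.aB_of_not_pos hs ha]
      exact φ.exists_Φ_eq_mul h2 hs (φ.exists_Φ_eq_mul h2 hs (φ.v_mul_σB_mul_u h2 hs)
        (φ.v_mul_up_mul_u h2 hs _)) (φ.v_mul_σB_mul_u h2 hs) i j
  | σ => exact φ.v_mul_σB_mul_u h2 hs i j

theorem Φ_surjective : Function.Surjective (φ.Φ h2 hs) := by
  have := R.finite_vert
  have := Fintype.ofFinite R.Vert
  intro y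
  choose f hf using fun i j : R.Vert => φ.exists_Φ_eq h2 hs y.1 (φ.sec i) (φ.sec j)
  refine ⟨∑ i, ∑ j, f i j, ?_⟩
  refine Subtype.ext ?_
  have h1 : (φ.Φ h2 hs (∑ i, ∑ j, f i j)).1 = ∑ i, ∑ j, (φ.Φ h2 hs (f i j)).1 := by
    simp only [map_sum]
    refine (map_sum (cornerVal (φ.η_idem π)) _ _).trans ?_
    exact Finset.sum_congr rfl fun i _ => map_sum (cornerVal (φ.η_idem π)) _ _
  have h : φ.η π = ∑ j, eB π (φ.sec j) := finsum_eq_sum_of_fintype _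
  obtain ⟨hy1, hy2⟩ := (Subsemigroup.mem_corner_iff (φ.η_idem π)).1 y.2
  rw [h1]
  -- At representatives `u` and `v` are trivial paths, so the double sum is `η y η`, which is `y` in
  -- the corner.
  simp only [hf, u_sec, v_sec, ← Finset.sum_mul, ← Finset.mul_sum, ← h]
  rw [hy1, hy2]

end

/-! ### Injectivity -/

section

variable {X : Type*} [Ring X] [Algebra k X] (ρ : R.Alg k ≃ₐ[k] X)

/-- The image of a trivial path under `ρ`. -/
def xe (j : R.Vert) : X := ρ (R.e k j)

/-- The image of an arrow under `ρ`. -/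
def xa (a : R.Arr) : X := ρ (R.arr k a)

theorem xe_mul_self (j : R.Vert) : xe ρ j * xe ρ j = xe ρ j := by
  rw [xe, ← map_mul, R.e_mul_self]

theorem xe_mul_of_ne {i j : R.Vert} (h : i ≠ j) : xe ρ i * xe ρ j = 0 := by
  rw [xe, xe, ← map_mul, R.e_mul_of_ne h, map_zero]

theorem finsum_xe : ∑ᶠ j, xe ρ j = 1 := by
  have := R.finite_vert
  rw [← map_one ρ, ← R.finsum_e]
  exact (map_finsum ρ (Set.toFinite _)).symm

theorem xe_tgt_mul_xa (a : R.Arr) : xe ρ (R.tgt a) * xa ρ a = xa ρ a := by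
  rw [xe, xa, ← map_mul, R.e_tgt_mul_arr]

theorem xa_mul_xe_src (a : R.Arr) : xa ρ a * xe ρ (R.src a) = xa ρ a := by
  rw [xe, xa, ← map_mul, R.arr_mul_e_src]

theorem xa_mul_xa {b a : R.Arr} (h : R.rel b a) : xa ρ b * xa ρ a = 0 := by
  rw [xa, xa, ← map_mul, R.arr_mul_arr h, map_zero]

theorem xa_mul_self {a : R.Arr} (h : a ∈ R.Sp) : xa ρ a * xa ρ a = xa ρ a := by
  rw [xa, ← map_mul, R.arr_mul_self h]

open Classical in
/-- The action of the group element on the coordinate `i` of the representation `N`. -/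
def twist (i : Q.Vert) : X :=
  if h : s.onV i = i then (2 : k) • xa ρ (φ.loop (φ.exists_loop i h).choose) - 1 else 1

/-- If `x` is idempotent, then `2x - 1` squares to `1`. It acts as `+1` on the ideal of `x` and as
`-1` on that of `e - x`, matching the eigenvalues of `σ` on the two halves. -/
theorem twist_mul_self (i : Q.Vert) : φ.twist ρ i * φ.twist ρ i = 1 := by
  unfold twist
  split_ifs with h
  · have hx := xa_mul_self ρ ((φ.mem_sp _).2 ⟨(φ.exists_loop i h).choose, rfl⟩)
    set x := xa ρ (φ.loop (φ.exists_loop i h).choose)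
    have : x * x = x := hx
    rw [sub_mul, mul_sub, smul_mul_smul_comm, this, mul_one, one_mul, mul_smul, two_smul k (2 • x),
      two_smul]
    abel
  · rw [mul_one]

/-- Needed for the operator `opσ` to preserve the subspace `N`. -/
theorem twist_comm (i : Q.Vert) :
    φ.twist ρ i * xe ρ (φ.down i) = xe ρ (φ.down i) * φ.twist ρ i := by
  unfold twist
  split_ifs with h
  · have hx := (φ.exists_loop i h).choose_spec
    have h1 := xa_mul_xe_src ρ (φ.loop (φ.exists_loop i h).choose)
    have h2 := xe_tgt_mul_xa ρ (φ.loop (φ.exists_loop i h).choose)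
    rw [φ.tgt_loop] at h2
    rw [hx] at h1 h2
    rw [sub_mul, mul_sub, smul_mul_assoc, mul_smul_comm, h1, h2, mul_one, one_mul]
  · rw [mul_one, one_mul]

theorem twist_onV (i : Q.Vert) : φ.twist ρ (s.onV i) = φ.twist ρ i := by
  by_cases h : s.onV i = i
  · rw [h]
  · unfold twist
    rw [dif_neg h, dif_neg (by rw [s.onV_onV]; exact fun h' => h h'.symm)]

/-- The space underlying a representation of the skew group algebra, whose coordinate at `i` is
the projective module at the image of `i`. -/
def N : Submodule k (Q.Vert → X) where
  carrier := {v | ∀ i, xe ρ (φ.down i) * v i = v i}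
  add_mem' {v w} hv hw i := by rw [Pi.add_apply, mul_add, hv, hw]
  zero_mem' i := by rw [Pi.zero_apply, mul_zero]
  smul_mem' c v hv i := by rw [Pi.smul_apply, mul_smul_comm, hv]

open Classical in
/-- Left multiplication by `x` from the coordinate `i` to the coordinate `j`. -/
def opMul (i j : Q.Vert) (x : X) (hx : xe ρ (φ.down j) * x = x) :
    Module.End k (φ.N ρ) where
  toFun v := ⟨Pi.single j (x * v.1 i), fun l => by
    by_cases h : l = j
    · subst h; rw [Pi.single_eq_same, ← mul_assoc, hx]
    · rw [Pi.single_eq_of_ne h, mul_zero]⟩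
  map_add' v w := Subtype.ext (by
    change (Pi.single j (x * (v.1 i + w.1 i)) : Q.Vert → X) =
      Pi.single j (x * v.1 i) + Pi.single j (x * w.1 i)
    rw [mul_add, Pi.single_add])
  map_smul' c v := Subtype.ext (by
    change (Pi.single j (x * (c • v.1 i)) : Q.Vert → X) = c • Pi.single j (x * v.1 i)
    rw [mul_smul_comm, Pi.single_smul])

/-- The action of the group element. -/
def opσ : Module.End k (φ.N ρ) where
  toFun v := ⟨fun i => φ.twist ρ i * v.1 (s.onV i), fun i => by
    have h := v.2 (s.onV i)
    rw [φ.down_onV] at h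
    rw [← mul_assoc, ← twist_comm, mul_assoc, h]⟩
  map_add' v w := Subtype.ext (funext fun i => mul_add _ _ _)
  map_smul' c v := Subtype.ext (funext fun i => mul_smul_comm _ _ _)

theorem opσ_apply (v : φ.N ρ) (i : Q.Vert) :
    (φ.opσ ρ v).1 i = φ.twist ρ i * v.1 (s.onV i) := rfl

open Classical in
theorem opMul_apply (i j : Q.Vert) (x : X) (hx) (v : φ.N ρ) (l : Q.Vert) :
    (φ.opMul ρ i j x hx v).1 l = if l = j then x * v.1 i else 0 := by
  change (Pi.single j (x * v.1 i) : Q.Vert → X) l = _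
  rw [Pi.single_apply]

theorem opσ_mul_opσ : φ.opσ ρ * φ.opσ ρ = 1 := by
  refine LinearMap.ext fun v => Subtype.ext (funext fun i => ?_)
  change φ.twist ρ i * (φ.twist ρ (s.onV i) * v.1 (s.onV (s.onV i))) = v.1 i
  rw [twist_onV, s.onV_onV, ← mul_assoc, twist_mul_self, one_mul]

/-- The action of the trivial path at `i`. -/
def opE (i : Q.Vert) : Module.End k (φ.N ρ) := φ.opMul ρ i i _ (xe_mul_self ρ (φ.down i))

open Classical in
theorem opE_apply (i : Q.Vert) (v : φ.N ρ) (l : Q.Vert) :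
    (φ.opE ρ i v).1 l = if l = i then v.1 i else 0 := by
  rw [opE, opMul_apply, v.2 i]

/-- The action of the chosen arrow over `c`. -/
def opUp (c : φ.Ord) : Module.End k (φ.N ρ) :=
  φ.opMul ρ (Q.src (φ.up c)) (Q.tgt (φ.up c)) (xa ρ (φ.ord c))
    (by rw [φ.down_tgt_up, xe_tgt_mul_xa])

open Classical in
/-- The action of an arrow. -/
def opArr (a : Q.Arr) : Module.End k (φ.N ρ) :=
  if φ.pos a then φ.opUp ρ (φ.base a) else φ.opσ ρ * φ.opUp ρ (φ.base a) * φ.opσ ρ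

theorem opσ_mul_opE (i : Q.Vert) : φ.opσ ρ * φ.opE ρ i = φ.opE ρ (s.onV i) * φ.opσ ρ := by
  classical
  refine LinearMap.ext fun v => Subtype.ext (funext fun l => ?_)
  change (φ.opσ ρ (φ.opE ρ i v)).1 l = (φ.opE ρ (s.onV i) (φ.opσ ρ v)).1 l
  rw [opσ_apply, opE_apply, opE_apply, opσ_apply]
  have : s.onV l = i ↔ l = s.onV i := ⟨fun h => by rw [← h, s.onV_onV], fun h => by
    rw [h, s.onV_onV]⟩
  by_cases h : s.onV l = i
  · rw [if_pos h, if_pos (this.1 h), ← this.1 h, h]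
  · rw [if_neg h, if_neg (mt this.2 h), mul_zero]

/-- Equivariance holds by construction: an arrow that is not chosen acts through the conjugate of
the operator of the chosen one. -/
theorem opσ_mul_opArr (a : Q.Arr) : φ.opσ ρ * φ.opArr ρ a = φ.opArr ρ (s.onA a) * φ.opσ ρ := by
  unfold opArr
  rw [φ.base_onA]
  by_cases h : φ.pos a
  · rw [if_pos h, if_neg (fun h' => (φ.pos_onA a).1 h' h), mul_assoc, opσ_mul_opσ, mul_one]
  · rw [if_neg h, if_pos ((φ.pos_onA a).2 h), ← mul_assoc, ← mul_assoc, opσ_mul_opσ, one_mul]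

theorem opE_mul_opUp (c : φ.Ord) : φ.opE ρ (Q.tgt (φ.up c)) * φ.opUp ρ c = φ.opUp ρ c := by
  classical
  refine LinearMap.ext fun v => Subtype.ext (funext fun l => ?_)
  change (φ.opE ρ _ (φ.opUp ρ c v)).1 l = (φ.opUp ρ c v).1 l
  rw [opE_apply, opUp, opMul_apply, opMul_apply, if_pos rfl]

theorem opUp_mul_opE (c : φ.Ord) : φ.opUp ρ c * φ.opE ρ (Q.src (φ.up c)) = φ.opUp ρ c := by
  classical
  refine LinearMap.ext fun v => Subtype.ext (funext fun l => ?_)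
  change (φ.opUp ρ c (φ.opE ρ _ v)).1 l = (φ.opUp ρ c v).1 l
  rw [opUp, opMul_apply, opMul_apply, opE_apply, if_pos rfl]

theorem opUp_mul_opUp {b a : φ.Ord} (h : R.rel (φ.ord b) (φ.ord a)) :
    φ.opUp ρ b * φ.opUp ρ a = 0 := by
  classical
  refine LinearMap.ext fun v => Subtype.ext (funext fun l => ?_)
  change (φ.opUp ρ b (φ.opUp ρ a v)).1 l = 0
  rw [opUp, opMul_apply, opUp, opMul_apply]
  split_ifs
  · rw [← mul_assoc, xa_mul_xa ρ h, zero_mul]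
  · rw [mul_zero]
  · rfl

theorem up_base_of_not_pos {a : Q.Arr} (h : ¬ φ.pos a) : φ.up (φ.base a) = s.onA a := by
  rw [← φ.base_onA, φ.up_base _ ((φ.pos_onA a).2 h)]

theorem isRep_N : Q.IsRep (φ.opE ρ) (φ.opArr ρ) where
  idem i := by
    classical
    refine LinearMap.ext fun v => Subtype.ext (funext fun l => ?_)
    change (φ.opE ρ i (φ.opE ρ i v)).1 l = (φ.opE ρ i v).1 l
    rw [opE_apply, opE_apply, opE_apply, if_pos rfl]
  orth i j h := by
    classical
    refine LinearMap.ext fun v => Subtype.ext (funext fun l => ?_)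
    change (φ.opE ρ i (φ.opE ρ j v)).1 l = 0
    rw [opE_apply, opE_apply, if_neg h, ite_self]
  one := by
    classical
    have := Q.finite_vert
    have := Fintype.ofFinite Q.Vert
    rw [finsum_eq_sum_of_fintype]
    refine LinearMap.ext fun v => Subtype.ext (funext fun l => ?_)
    rw [LinearMap.sum_apply, AddSubmonoidClass.coe_finsetSum, Finset.sum_apply]
    simp only [opE_apply]
    simp
  tgt a := by
    by_cases h : φ.pos a
    · have := φ.opE_mul_opUp ρ (φ.base a)
      rw [φ.up_base a h] at this
      rw [opArr, if_pos h, this]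
    · have := φ.opE_mul_opUp ρ (φ.base a)
      rw [φ.up_base_of_not_pos h, s.tgt_onA] at this
      rw [opArr, if_neg h, ← mul_assoc, ← mul_assoc]
      nth_rw 1 [← s.onV_onV (Q.tgt a)]
      rw [← opσ_mul_opE, mul_assoc (φ.opσ ρ), this]
  src a := by
    by_cases h : φ.pos a
    · have := φ.opUp_mul_opE ρ (φ.base a)
      rw [φ.up_base a h] at this
      rw [opArr, if_pos h, this]
    · have := φ.opUp_mul_opE ρ (φ.base a)
      rw [φ.up_base_of_not_pos h, s.src_onA] at this
      rw [opArr, if_neg h, mul_assoc, opσ_mul_opE, mul_assoc, ← mul_assoc (φ.opUp ρ _), this,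
        mul_assoc]
  quad b a h := by
    obtain ⟨h1, h2⟩ := φ.rel_base b a h
    have h3 := φ.opUp_mul_opUp ρ h2
    unfold opArr
    by_cases hb : φ.pos b
    · rw [if_pos hb, if_pos (h1.1 hb), h3]
    · rw [if_neg hb, if_neg (mt h1.2 hb)]
      -- For two arrows that are not chosen, the inner factors `σ σ` cancel and the product is the
      -- conjugate of the relation between the chosen lifts.
      simp only [mul_assoc]
      rw [← mul_assoc (φ.opσ ρ) (φ.opσ ρ), opσ_mul_opσ, one_mul, ← mul_assoc (φ.opUp ρ _), h3,
        zero_mul, mul_zero]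
  special a h := absurd h (φ.sp_empty a)

/-- The operators of paths and that of `σ` satisfy the commutation rule of the skew group algebra.
It suffices to check the rule on generators of the path algebra. -/
theorem exists_action (hs : ActsBy π s) : ∃ F : 𝔹 →ₐ[k] Module.End k (φ.N ρ),
    (∀ i, F (eB π i) = φ.opE ρ i) ∧ (∀ a, F (aB π a) = φ.opArr ρ a) ∧ F (σB A) = φ.opσ ρ := by
  have key : ∀ x : Q.Alg k, φ.opσ ρ * (φ.isRep_N ρ).lift x =
      (φ.isRep_N ρ).lift (s.hom k x) * φ.opσ ρ := fun x => by
    induction x using Alg.induction with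
    | smul c x hx => simp only [map_smul, mul_smul_comm, smul_mul_assoc, hx]
    | add x y hx hy => simp only [map_add, mul_add, add_mul, hx, hy]
    | mul x y hx hy => rw [map_mul, ← mul_assoc, hx, mul_assoc, hy, ← mul_assoc, ← map_mul,
        ← map_mul]
    | zero => simp only [map_zero, mul_zero, zero_mul]
    | e i => rw [s.hom_e k, IsRep.lift_e, IsRep.lift_e, opσ_mul_opE]
    | arr a => rw [s.hom_arr k, IsRep.lift_arr, IsRep.lift_arr, opσ_mul_opArr]
  let f : A →ₐ[k] Module.End k (φ.N ρ) :=
    ((φ.isRep_N ρ).lift (k := k)).comp (π.symm : A →ₐ[k] Q.Alg k)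
  have hf : ∀ x, f (π x) = (φ.isRep_N ρ).lift x := fun x =>
    congrArg ((φ.isRep_N ρ).lift (k := k)) (π.symm_apply_apply x)
  obtain ⟨F, hF, hσ⟩ := exists_skewLift (k := k) (A := A) (C := Module.End k (φ.N ρ)) f (φ.opσ_mul_opσ ρ) (fun a => by
    obtain ⟨x, rfl⟩ := π.surjective a
    rw [hs x, hf, hf, key])
  refine ⟨F, fun i => ?_, fun a => ?_, hσ⟩
  · rw [eB, hF, hf, IsRep.lift_e]
  · rw [aB, hF, hf, IsRep.lift_arr]

open Classical in
/-- The vector of the representation that is given by an element of the algebra of `R`. -/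
def vec (x : X) : φ.N ρ :=
  ⟨fun i => if φ.sec (φ.down i) = i then xe ρ (φ.down i) * x else 0, fun i => by
    dsimp only
    split_ifs
    · rw [← mul_assoc, xe_mul_self]
    · rw [mul_zero]⟩

open Classical in
theorem vec_apply (x : X) (i : Q.Vert) :
    (φ.vec ρ x).1 i = if φ.sec (φ.down i) = i then xe ρ (φ.down i) * x else 0 := rfl

theorem vec_add (x y : X) : φ.vec ρ (x + y) = φ.vec ρ x + φ.vec ρ y := by
  refine Subtype.ext (funext fun i => ?_)
  change _ = (φ.vec ρ x).1 i + (φ.vec ρ y).1 i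
  rw [vec_apply, vec_apply, vec_apply]
  split_ifs
  · rw [mul_add]
  · rw [add_zero]

theorem vec_smul (c : k) (x : X) : φ.vec ρ (c • x) = c • φ.vec ρ x := by
  refine Subtype.ext (funext fun i => ?_)
  change _ = c • (φ.vec ρ x).1 i
  rw [vec_apply, vec_apply]
  split_ifs
  · rw [mul_smul_comm]
  · rw [smul_zero]

theorem vec_zero : φ.vec ρ 0 = 0 := by
  refine Subtype.ext (funext fun i => ?_)
  change _ = (0 : X)
  rw [vec_apply, mul_zero, ite_self]

theorem opE_vec (j : R.Vert) (x : X) : φ.opE ρ (φ.sec j) (φ.vec ρ x) = φ.vec ρ (xe ρ j * x) := by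
  classical
  refine Subtype.ext (funext fun i => ?_)
  rw [opE_apply, vec_apply, vec_apply, φ.down_sec, if_pos rfl]
  by_cases h : i = φ.sec j
  · subst h
    rw [if_pos rfl, φ.down_sec, if_pos rfl, ← mul_assoc, xe_mul_self]
  · rw [if_neg h]
    split_ifs with h'
    · rw [← mul_assoc, xe_mul_of_ne, zero_mul]
      rintro rfl
      exact h h'.symm
    · rfl

open Classical in
/-- The vector concentrated in the coordinate `i`. -/
def vecAt (i : Q.Vert) (x : X) : φ.N ρ :=
  ⟨Pi.single i (xe ρ (φ.down i) * x), fun l => by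
    by_cases h : l = i
    · subst h; rw [Pi.single_eq_same, ← mul_assoc, xe_mul_self]
    · rw [Pi.single_eq_of_ne h, mul_zero]⟩

open Classical in
theorem vecAt_apply (i : Q.Vert) (x : X) (l : Q.Vert) :
    (φ.vecAt ρ i x).1 l = if l = i then xe ρ (φ.down i) * x else 0 := by
  change (Pi.single i (xe ρ (φ.down i) * x) : Q.Vert → X) l = _
  rw [Pi.single_apply]

theorem vecAt_sec (j : R.Vert) (x : X) :
    φ.vecAt ρ (φ.sec j) x = φ.vec ρ (xe ρ j * x) := by
  classical
  rw [← opE_vec]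
  refine Subtype.ext (funext fun i => ?_)
  rw [opE_apply, vec_apply, vecAt_apply, φ.down_sec, if_pos rfl]

theorem opE_vecAt (i : Q.Vert) (x : X) : φ.opE ρ i (φ.vecAt ρ i x) = φ.vecAt ρ i x := by
  classical
  refine Subtype.ext (funext fun l => ?_)
  rw [opE_apply, vecAt_apply, vecAt_apply, if_pos rfl]

theorem opσ_vecAt {i : Q.Vert} (h : s.onV i ≠ i) (x : X) :
    φ.opσ ρ (φ.vecAt ρ i x) = φ.vecAt ρ (s.onV i) x := by
  classical
  refine Subtype.ext (funext fun l => ?_)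
  rw [opσ_apply, vecAt_apply, vecAt_apply, φ.down_onV]
  by_cases hl : l = s.onV i
  · subst hl
    rw [s.onV_onV, if_pos rfl, if_pos rfl, twist_onV, twist, dif_neg h, one_mul]
  · rw [if_neg hl, if_neg, mul_zero]
    rintro rfl
    exact hl (s.onV_onV l).symm

theorem opUp_vecAt (c : φ.Ord) (x : X) : φ.opUp ρ c (φ.vecAt ρ (Q.src (φ.up c)) x) =
    φ.vecAt ρ (Q.tgt (φ.up c)) (xa ρ (φ.ord c) * x) := by
  classical
  refine Subtype.ext (funext fun l => ?_)
  rw [opUp, opMul_apply, vecAt_apply, vecAt_apply, if_pos rfl, φ.down_src_up, φ.down_tgt_up,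
    ← mul_assoc, ← mul_assoc, xe_tgt_mul_xa, xa_mul_xe_src]

section

/-- The vectors `vec x` live on the representatives. The element `u i` moves the coordinate at the
representative of `i` to the coordinate `i`, and `v i` moves it back, without a twist because the
twist is trivial at moved vertices. -/
theorem action_u_vec {F : 𝔹 →ₐ[k] Module.End k (φ.N ρ)}
    (hE : ∀ i, F (eB π i) = φ.opE ρ i) (hσ : F (σB A) = φ.opσ ρ)
    (hs : ActsBy π s) (i : Q.Vert) (x : X) :
    F (φ.u π i) (φ.vec ρ x) = φ.vecAt ρ i x := by
  have h0 : ∀ j, φ.opE ρ (φ.sec j) (φ.vec ρ x) = φ.vecAt ρ (φ.sec j) x := fun j => by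
    rw [opE_vec, vecAt_sec]
  by_cases h : φ.sec (φ.down i) = i
  · have hu : φ.u π i = eB π i := if_pos h
    rw [hu, hE, ← h, h0]
  · have hu : φ.u π i = σB A * eB π (φ.sec (φ.down i)) := by
      rw [u, if_neg h, φ.sec_down_onV h, σB_mul_eB hs, s.onV_onV]
    have hi : s.onV (s.onV i) ≠ s.onV i := fun h' => h (φ.sec_down_of_fixed (by
      rw [s.onV_onV] at h'; exact h'.symm))
    rw [hu, map_mul, hσ, hE, Module.End.mul_apply, h0, φ.sec_down_onV h, opσ_vecAt _ _ hi,
      s.onV_onV]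

theorem action_v_vecAt {F : 𝔹 →ₐ[k] Module.End k (φ.N ρ)}
    (hE : ∀ i, F (eB π i) = φ.opE ρ i) (hσ : F (σB A) = φ.opσ ρ)
    (i : Q.Vert) (x : X) :
    F (φ.v π i) (φ.vecAt ρ i x) = φ.vec ρ (xe ρ (φ.down i) * x) := by
  rw [← vecAt_sec]
  by_cases h : φ.sec (φ.down i) = i
  · have hv : φ.v π i = eB π i := if_pos h
    rw [hv, hE, opE_vecAt, h]
  · have hv : φ.v π i = σB A * eB π i := if_neg h
    rw [hv, map_mul, hσ, hE, Module.End.mul_apply, opE_vecAt,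
      opσ_vecAt _ _ (fun h' => h (φ.sec_down_of_fixed h')), φ.sec_down_onV h]

/-- At a fixed vertex `σ` acts by `2x - 1`, so `(1 + σ) / 2` acts by the special loop `x`. This is
why the twist has this form. -/
theorem action_half_vec {F : 𝔹 →ₐ[k] Module.End k (φ.N ρ)} (h2 : (2 : k) ≠ 0)
    (hE : ∀ i, F (eB π i) = φ.opE ρ i)
    (hσ : F (σB A) = φ.opσ ρ) (hs : ActsBy π s) (l : φ.Loop) (x : X) :
    F (half π (φ.sec (R.src (φ.loop l))) 0) (φ.vec ρ x) = φ.vec ρ (xa ρ (φ.loop l) * x) := by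
  classical
  set i := φ.sec (R.src (φ.loop l)) with hi
  have hfix : s.onV i = i := φ.loop_fixed l
  have hdown : φ.down i = R.src (φ.loop l) := φ.down_sec _
  -- The loop selected in the definition of the twist is the given one, as a vertex carries at most
  -- one special loop.
  have hl : (φ.exists_loop i hfix).choose = l :=
    φ.loop_injective _ _ ((φ.exists_loop i hfix).choose_spec.trans hdown)
  have h1 : F (half π i 0) = (2 : k)⁻¹ • (φ.opE ρ i + φ.opσ ρ * φ.opE ρ i) := by
    rw [half, Fin.val_zero, pow_zero, one_smul, map_smul, map_add, eB_mul_σB hs hfix, map_mul, hE,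
      hσ]
  have h3 := xa_mul_xe_src ρ (φ.loop l)
  have h4 := xe_tgt_mul_xa ρ (φ.loop l)
  rw [φ.tgt_loop] at h4
  rw [h1]
  have h5 : φ.opE ρ i (φ.vec ρ x) = φ.vecAt ρ i x := by rw [hi, opE_vec, vecAt_sec]
  have h6 : φ.vec ρ (xa ρ (φ.loop l) * x) = φ.vecAt ρ i (xa ρ (φ.loop l) * x) := by
    rw [hi, vecAt_sec, ← mul_assoc, h4]
  rw [LinearMap.smul_apply, LinearMap.add_apply, Module.End.mul_apply, h5, h6,
    inv_smul_eq_iff₀ h2]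
  refine Subtype.ext (funext fun m => ?_)
  change (φ.vecAt ρ i x).1 m + (φ.opσ ρ (φ.vecAt ρ i x)).1 m =
    (2 : k) • (φ.vecAt ρ i (xa ρ (φ.loop l) * x)).1 m
  rw [opσ_apply, vecAt_apply, vecAt_apply, vecAt_apply, hdown]
  by_cases hm : m = i
  · subst hm
    rw [if_pos rfl, if_pos hfix, if_pos rfl, twist, dif_pos hfix, hl, sub_mul, one_mul,
      smul_mul_assoc, ← mul_assoc, ← mul_assoc, h3, h4]
    abel
  · have hm' : s.onV m ≠ i := fun h => hm (by rw [← s.onV_onV m, h, hfix])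
    rw [if_neg hm, if_neg hm', if_neg hm, mul_zero, add_zero, smul_zero]

/-- The representation restricted along `Φ` to the vectors `vec y` is the left regular
representation of the algebra of `R`, which is faithful. For an ordinary arrow, `u` moves the vector
to the source of the chosen lift, the lift multiplies it, and `v` brings it back. -/
theorem action_Φ_vec {F : 𝔹 →ₐ[k] Module.End k (φ.N ρ)} (h2 : (2 : k) ≠ 0)
    (hE : ∀ i, F (eB π i) = φ.opE ρ i)
    (hA : ∀ a, F (aB π a) = φ.opArr ρ a) (hσ : F (σB A) = φ.opσ ρ) (hs : ActsBy π s)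
    (x : R.Alg k) (y : X) : F (φ.Φ h2 hs x).1 (φ.vec ρ y) = φ.vec ρ (ρ x * y) := by
  induction x using Alg.induction generalizing y with
  | smul c x hx => rw [Φ_smul, map_smul, map_smul, LinearMap.smul_apply, hx, smul_mul_assoc,
      vec_smul]
  | add x z hx hz => rw [Φ_add, map_add, map_add, LinearMap.add_apply, hx, hz, add_mul, vec_add]
  | mul x z hx hz => rw [Φ_mul, map_mul, map_mul, Module.End.mul_apply, hz, hx, mul_assoc]
  | zero => rw [Φ_zero, map_zero, map_zero, zero_mul, vec_zero, LinearMap.zero_apply]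
  | e j => rw [Φ_e, hE, opE_vec]; rfl
  | arr a =>
    rw [Φ_arr]
    induction a using φ.arr_cases with
    | ord c =>
      have hup : F (aB π (φ.up c)) = φ.opUp ρ c := by
        rw [hA, opArr, if_pos (φ.pos_up c), φ.base_up]
      rw [arrowImage_ord, map_mul, map_mul, Module.End.mul_apply, Module.End.mul_apply,
        φ.action_u_vec ρ hE hσ hs, hup, opUp_vecAt, φ.action_v_vecAt ρ hE hσ, φ.down_tgt_up,
        ← mul_assoc, xe_tgt_mul_xa]
      rfl
    | loop l => rw [arrowImage_loop, φ.action_half_vec ρ h2 hE hσ hs]; rfl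

theorem vec_injective {x : X} (h : φ.vec ρ x = 0) : x = 0 := by
  have := R.finite_vert
  have := Fintype.ofFinite R.Vert
  rw [← one_mul x, ← finsum_xe ρ, finsum_eq_sum_of_fintype, Finset.sum_mul]
  refine Finset.sum_eq_zero fun j _ => ?_
  have h1 : (φ.vec ρ x).1 (φ.sec j) = 0 := by rw [h]; rfl
  rwa [vec_apply, φ.down_sec, if_pos rfl] at h1

end

end

/-- The algebra of a quiver triple, with its ring structure sealed off. -/
def SealedAlg (k : Type*) [Field k] (R : QuiverTriple.{u}) : Type _ := R.Alg k

instance (k : Type*) [Field k] (R : QuiverTriple.{u}) : Ring (SealedAlg k R) :=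
  inferInstanceAs (Ring (R.Alg k))

instance (k : Type*) [Field k] (R : QuiverTriple.{u}) : Algebra k (SealedAlg k R) :=
  inferInstanceAs (Algebra k (R.Alg k))

/-- The identity, as an isomorphism onto the sealed algebra. -/
def sealEquiv (k : Type*) [Field k] (R : QuiverTriple.{u}) : R.Alg k ≃ₐ[k] SealedAlg k R :=
  AlgEquiv.refl

theorem Φ_injective (h2 : (2 : k) ≠ 0) (hs : ActsBy π s) : Function.Injective (φ.Φ h2 hs) := by
  rw [injective_iff_map_eq_zero]
  intro x hx
  obtain ⟨F, hE, hA, hσ⟩ := φ.exists_action (π := π) (sealEquiv k R) hs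
  -- Acting on the vector of `1` recovers `x`.
  have h := φ.action_Φ_vec (sealEquiv k R) h2 hE hA hσ hs x 1
  have h0 : (φ.Φ h2 hs x).1 = 0 := by rw [hx]; rfl
  rw [h0, map_zero, LinearMap.zero_apply, mul_one] at h
  exact (map_eq_zero_iff (sealEquiv k R) (sealEquiv k R).injective).1 (φ.vec_injective _ h.symm)

/-- The algebra of `R` is a corner of the skew group algebra. -/
def equiv (h2 : (2 : k) ≠ 0) (hs : ActsBy π s) : R.Alg k ≃ₐ[k] (φ.η_idem π).Corner :=
  AlgEquiv.ofBijective (φ.Φ h2 hs) ⟨φ.Φ_injective h2 hs, φ.Φ_surjective h2 hs⟩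

end Folding
end GSurf

/-! ### Primitive idempotents in degree zero, and explicit values of the comparison map. -/

namespace GSurf

open QuiverTriple

/-! ## Idempotents and gradings -/

section Graded

variable {B : Type*} [Ring B]

theorem isBasicIdem_of_fintype {ι : Type*} [Fintype ι] {f : ι → B} {s : Finset ι} {η : B}
    (hf : CompleteOrthogonalIdempotents f) (hp : ∀ i, IsPrimitiveIdem (f i))
    (hs : ∀ i ∈ s, ∀ j ∈ s, IdemIso (f i) (f j) → i = j)
    (hs' : ∀ i, ∃ j ∈ s, IdemIso (f i) (f j)) (hη : η = ∑ i ∈ s, f i) : IsBasicIdem η := by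
  let e := Fintype.equivFin ι
  refine ⟨Fintype.card ι, f ∘ e.symm, s.map e.toEmbedding, ⟨⟨fun i => hf.idem _, fun i j hij => ?_⟩,
    ?_⟩, fun i => hp _, ?_, fun i => ?_, ?_⟩
  · exact hf.ortho (e.symm.injective.ne hij)
  · rw [← hf.complete]
    exact Equiv.sum_comp e.symm f
  · intro i hi j hj h
    obtain ⟨i, hi', rfl⟩ := Finset.mem_map.1 hi
    obtain ⟨j, hj', rfl⟩ := Finset.mem_map.1 hj
    simp only [Function.comp_apply, Equiv.coe_toEmbedding, Equiv.symm_apply_apply] at h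
    rw [hs i hi' j hj' h]
  · obtain ⟨j, hj, h⟩ := hs' (e.symm i)
    refine ⟨e j, Finset.mem_map.2 ⟨j, hj, rfl⟩, ?_⟩
    simpa using h
  · rw [hη, Finset.sum_map]
    simp

open Polynomial in
-- In the coefficient of degree `n` of `p * p`, each product either has a left factor of degree
-- below `n`, zero by induction, or has the constant coefficient as its right factor.
theorem polynomial_eq_zero_of_idem {p : B[X]} (h : p * p = p) (h0 : p.coeff 0 = 0) : p = 0 := by
  ext n
  induction n using Nat.strong_induction_on with
  | _ n ih =>
    rw [← h, Polynomial.coeff_mul, coeff_zero]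
    refine Finset.sum_eq_zero fun x hx => ?_
    rw [Finset.HasAntidiagonal.mem_antidiagonal] at hx
    by_cases h1 : x.1 < n
    · rw [ih _ h1, coeff_zero, zero_mul]
    · rw [show x.2 = 0 by omega, h0, mul_zero]

variable (B) in
/-- A grading of `B` by natural numbers, given by the homomorphism `∑ bₙ ↦ ∑ bₙ Xⁿ`. -/
structure Grading where
  hom : B →+* Polynomial B
  injective : Function.Injective hom

namespace Grading

variable (γ : Grading B)

/-- The component of degree zero. -/
def zeroPart (b : B) : B := (γ.hom b).coeff 0

theorem zeroPart_mul (a b : B) : γ.zeroPart (a * b) = γ.zeroPart a * γ.zeroPart b := by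
  rw [zeroPart, map_mul, Polynomial.mul_coeff_zero]; rfl

theorem zeroPart_add (a b : B) : γ.zeroPart (a + b) = γ.zeroPart a + γ.zeroPart b := by
  rw [zeroPart, map_add, Polynomial.coeff_add]; rfl

theorem eq_zero {f : B} (hf : IsIdempotentElem f) (h0 : γ.zeroPart f = 0) : f = 0 := by
  apply γ.injective
  rw [map_zero]
  exact polynomial_eq_zero_of_idem (by rw [← map_mul, hf.eq]) h0

/-- A summand `a` of `f` satisfies `a = f a f`, so its degree-zero part is `c • f`, and idempotence
gives `c = 0` or `c = 1`. Hence `a` or the complementary summand has no degree-zero part and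
vanishes. -/
theorem isPrimitiveIdem {k : Type*} [Field k] [Algebra k B] {f : B} (hf : IsIdempotentElem f)
    (h0 : f ≠ 0) (hγ : γ.zeroPart f = f) (h : ∀ b, ∃ c : k, f * γ.zeroPart b * f = c • f) :
    IsPrimitiveIdem f := by
  refine ⟨hf, h0, fun a b ha hb hab hba hadd => ?_⟩
  have h1 : f * a * f = a := by
    rw [← hadd, add_mul, hba, ha.eq, add_zero, mul_add, ha.eq, hab, add_zero]
  obtain ⟨c, hc⟩ := h a
  have h2 : γ.zeroPart a = c • f := by
    rw [← hc]
    conv_lhs => rw [← h1, zeroPart_mul, zeroPart_mul, hγ]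
  have h3 : (c * c) • f = c • f := by
    rw [← h2, ← ha.eq, zeroPart_mul, h2, smul_mul_smul_comm, hf.eq]
  have h4 : c * c = c := by
    by_contra h'
    refine h0 ((smul_eq_zero_iff_right (sub_ne_zero.2 h')).1 (?_ : (c * c - c) • f = 0))
    rw [sub_smul, h3, sub_self]
  rcases eq_or_ne c 0 with h5 | h5
  · exact Or.inl (γ.eq_zero ha (by rw [h2, h5, zero_smul]))
  · have h6 : c = 1 := mul_left_cancel₀ h5 (by rw [h4, mul_one])
    refine Or.inr (γ.eq_zero hb ?_)
    rw [h6, one_smul] at h2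
    have h7 := γ.zeroPart_add a b
    rwa [hadd, hγ, h2, left_eq_add] at h7

/-- An isomorphism writes `f = a * b` with `a = f a g`. Then `a`, and hence `f`, has no degree-zero
part, which forces `f = 0`. -/
theorem not_idemIso {f g : B} (hf : IsIdempotentElem f) (h0 : f ≠ 0) (hγf : γ.zeroPart f = f)
    (hγg : γ.zeroPart g = g) (h : ∀ b, f * γ.zeroPart b * g = 0) : ¬ IdemIso f g := by
  rintro ⟨a, b, ha, -, hab, -⟩
  refine h0 (γ.eq_zero hf ?_)
  rw [← hab, ← ha, zeroPart_mul, zeroPart_mul, zeroPart_mul, hγf, hγg, h, zero_mul]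

end Grading

end Graded

namespace Folding

variable {Q R : QuiverTriple.{u}} {s : Q.Involution} (φ : Folding Q s R)

variable {k A : Type*} [Field k] [Ring A] [Algebra k A] [MulSemiringAction G A]
  [SMulCommClass G k A] {π : Q.Alg k ≃ₐ[k] A}

local notation "𝔹" => SkewMonoidAlgebra A G

/-! ### Explicit values -/

theorem eB_mul_aB_mul_eB [DecidableEq Q.Vert] (i j : Q.Vert) (a : Q.Arr) :
    (eB π j * aB π a * eB π i : 𝔹) = if Q.tgt a = j ∧ Q.src a = i then aB π a else 0 := by
  split_ifs with h
  · rw [← h.1, ← h.2, eB_tgt_mul_aB, aB_mul_eB_src]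
  · by_cases h1 : j = Q.tgt a
    · rw [mul_assoc, aB_mul_eB_of_ne π fun h' => h ⟨h1.symm, h'⟩, mul_zero]
    · rw [eB_mul_aB_of_ne π h1, zero_mul]

theorem src_up_eq_or (c : φ.Ord) : Q.src (φ.up c) = φ.sec (R.src (φ.ord c)) ∨
    Q.src (φ.up c) = s.onV (φ.sec (R.src (φ.ord c))) := by
  rw [← φ.down_src_up]; exact φ.eq_or _

theorem tgt_up_eq_or (c : φ.Ord) : Q.tgt (φ.up c) = φ.sec (R.tgt (φ.ord c)) ∨
    Q.tgt (φ.up c) = s.onV (φ.sec (R.tgt (φ.ord c))) := by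
  rw [← φ.down_tgt_up]; exact φ.eq_or _

theorem u_onV_sec (hs : ActsBy π s) {j : R.Vert} (h : s.onV (φ.sec j) ≠ φ.sec j) :
    (φ.u π (s.onV (φ.sec j)) : 𝔹) = σB A * eB π (φ.sec j) := by
  rw [← φ.σB_mul_u hs h, u_sec]

theorem v_onV_sec (hs : ActsBy π s) {j : R.Vert} (h : s.onV (φ.sec j) ≠ φ.sec j) :
    (φ.v π (s.onV (φ.sec j)) : 𝔹) = eB π (φ.sec j) * σB A := by
  rw [v, φ.down_onV, φ.down_sec, if_neg (Ne.symm h), σB_mul_eB hs, s.onV_onV]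

theorem onV_eq_iff {i j : Q.Vert} : s.onV i = s.onV j ↔ i = j :=
  ⟨fun h => by rw [← s.onV_onV i, h, s.onV_onV], congrArg _⟩

variable (h2 : (2 : k) ≠ 0) (hs : ActsBy π s)

/-- Expanded, the right side has four terms, one for each choice of which end of the lift is a
representative. Exactly one survives, and it is the term produced by the factors `σ` hidden in `u`
and `v`. -/
theorem Φ_ord (c : φ.Ord) (hi : s.onV (φ.sec (R.src (φ.ord c))) ≠ φ.sec (R.src (φ.ord c)))
    (hj : s.onV (φ.sec (R.tgt (φ.ord c))) ≠ φ.sec (R.tgt (φ.ord c))) :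
    (φ.Φ h2 hs (R.arr k (φ.ord c))).1 = eB π (φ.sec (R.tgt (φ.ord c))) *
      ((aB π (φ.up c) + aB π (s.onA (φ.up c))) +
        (aB π (φ.up c) + aB π (s.onA (φ.up c))) * σB A) * eB π (φ.sec (R.src (φ.ord c))) := by
  classical
  rw [Φ_arr, arrowImage_ord]
  have hi' := φ.src_up_eq_or c
  have hj' := φ.tgt_up_eq_or c
  set i := φ.sec (R.src (φ.ord c)) with hi0
  set j := φ.sec (R.tgt (φ.ord c)) with hj0
  set α := φ.up c
  -- All occurrences of `σ` are moved to the right, so that each term can be tested against the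
  -- source and target of the lifts.
  have hR : (eB π j * ((aB π α + aB π (s.onA α)) + (aB π α + aB π (s.onA α)) * σB A) * eB π i : 𝔹) =
      eB π j * aB π α * eB π i + eB π j * aB π (s.onA α) * eB π i +
      (eB π j * aB π α * eB π (s.onV i) + eB π j * aB π (s.onA α) * eB π (s.onV i)) * σB A := by
    have : (σB A * eB π i : 𝔹) = eB π (s.onV i) * σB A := σB_mul_eB hs i
    simp only [mul_add, add_mul, mul_assoc, this]
  rw [hR]
  simp only [eB_mul_aB_mul_eB, s.tgt_onA, s.src_onA]
  rcases hi' with hi' | hi' <;> rcases hj' with hj' | hj'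
  · rw [hi', hj', hi0, hj0, u_sec, v_sec, ← hi0, ← hj0, eB_mul_aB_mul_eB]
    simp [hi', hj', hi, hj, hi.symm]
  · rw [hi', hj', hi0, u_sec, ← hi0, hj0, φ.v_onV_sec hs hj, ← hj0, mul_assoc (eB π j), σB_mul_aB hs,
      mul_assoc, mul_assoc, σB_mul_eB hs, ← mul_assoc, ← mul_assoc, eB_mul_aB_mul_eB]
    simp [hi', hj', hi, hj, hi.symm, s.tgt_onA, s.src_onA, s.onV_onV]
  · rw [hi', hj', hj0, v_sec, ← hj0, hi0, φ.u_onV_sec hs hi, ← hi0, σB_mul_eB hs, ← mul_assoc,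
      eB_mul_aB_mul_eB]
    simp [hi', hj', hi, hj, hi.symm, s.onV_onV]
  · rw [hi', hj', hj0, φ.v_onV_sec hs hj, ← hj0, hi0, φ.u_onV_sec hs hi, ← hi0,
      mul_assoc (eB π j), σB_mul_aB hs, mul_assoc, mul_assoc, σB_mul_σB_assoc, ← mul_assoc,
      eB_mul_aB_mul_eB]
    simp [hi', hj', hi, hj, hi.symm, s.tgt_onA, s.src_onA, s.onV_onV]

/-- The source is fixed, so the lift starts at the representative. If its target is not the
representative, `v` contributes a `σ` that passes through the arrow, replacing the lift by its
translate, and reaches the half idempotent, where it becomes the sign. -/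
theorem Φ_ord_mul_eSp (c : φ.Ord) (l : φ.Loop) (ε : Fin 2)
    (hl : R.src (φ.loop l) = R.src (φ.ord c))
    (hj : s.onV (φ.sec (R.tgt (φ.ord c))) ≠ φ.sec (R.tgt (φ.ord c))) :
    (φ.Φ h2 hs (R.arr k (φ.ord c) * R.eSp k (φ.loop l) ε)).1 = eB π (φ.sec (R.tgt (φ.ord c))) *
      (aB π (φ.up c) + (-1 : k) ^ (ε : ℕ) • aB π (s.onA (φ.up c))) *
        half π (φ.sec (R.src (φ.ord c))) ε := by
  have hi := φ.loop_fixed l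
  rw [Φ_mul, Φ_arr, Φ_eSp, arrowImage_ord, hl]
  rw [hl] at hi
  have hi' : Q.src (φ.up c) = φ.sec (R.src (φ.ord c)) := by
    rcases φ.src_up_eq_or c with h | h
    · exact h
    · rw [h, hi]
  have hj' := φ.tgt_up_eq_or c
  rw [hi', u_sec, mul_assoc, eB_mul_half]
  set i := φ.sec (R.src (φ.ord c)) with hi0
  set j := φ.sec (R.tgt (φ.ord c)) with hj0
  set α := φ.up c
  rcases hj' with hj' | hj'
  · rw [hj', hj0, v_sec, ← hj0, mul_add, mul_smul_comm, eB_mul_aB_of_ne π (a := s.onA α), smul_zero,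
      add_zero]
    rw [s.tgt_onA, hj']
    exact hj.symm
  · rw [hj', hj0, φ.v_onV_sec hs hj, ← hj0, mul_add, eB_mul_aB_of_ne π (a := α), zero_add,
      mul_assoc (eB π j), σB_mul_aB hs, mul_assoc, mul_assoc, σB_mul_half hs hi, mul_smul_comm,
      mul_smul_comm, mul_smul_comm, smul_mul_assoc, mul_assoc]
    rw [hj']
    exact hj.symm

/-- The mirror case: the factor `σ` in `u` moves left through the arrow and becomes the sign at the
half idempotent of the target. -/
theorem Φ_eSp_mul_ord (c : φ.Ord) (l : φ.Loop) (ε : Fin 2)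
    (hi : s.onV (φ.sec (R.src (φ.ord c))) ≠ φ.sec (R.src (φ.ord c)))
    (hl : R.src (φ.loop l) = R.tgt (φ.ord c)) :
    (φ.Φ h2 hs (R.eSp k (φ.loop l) ε * R.arr k (φ.ord c))).1 = half π (φ.sec (R.tgt (φ.ord c))) ε *
      (aB π (φ.up c) + (-1 : k) ^ (ε : ℕ) • aB π (s.onA (φ.up c))) *
        eB π (φ.sec (R.src (φ.ord c))) := by
  have hj := φ.loop_fixed l
  rw [Φ_mul, Φ_arr, Φ_eSp, arrowImage_ord, hl]
  rw [hl] at hj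
  have hj' : Q.tgt (φ.up c) = φ.sec (R.tgt (φ.ord c)) := by
    rcases φ.tgt_up_eq_or c with h | h
    · exact h
    · rw [h, hj]
  have hi' := φ.src_up_eq_or c
  rw [hj', v_sec, ← mul_assoc, ← mul_assoc, half_mul_eB hs hj]
  set i := φ.sec (R.src (φ.ord c)) with hi0
  set j := φ.sec (R.tgt (φ.ord c)) with hj0
  set α := φ.up c
  rcases hi' with hi' | hi'
  · rw [hi', hi0, u_sec, ← hi0, mul_assoc, mul_assoc, add_mul, smul_mul_assoc,
      aB_mul_eB_of_ne π (a := s.onA α), smul_zero, add_zero]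
    rw [s.src_onA, hi']
    exact hi
  · have h : (aB π α * σB A : 𝔹) = σB A * aB π (s.onA α) := by rw [σB_mul_aB hs, s.onA_onA]
    rw [hi', hi0, φ.u_onV_sec hs hi, ← hi0, mul_assoc (half π j ε) (_ + _), add_mul,
      aB_mul_eB_of_ne π (a := α), zero_add, mul_assoc (half π j ε), ← mul_assoc (aB π α), h,
      mul_assoc, ← mul_assoc (half π j ε), half_mul_σB, smul_mul_assoc, smul_mul_assoc,
      mul_smul_comm]
    rw [hi']
    exact hi

/-- With both ends fixed, the transport elements are trivial paths and no sign arises. -/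
theorem Φ_eSp_mul_ord_mul_eSp (c : φ.Ord) (l m : φ.Loop) (ε ε' : Fin 2)
    (hl : R.src (φ.loop l) = R.src (φ.ord c)) (hm : R.src (φ.loop m) = R.tgt (φ.ord c)) :
    (φ.Φ h2 hs (R.eSp k (φ.loop m) ε' * R.arr k (φ.ord c) * R.eSp k (φ.loop l) ε)).1 =
      half π (φ.sec (R.tgt (φ.ord c))) ε' * aB π (φ.up c) * half π (φ.sec (R.src (φ.ord c))) ε := by
  have hi := φ.loop_fixed l
  have hj := φ.loop_fixed m
  rw [Φ_mul, Φ_mul, Φ_arr, Φ_eSp, Φ_eSp, arrowImage_ord, hl, hm]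
  rw [hm] at hj
  rw [hl] at hi
  have hj' : Q.tgt (φ.up c) = φ.sec (R.tgt (φ.ord c)) := by
    rcases φ.tgt_up_eq_or c with h | h
    · exact h
    · rw [h, hj]
  have hi' : Q.src (φ.up c) = φ.sec (R.src (φ.ord c)) := by
    rcases φ.src_up_eq_or c with h | h
    · exact h
    · rw [h, hi]
  rw [hj', hi', u_sec, v_sec, ← mul_assoc, ← mul_assoc, half_mul_eB hs hj, mul_assoc, eB_mul_half]

end Folding
end GSurf

namespace GSurf

open QuiverTriple

namespace Folding

variable {Q R : QuiverTriple.{u}} {s : Q.Involution} (φ : Folding Q s R)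

variable {k A : Type*} [Field k] [Ring A] [Algebra k A] [MulSemiringAction G A]
  [SMulCommClass G k A] {π : Q.Alg k ≃ₐ[k] A}

local notation "𝔹" => SkewMonoidAlgebra A G

/-! ### The grading of the skew group algebra by the length of paths -/

open Polynomial in
-- Arrows are put in degree one. The relations upstairs are homogeneous, because there are no
-- special loops there.
theorem isRep_polynomial (φ : Folding Q s R) :
    Q.IsRep (C := 𝔹[X]) (fun i => C (eB π i)) (fun a => C (aB π a) * X) where
  idem i := by rw [← C_mul, eB_mul_self]
  orth i j h := by rw [← C_mul, eB_mul_of_ne π h, C_0]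
  one := by
    have := Q.finite_vert
    rw [← C_1, ← finsum_eB π]
    exact (map_finsum (C : 𝔹 →+* 𝔹[X]) (Set.toFinite _)).symm
  tgt a := by rw [← mul_assoc, ← C_mul, eB_tgt_mul_aB]
  src a := by rw [mul_assoc, X_mul_C, ← mul_assoc, ← C_mul, aB_mul_eB_src]
  quad b a h := by
    rw [mul_assoc, ← mul_assoc X, X_mul_C, mul_assoc (C (aB π a)), ← mul_assoc, ← C_mul,
      aB_mul_aB π h, C_0, zero_mul]
  special a h := absurd h (φ.sp_empty a)

open Polynomial in
theorem exists_grading (φ : Folding Q s R) (hs : ActsBy π s) :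
    ∃ γ : Grading 𝔹, (∀ i, γ.hom (eB π i) = C (eB π i)) ∧
      (∀ a, γ.hom (aB π a) = C (aB π a) * X) ∧ γ.hom (σB A) = C (σB A) ∧
      ∀ (c : k) x, γ.hom (c • x) = c • γ.hom x := by
  have rep := φ.isRep_polynomial (π := π)
  have key : ∀ x : Q.Alg k, C (σB A) * rep.lift (k := k) x =
      rep.lift (k := k) (s.hom k x) * C (σB A) := fun x => by
    induction x using Alg.induction with
    | smul c x hx => simp only [map_smul, mul_smul_comm, smul_mul_assoc, hx]
    | add x y hx hy => simp only [map_add, mul_add, add_mul, hx, hy]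
    | mul x y hx hy => rw [map_mul, ← mul_assoc, hx, mul_assoc, hy, ← mul_assoc, ← map_mul,
        ← map_mul]
    | zero => simp only [map_zero, mul_zero, zero_mul]
    | e i => rw [s.hom_e k, IsRep.lift_e, IsRep.lift_e, ← C_mul, σB_mul_eB hs, C_mul]
    | arr a => rw [s.hom_arr k, IsRep.lift_arr, IsRep.lift_arr, ← mul_assoc, ← C_mul, σB_mul_aB hs,
        mul_assoc, X_mul_C, ← mul_assoc, C_mul]
  let f : A →ₐ[k] 𝔹[X] := (rep.lift (k := k)).comp (π.symm : A →ₐ[k] Q.Alg k)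
  have hf : ∀ x, f (π x) = rep.lift (k := k) x := fun x =>
    congrArg (rep.lift (k := k)) (π.symm_apply_apply x)
  obtain ⟨F, hF, hσ⟩ := exists_skewLift (k := k) (A := A) (C := 𝔹[X]) f
    (t := C (σB A)) (by rw [← C_mul, σB_mul_σB, C_1]) (fun a => by
      obtain ⟨x, rfl⟩ := π.surjective a
      rw [hs x, hf, hf, key])
  have hE : ∀ i, F (eB π i) = C (eB π i) := fun i => by rw [eB, hF, hf, IsRep.lift_e]; rfl
  have hA : ∀ a, F (aB π a) = C (aB π a) * X := fun a => by rw [aB, hF, hf, IsRep.lift_arr]; rfl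
  refine ⟨⟨F, ?_⟩, hE, hA, hσ, map_smul F⟩
  -- Setting the variable equal to `1` adds up the homogeneous components, so it is a left inverse.
  have hev : ∀ b, eval₂RingHom' (RingHom.id 𝔹) 1 (fun a => Commute.one_right a) (F b) = b := by
    intro b
    set ev := eval₂RingHom' (RingHom.id 𝔹) 1 (fun a => Commute.one_right a) with hdef
    have hC : ∀ b, ev (C b) = b := fun b => by simp [hdef, eval₂RingHom']
    have hX : ev X = 1 := by simp [hdef, eval₂RingHom']
    induction b using skew_induction π with
    | smul c x hx =>
      rw [map_smul, Algebra.smul_def, map_mul, hx, Polynomial.algebraMap_apply, hC,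
        ← Algebra.smul_def]
    | add x y hx hy => rw [map_add, map_add, hx, hy]
    | mul x y hx hy => rw [map_mul, map_mul, hx, hy]
    | zero => rw [map_zero, map_zero]
    | e i => rw [hE, hC]
    | a a => rw [hA, map_mul, hC, hX, mul_one]
    | σ => rw [σB, hσ, hC]; rfl
  exact Function.LeftInverse.injective hev

/-- In degree zero all arrows disappear, so what remains of a path-algebra element at `j` is a
multiple of the trivial path, and a general element is `a + a' σ`. -/
theorem eB_mul_zeroPart {γ : Grading 𝔹} (hE : ∀ i, γ.zeroPart (eB π i) = eB π i)
    (hA : ∀ a, γ.zeroPart (aB π a) = 0) (hσ : γ.zeroPart (σB A) = σB A)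
    (hsm : ∀ (c : k) x, γ.zeroPart (c • x) = c • γ.zeroPart x) (b : 𝔹) (j : Q.Vert) :
    ∃ c c' : k, eB π j * γ.zeroPart b = c • eB π j + c' • (eB π j * σB A) := by
  have h0 : γ.zeroPart 0 = 0 := by
    have := γ.zeroPart_add 0 0
    rwa [add_zero, left_eq_add] at this
  have key : ∀ x : Q.Alg k, ∀ j, ∃ c : k,
      eB π j * γ.zeroPart (SkewMonoidAlgebra.single 1 (π x)) = c • eB π j := fun x => by
    induction x using Alg.induction with
    | smul c x hx =>
      intro j
      obtain ⟨d, hd⟩ := hx j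
      exact ⟨c * d, by rw [map_smul, ← SkewMonoidAlgebra.smul_single, hsm, mul_smul_comm, hd,
        mul_smul]⟩
    | add x y hx hy =>
      intro j
      obtain ⟨c, hc⟩ := hx j
      obtain ⟨d, hd⟩ := hy j
      exact ⟨c + d, by rw [map_add, SkewMonoidAlgebra.single_add, Grading.zeroPart_add, mul_add, hc,
        hd, add_smul]⟩
    | mul x y hx hy =>
      intro j
      obtain ⟨c, hc⟩ := hx j
      obtain ⟨d, hd⟩ := hy j
      exact ⟨c * d, by rw [map_mul, ← single_one_mul_single_one, Grading.zeroPart_mul, ← mul_assoc,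
        hc, smul_mul_assoc, hd, mul_smul]⟩
    | zero => exact fun j => ⟨0, by rw [map_zero, SkewMonoidAlgebra.single_zero, h0, mul_zero,
        zero_smul]⟩
    | e i =>
      intro j
      by_cases h : j = i
      · exact ⟨1, by subst h; rw [← eB, hE, eB_mul_self, one_smul]⟩
      · exact ⟨0, by rw [← eB, hE, eB_mul_of_ne π h, zero_smul]⟩
    | arr a => exact fun j => ⟨0, by rw [← aB, hA, mul_zero, zero_smul]⟩
  obtain ⟨y, z, rfl⟩ := exists_eq_add_mul_gen b
  obtain ⟨y, rfl⟩ := π.surjective y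
  obtain ⟨z, rfl⟩ := π.surjective z
  obtain ⟨c, hc⟩ := key y j
  obtain ⟨d, hd⟩ := key z j
  refine ⟨c, d, ?_⟩
  rw [Grading.zeroPart_add, Grading.zeroPart_mul, ← σB, hσ, mul_add, ← mul_assoc, hc, hd,
    smul_mul_assoc]

/-! ### A complete set of primitive idempotents -/

theorem eB_ne_zero (i : Q.Vert) : (eB π i : 𝔹) ≠ 0 := by
  intro h
  rw [eB, SkewMonoidAlgebra.single_eq_zero, map_eq_zero_iff π π.injective] at h
  exact Q.e_ne_zero i h

theorem half_ne_zero (h2 : (2 : k) ≠ 0) (i : Q.Vert) (ε : Fin 2) : (half π i ε : 𝔹) ≠ 0 := by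
  intro h
  rw [half, smul_eq_zero_iff_right (inv_ne_zero h2), ← smul_mul_assoc] at h
  have h1 : (SkewMonoidAlgebra.single 1 (π (Q.e k i)) +
      SkewMonoidAlgebra.single 1 ((-1 : k) ^ (ε : ℕ) • π (Q.e k i)) *
        SkewMonoidAlgebra.single gen 1 : 𝔹) =
      SkewMonoidAlgebra.single 1 0 + SkewMonoidAlgebra.single 1 0 *
        SkewMonoidAlgebra.single gen 1 := by
    rw [SkewMonoidAlgebra.single_zero, zero_mul, add_zero, ← SkewMonoidAlgebra.smul_single]
    exact h
  exact Q.e_ne_zero i ((map_eq_zero_iff π π.injective).1 (single_one_injective h1))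

variable (s) in
/-- The index set of a complete set of primitive idempotents: two for each fixed vertex, one for
each other vertex. -/
abbrev Idx := ({i : Q.Vert // s.onV i = i} × Fin 2) ⊕ {i : Q.Vert // ¬ s.onV i = i}

/-- The vertex of an index. -/
def vtx : Idx s → Q.Vert := Sum.elim (fun p => p.1.1) (fun i => i.1)

variable (π s) in
/-- A complete set of primitive orthogonal idempotents. -/
def prim : Idx s → 𝔹 := Sum.elim (fun p => half π p.1.1 p.2) (fun i => eB π i.1)

theorem eB_mul_prim (x : Idx s) : (eB π (vtx x) * prim s π x : 𝔹) = prim s π x := by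
  rcases x with ⟨i, ε⟩ | i
  · exact eB_mul_half _ _
  · exact eB_mul_self _ _

theorem prim_mul_eB (hs : ActsBy π s) (x : Idx s) :
    (prim s π x * eB π (vtx x) : 𝔹) = prim s π x := by
  rcases x with ⟨i, ε⟩ | i
  · exact half_mul_eB hs i.2 _
  · exact eB_mul_self _ _

theorem prim_idem (h2 : (2 : k) ≠ 0) (hs : ActsBy π s) (x : Idx s) :
    IsIdempotentElem (prim s π x : 𝔹) := by
  rcases x with ⟨i, ε⟩ | i
  · exact (half_mul_half h2 hs i.2 _ _).trans (if_pos rfl)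
  · exact eB_mul_self _ _

theorem prim_ne_zero (h2 : (2 : k) ≠ 0) (x : Idx s) : (prim s π x : 𝔹) ≠ 0 := by
  rcases x with ⟨i, ε⟩ | i
  · exact half_ne_zero h2 _ _
  · exact eB_ne_zero _

theorem prim_mul_prim (h2 : (2 : k) ≠ 0) (hs : ActsBy π s) {x y : Idx s} (h : x ≠ y) :
    (prim s π x * prim s π y : 𝔹) = 0 := by
  by_cases hv : vtx x = vtx y
  · rcases x with ⟨i, ε⟩ | i <;> rcases y with ⟨j, ε'⟩ | j
    · have hij : i = j := Subtype.ext hv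
      subst hij
      exact (half_mul_half h2 hs i.2 _ _).trans (if_neg fun h' => h (congrArg (fun e => Sum.inl (i, e)) h'))
    · exact absurd i.2 (by rw [show i.1 = j.1 from hv]; exact j.2)
    · exact absurd j.2 (by rw [← show i.1 = j.1 from hv]; exact i.2)
    · exact absurd (congrArg Sum.inr (Subtype.ext hv)) h
  · rw [← eB_mul_prim y, ← prim_mul_eB hs x, mul_assoc, ← mul_assoc (eB π _), eB_mul_of_ne π hv,
      zero_mul, mul_zero]

theorem sum_half [Fintype {i : Q.Vert // s.onV i = i}] (h2 : (2 : k) ≠ 0) :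
    (∑ p : {i : Q.Vert // s.onV i = i} × Fin 2, half π p.1.1 p.2 : 𝔹) =
      ∑ i : {i : Q.Vert // s.onV i = i}, eB π i.1 := by
  rw [Fintype.sum_prod_type]
  refine Finset.sum_congr rfl fun i _ => ?_
  rw [Fin.sum_univ_two, half_add_half h2]

theorem prim_complete [Fintype Q.Vert] [DecidableEq Q.Vert] (h2 : (2 : k) ≠ 0) (hs : ActsBy π s) :
    CompleteOrthogonalIdempotents (prim s π : Idx s → 𝔹) := by
  refine ⟨⟨prim_idem h2 hs, fun x y h => prim_mul_prim h2 hs h⟩, ?_⟩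
  rw [Fintype.sum_sum_type]
  change (∑ p : {i : Q.Vert // s.onV i = i} × Fin 2, half π p.1.1 p.2) +
    ∑ i : {i : Q.Vert // ¬ s.onV i = i}, eB π i.1 = 1
  rw [sum_half h2, Fintype.sum_subtype_add_sum_subtype, ← finsum_eq_sum_of_fintype, finsum_eB]

/-- The degree-zero endomorphisms of a primitive idempotent are scalars: at a fixed vertex `σ` acts
on the half by a sign, and at a moved vertex `e_i σ e_i = e_i e_{σ i} σ` vanishes. -/
theorem prim_mul_zeroPart_mul_prim {γ : Grading 𝔹} (h2 : (2 : k) ≠ 0) (hs : ActsBy π s)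
    (hγ : ∀ (b : 𝔹) (j : Q.Vert), ∃ c c' : k,
      eB π j * γ.zeroPart b = c • eB π j + c' • (eB π j * σB A))
    (x : Idx s) (b : 𝔹) : ∃ c : k, prim s π x * γ.zeroPart b * prim s π x = c • prim s π x := by
  obtain ⟨c, c', h⟩ := hγ b (vtx x)
  rw [← prim_mul_eB hs x, mul_assoc (prim s π x), h, prim_mul_eB hs]
  have hx := prim_mul_eB hs x
  have hx' := eB_mul_prim (π := π) x
  have hi := (prim_idem h2 hs x).eq
  rcases x with ⟨i, ε⟩ | i
  · refine ⟨c + c' * (-1) ^ (ε : ℕ), ?_⟩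
    have h3 : (prim s π (Sum.inl (i, ε)) * σB A : 𝔹) =
      (-1 : k) ^ (ε : ℕ) • prim s π (Sum.inl (i, ε)) := half_mul_σB _ _
    rw [mul_add, mul_smul_comm, mul_smul_comm, ← mul_assoc, hx, h3, add_mul, smul_mul_assoc,
      smul_mul_assoc, smul_mul_assoc, hi, add_smul, mul_smul]
  · refine ⟨c, ?_⟩
    have h3 : (prim s π (Sum.inr i) * (eB π i.1 * σB A) * prim s π (Sum.inr i) : 𝔹) = 0 := by
      change (eB π i.1 * (eB π i.1 * σB A) * eB π i.1 : 𝔹) = 0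
      rw [mul_assoc, mul_assoc, σB_mul_eB hs, ← mul_assoc (eB π i.1) (eB π (s.onV i.1)),
        eB_mul_of_ne π (Ne.symm i.2), zero_mul, mul_zero]
    rw [mul_add, mul_smul_comm, mul_smul_comm, hx, add_mul, smul_mul_assoc, smul_mul_assoc,
      show vtx (Sum.inr i : Idx s) = i.1 from rfl, h3, smul_zero, add_zero, hi]

/-- Only the term with `σ` needs care. It vanishes unless `σ` takes the vertex of `y` to that of
`x`. Both being representatives, this vertex is then fixed, and `σ` acts on the half by a sign, so
orthogonality applies. -/
theorem prim_mul_zeroPart_mul_prim_of_ne {γ : Grading 𝔹} (h2 : (2 : k) ≠ 0) (hs : ActsBy π s)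
    (hγ : ∀ (b : 𝔹) (j : Q.Vert), ∃ c c' : k,
      eB π j * γ.zeroPart b = c • eB π j + c' • (eB π j * σB A))
    {x y : Idx s} (hxy : x ≠ y) (hx : φ.sec (φ.down (vtx x)) = vtx x)
    (hy : φ.sec (φ.down (vtx y)) = vtx y) (b : 𝔹) :
    prim s π x * γ.zeroPart b * prim s π y = 0 := by
  obtain ⟨c, c', h⟩ := hγ b (vtx x)
  have h0 := prim_mul_prim (π := π) h2 hs hxy
  have h3 : (prim s π x * (eB π (vtx x) * σB A) * prim s π y : 𝔹) = 0 := by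
    by_cases hv : s.onV (vtx y) = vtx x
    · have hv' : vtx y = vtx x := by
        rw [← hy, ← φ.down_onV, hv, hx]
      have hfix : s.onV (vtx y) = vtx y := by rw [hv, hv']
      rcases y with ⟨j, ε⟩ | j
      · rw [← mul_assoc, prim_mul_eB hs, mul_assoc]
        have : (σB A * prim s π (Sum.inl (j, ε)) : 𝔹) =
          (-1 : k) ^ (ε : ℕ) • prim s π (Sum.inl (j, ε)) := σB_mul_half hs j.2 _
        rw [this, mul_smul_comm, h0, smul_zero]
      · exact absurd hfix j.2
    · rw [← eB_mul_prim y, mul_assoc, mul_assoc, ← mul_assoc (σB A), σB_mul_eB hs, mul_assoc,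
        ← mul_assoc (eB π (vtx x)), eB_mul_of_ne π (Ne.symm hv), zero_mul, mul_zero]
  rw [← prim_mul_eB hs x, mul_assoc (prim s π x), h, mul_add, mul_smul_comm, mul_smul_comm, add_mul,
    smul_mul_assoc, smul_mul_assoc, h3, prim_mul_eB hs, h0, smul_zero, smul_zero, add_zero]

theorem idemIso_prim {f : 𝔹} (hf : IsIdempotentElem f) : IdemIso f f :=
  ⟨f, f, by rw [hf.eq, hf.eq], by rw [hf.eq, hf.eq], hf.eq, hf.eq⟩

/-- Conjugation by the unit `σ` carries one idempotent to the other. -/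
theorem idemIso_onV (hs : ActsBy π s) (i : Q.Vert) : IdemIso (eB π i : 𝔹) (eB π (s.onV i)) := by
  have h : ∀ i, (eB π i * σB A : 𝔹) = σB A * eB π (s.onV i) := fun i => by
    rw [σB_mul_eB hs, s.onV_onV]
  refine ⟨eB π i * σB A, eB π (s.onV i) * σB A, ?_, ?_, ?_, ?_⟩
  · rw [← mul_assoc, eB_mul_self, h, mul_assoc, eB_mul_self]
  · rw [← mul_assoc, eB_mul_self, h, s.onV_onV, mul_assoc, eB_mul_self]
  · rw [h i, mul_assoc, ← mul_assoc (eB π _), eB_mul_self, ← mul_assoc, ← h, mul_assoc, σB_mul_σB,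
      mul_one]
  · rw [h (s.onV i), s.onV_onV, mul_assoc, ← mul_assoc (eB π _), eB_mul_self, ← mul_assoc,
      σB_mul_eB hs, mul_assoc, σB_mul_σB, mul_one]

/-- The representatives of the isomorphism classes are both halves at every fixed vertex and one
trivial path for each pair of moved vertices. They are the primitive idempotents lying at vertices
in the image of `sec`. -/
theorem isBasicIdem_η (h2 : (2 : k) ≠ 0) (hs : ActsBy π s) : IsBasicIdem (φ.η π : 𝔹) := by
  classical
  have := Q.finite_vert
  have := R.finite_vert
  have := Fintype.ofFinite Q.Vert
  have := Fintype.ofFinite R.Vert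
  obtain ⟨γ, hE, hA, hσ, hsm⟩ := φ.exists_grading hs
  have hE' : ∀ i, γ.zeroPart (eB π i) = eB π i := fun i => by
    rw [Grading.zeroPart, hE, Polynomial.coeff_C_zero]
  have hσ' : γ.zeroPart (σB A) = σB A := by rw [Grading.zeroPart, hσ, Polynomial.coeff_C_zero]
  have hA' : ∀ a, γ.zeroPart (aB π a) = 0 := fun a => by
    rw [Grading.zeroPart, hA, Polynomial.mul_coeff_zero, Polynomial.coeff_X_zero, mul_zero]
  have hsm' : ∀ (c : k) x, γ.zeroPart (c • x) = c • γ.zeroPart x := fun c x => by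
    rw [Grading.zeroPart, hsm, Polynomial.coeff_smul]; rfl
  have hγ := eB_mul_zeroPart hE' hA' hσ' hsm'
  have hprim : ∀ x, γ.zeroPart (prim s π x) = prim s π x := fun x => by
    rcases x with ⟨i, ε⟩ | i
    · change γ.zeroPart (half π i.1 ε) = half π i.1 ε
      rw [half, hsm', Grading.zeroPart_add, hsm', Grading.zeroPart_mul, hE', hσ']
    · exact hE' _
  refine isBasicIdem_of_fintype (f := prim s π)
    (s := Finset.univ.filter fun x => φ.sec (φ.down (vtx x)) = vtx x) (prim_complete h2 hs)
    (fun x => γ.isPrimitiveIdem (prim_idem h2 hs x) (prim_ne_zero h2 x) (hprim x)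
      (prim_mul_zeroPart_mul_prim h2 hs hγ x)) ?_ ?_ ?_
  · intro x hx y hy h
    by_contra hxy
    exact γ.not_idemIso (prim_idem h2 hs x) (prim_ne_zero h2 x) (hprim x) (hprim y)
      (φ.prim_mul_zeroPart_mul_prim_of_ne h2 hs hγ hxy (Finset.mem_filter.1 hx).2
        (Finset.mem_filter.1 hy).2) h
  · rintro (⟨i, ε⟩ | i)
    · exact ⟨Sum.inl (i, ε), Finset.mem_filter.2 ⟨Finset.mem_univ _, φ.sec_down_of_fixed i.2⟩,
        idemIso_prim (prim_idem h2 hs _)⟩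
    · by_cases h : φ.sec (φ.down i.1) = i.1
      · exact ⟨Sum.inr i, Finset.mem_filter.2 ⟨Finset.mem_univ _, h⟩, idemIso_prim (prim_idem h2 hs _)⟩
      · refine ⟨Sum.inr ⟨s.onV i.1, fun h' => i.2 (onV_eq_iff.1 h')⟩,
          Finset.mem_filter.2 ⟨Finset.mem_univ _, ?_⟩, idemIso_onV hs i.1⟩
        change φ.sec (φ.down (s.onV i.1)) = s.onV i.1
        rw [φ.down_onV, φ.sec_down_onV h]
  -- Rewritten over all vertices, the sum `η` can be split into fixed and moved ones, and each fixed
  -- term into its two halves.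
  · have h1 : (φ.η π : 𝔹) = ∑ i, if φ.sec (φ.down i) = i then eB π i else 0 := by
      rw [η, finsum_eq_sum_of_fintype, ← Finset.sum_filter]
      refine Finset.sum_bij (fun j _ => φ.sec j) (fun j _ => ?_) (fun i _ j _ h => φ.sec_injective h)
        (fun i hi => ⟨φ.down i, Finset.mem_univ _, (Finset.mem_filter.1 hi).2⟩) (fun _ _ => rfl)
      exact Finset.mem_filter.2 ⟨Finset.mem_univ _, by rw [φ.down_sec]⟩
    rw [h1, Finset.sum_filter, Fintype.sum_sum_type,
      ← Fintype.sum_subtype_add_sum_subtype (fun i => s.onV i = i)]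
    congr 1
    rw [Fintype.sum_prod_type]
    refine Finset.sum_congr rfl fun i _ => ?_
    have hi := φ.sec_down_of_fixed i.2
    have hε : ∀ ε, φ.sec (φ.down (vtx (Sum.inl (i, ε) : Idx s))) = vtx (Sum.inl (i, ε)) :=
      fun _ => hi
    rw [if_pos hi, Fin.sum_univ_two, if_pos (hε 0), if_pos (hε 1)]
    exact (half_add_half h2 i.1).symm

end Folding
end GSurf

/-! ### An orientation-preserving involution has no isolated fixed point on the boundary. -/

namespace GSurf

open Set Filter Topology

/-- A linear involution of the plane with positive determinant that preserves a half plane is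
the identity. -/
theorem eq_id_of_preserves_halfPlane {L : Plane →L[ℝ] Plane} (hLL : ∀ v, L (L v) = v)
    (hpos : ∀ v : Plane, 0 ≤ v 0 → 0 ≤ L v 0) (hdet : 0 < L.det) :
    L = ContinuousLinearMap.id ℝ Plane := by
  set e0 : Plane := EuclideanSpace.single 0 1 with he0
  set e1 : Plane := EuclideanSpace.single 1 1 with he1
  have hdec : ∀ v : Plane, v = v 0 • e0 + v 1 • e1 := fun v => by
    ext i; fin_cases i <;> simp [he0, he1]
  -- Both `e1` and `-e1` lie in the half plane, so the boundary line is preserved and the matrix of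
  -- `L` is triangular.
  have h10 : L e1 0 = 0 := by
    have h1 := hpos e1 (by simp [he1])
    have h2 := hpos (-e1) (by simp [he1])
    rw [map_neg, PiLp.neg_apply] at h2
    linarith
  have hd : L.det = L e0 0 * L e1 1 := by
    have : L.det = LinearMap.det (L : Plane →ₗ[ℝ] Plane) := rfl
    rw [this, ← LinearMap.det_toMatrix (EuclideanSpace.basisFun (Fin 2) ℝ).toBasis,
      Matrix.det_fin_two]
    simp [LinearMap.toMatrix_apply, ← he0, ← he1, h10]
  have ha : 0 ≤ L e0 0 := hpos e0 (by simp [he0])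
  have hL : ∀ v, L v = v 0 • L e0 + v 1 • L e1 := fun v => by
    conv_lhs => rw [hdec v]
    rw [map_add, map_smul, map_smul]
  have h0 := hLL e0
  rw [hL (L e0)] at h0
  have h00 := congrArg (fun v : Plane => v 0) h0
  have h01 := congrArg (fun v : Plane => v 1) h0
  have h1 := hLL e1
  rw [hL (L e1)] at h1
  have h11 := congrArg (fun v : Plane => v 1) h1
  simp [he0, he1] at h00 h01 h11
  rw [← he0, ← he1] at h00 h01
  rw [← he1] at h11
  rw [h10] at h00 h11
  -- The diagonal entries square to `1`. The first is nonnegative and the determinant is positive,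
  -- so both are `1`, and the square of the matrix being the identity then kills the off-diagonal
  -- entry.
  have a1 : L e0 0 = 1 := by nlinarith
  have d1 : L e1 1 = 1 := by
    rw [hd, a1] at hdet
    nlinarith
  have c0 : L e0 1 = 0 := by rw [a1, d1] at h01; linarith
  ext v i
  rw [hL v]
  fin_cases i <;> simp [a1, d1, c0, h10]

theorem mem_range_halfPlane {x : Plane} : x ∈ range (𝓡∂ 2) ↔ 0 ≤ x 0 := by
  rw [range_modelWithCornersEuclideanHalfSpace]; rfl

/-- A smooth orientation-preserving involution of a half plane is the identity near a fixed point
on the boundary. -/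
theorem eventually_fixed_halfPlane {F : Plane → Plane} {x₀ : Plane} (h0 : x₀ 0 = 0)
    (hmaps : ∀ x, 0 ≤ F x 0) (hfix : F x₀ = x₀)
    (hinv : ∀ᶠ x in 𝓝[range (𝓡∂ 2)] x₀, F (F x) = x)
    (hC : ContDiffWithinAt ℝ ∞ F (range (𝓡∂ 2)) x₀)
    (hdet : 0 < (fderivWithin ℝ F (range (𝓡∂ 2)) x₀).det) :
    ∀ᶠ x in 𝓝[range (𝓡∂ 2)] x₀, F x = x := by
  set H := range (𝓡∂ 2) with hH
  have hx₀ : x₀ ∈ H := mem_range_halfPlane.2 h0.ge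
  have hFH : ∀ x, F x ∈ H := fun x => mem_range_halfPlane.2 (hmaps x)
  have hconv : Convex ℝ H := (𝓡∂ 2).convex_range
  have hL : HasFDerivWithinAt F (fderivWithin ℝ F H x₀) H x₀ :=
    (hC.differentiableWithinAt (by simp)).hasFDerivWithinAt
  have huniq : UniqueDiffWithinAt ℝ H x₀ := (𝓡∂ 2).uniqueDiffOn _ hx₀
  set L := fderivWithin ℝ F H x₀ with hLdef
  have hLid : L = ContinuousLinearMap.id ℝ Plane := by
    refine eq_id_of_preserves_halfPlane (fun v => ?_) (fun v hv => ?_) hdet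
    · have h1 : HasFDerivWithinAt F L H (F x₀) := by rwa [hfix]
      have h2 := h1.comp x₀ hL (fun x _ => hFH x)
      have h3 : HasFDerivWithinAt (F ∘ F) (ContinuousLinearMap.id ℝ Plane) H x₀ :=
        (hasFDerivWithinAt_id x₀ H).congr_of_eventuallyEq hinv (by simp [hfix])
      exact DFunLike.congr_fun (huniq.eq h2 h3) v
    -- The first coordinate of `F` is minimal at the boundary point, so its derivative is
    -- nonnegative in every direction pointing into the half plane.
    · let pr : Plane →L[ℝ] ℝ := EuclideanSpace.proj 0
      have h1 : HasFDerivWithinAt (fun x => F x 0) (pr.comp L) H x₀ :=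
        pr.hasFDerivAt.comp_hasFDerivWithinAt x₀ hL
      have h2 : IsLocalMinOn (fun x => F x 0) H x₀ :=
        Filter.Eventually.of_forall fun x => by simp only [hfix, h0]; exact hmaps x
      refine h2.hasFDerivWithinAt_nonneg h1 (mem_posTangentConeAt_of_segment_subset ?_)
      exact hconv.segment_subset hx₀ (mem_range_halfPlane.2 (by simpa [h0] using hv))
  -- Any bound below `2` would do for the distance from the derivative to the identity.
  obtain ⟨r, hr, hrd⟩ : ∃ r > 0, ∀ x ∈ Metric.ball x₀ r ∩ H,
      DifferentiableWithinAt ℝ F H x ∧ ‖fderivWithin ℝ F H x - ContinuousLinearMap.id ℝ Plane‖ ≤ 1 := by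
    have h1 : ∀ᶠ x in 𝓝[H] x₀, ContDiffWithinAt ℝ 1 F H x := by
      have := (hC.of_le (m := 1) (by simp)).eventually (by simp)
      rwa [insert_eq_of_mem hx₀] at this
    have h2 : ContinuousWithinAt (fderivWithin ℝ F H) H x₀ :=
      (hC.fderivWithin_right (m := 0) (𝓡∂ 2).uniqueDiffOn (by simp) hx₀).continuousWithinAt
    have h3 : ∀ᶠ x in 𝓝[H] x₀, ‖fderivWithin ℝ F H x - ContinuousLinearMap.id ℝ Plane‖ < 1 := by
      have h4 := (h2.sub (continuousWithinAt_const (b := ContinuousLinearMap.id ℝ Plane))).norm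
      refine h4.eventually (gt_mem_nhds ?_)
      simp only [Pi.sub_apply]
      rw [← hLdef, hLid]; simp
    obtain ⟨r, hr, h⟩ := Metric.mem_nhdsWithin_iff.1 (h1.and h3)
    exact ⟨r, hr, fun x hx => ⟨(h hx).1.differentiableWithinAt (by simp), (h hx).2.le⟩⟩
  have hball : ∀ᶠ x in 𝓝[H] x₀, x ∈ Metric.ball x₀ r ∩ H :=
    inter_mem (mem_nhdsWithin_of_mem_nhds (Metric.ball_mem_nhds _ hr)) self_mem_nhdsWithin
  have hball' : ∀ᶠ x in 𝓝[H] x₀, F x ∈ Metric.ball x₀ r ∩ H := by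
    have h1 : Tendsto F (𝓝[H] x₀) (𝓝 x₀) := by
      have := hC.continuousWithinAt.tendsto
      rwa [hfix] at this
    filter_upwards [h1 (Metric.ball_mem_nhds _ hr)] with x hx using ⟨hx, hFH x⟩
  filter_upwards [hinv, hball, hball'] with x hx h1 h2
  -- The mean value inequality for `F - id` between `x` and `F x`. As `F (F x) = x`, it reads `2 ‖F
  -- x - x‖ ≤ ‖F x - x‖`.
  have h3 := ((convex_ball x₀ r).inter hconv).norm_image_sub_le_of_norm_hasFDerivWithin_le'
    (fun y hy => (hrd y hy).1.hasFDerivWithinAt.mono inter_subset_right)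
    (fun y hy => (hrd y hy).2) h1 h2
  have h4 : F (F x) - F x - (ContinuousLinearMap.id ℝ Plane) (F x - x) = (-2 : ℝ) • (F x - x) := by
    rw [hx, ContinuousLinearMap.id_apply, neg_smul, two_smul]; abel
  rw [h4, norm_smul, Real.norm_eq_abs] at h3
  norm_num at h3
  exact sub_eq_zero.1 (norm_eq_zero.1 (by linarith [norm_nonneg (F x - x)]))

section Surface

variable {S : Type*} [TopologicalSpace S] [ChartedSpace (EuclideanHalfSpace 2) S]
  [IsManifold (𝓡∂ 2) ∞ S]

/-- Whether a point is an interior point can be read off in any chart of the smooth structure. -/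
theorem mem_interior_range_of_mem_maximalAtlas {E H N : Type*} [NormedAddCommGroup E]
    [NormedSpace ℝ E] [TopologicalSpace H] [TopologicalSpace N] [ChartedSpace H N]
    {I : ModelWithCorners ℝ E H} [IsManifold I ∞ N] {e e' : OpenPartialHomeomorph N H}
    (he : e ∈ IsManifold.maximalAtlas I ∞ N) (he' : e' ∈ IsManifold.maximalAtlas I ∞ N) {x : N}
    (hex : x ∈ e.source) (hex' : x ∈ e'.source) (hin : e.extend I x ∈ interior (range I)) :
    e'.extend I x ∈ interior (range I) := by
  have hin' : e.extend I x ∈ interior (e.extend I).target :=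
    e.mem_interior_extend_target (by simp [hex]) hin
  let φ := I.extendCoordChange e e'
  have hφ : ContDiffOn ℝ ∞ φ φ.source :=
    ModelWithCorners.contDiffOn_extendCoordChange he he'
  have hinv : Function.Surjective (fderivWithin ℝ φ φ.source (e.extend I x)) :=
    (ModelWithCorners.isInvertible_fderivWithin_extendCoordChange
    (by simp : (∞ : WithTop ℕ∞) ≠ 0) he he' (by simp [hex, hex'])).surjective
  have hφx : φ.source ∈ 𝓝 (e.extend I x) := by
    simp_rw [φ, ModelWithCorners.extendCoordChange, PartialEquiv.trans_source,
      PartialEquiv.symm_source, Filter.inter_mem_iff, mem_interior_iff_mem_nhds.1 hin', true_and,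
      e'.extend_source]
    exact e.extend_preimage_mem_nhds hex <| e'.open_source.mem_nhds hex'
  rw [fderivWithin_of_mem_nhds hφx] at hinv
  have h1 := (hφ.differentiableOn (by simp)).differentiableAt hφx
  rw [show e'.extend I x = φ (e.extend I x) by simp [φ, hex]]
  -- The chart change has surjective derivative at the point and takes values in the convex range of
  -- the model, so the image point is interior to that range.
  exact h1.mem_interior_convex_of_surjective_fderiv hφx I.convex_range
    I.isClosed_range I.nonempty_interior
    (φ.mapsTo.mono_right <| by simp [φ, inter_assoc]) hinv

/-- Charts of the smooth structure send boundary points to the boundary of the half plane. -/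
theorem extend_zero_of_mem_boundary {e : OpenPartialHomeomorph S (EuclideanHalfSpace 2)}
    (he : e ∈ IsManifold.maximalAtlas (𝓡∂ 2) ∞ S) {x : S} (hex : x ∈ e.source)
    (hx : x ∈ (𝓡∂ 2).boundary S) : e.extend (𝓡∂ 2) x 0 = 0 := by
  by_contra hne
  have hin : e.extend (𝓡∂ 2) x ∈ interior (range (𝓡∂ 2)) := by
    rw [interior_range_modelWithCornersEuclideanHalfSpace]
    exact lt_of_le_of_ne (mem_range_halfPlane.1 ⟨e x, rfl⟩) (Ne.symm hne)
  have h2 := mem_interior_range_of_mem_maximalAtlas he (IsManifold.chart_mem_maximalAtlas x) hex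
    (mem_chart_source _ x) hin
  have h3 : extChartAt (𝓡∂ 2) x x ∈ frontier (range (𝓡∂ 2)) := hx
  exact h3.2 h2

/-- An orientation-preserving involution with finitely many fixed points has no fixed points on
the boundary. -/
theorem GMarkedSurface.σ_ne_of_mem_boundary (𝒮 : GMarkedSurface S) {s : S}
    (hs : s ∈ (𝓡∂ 2).boundary S) : 𝒮.σ s ≠ s := by
  intro hfix
  obtain ⟨φ, hφ, hsφ⟩ := 𝒮.orient.cover s
  have hsφ' : 𝒮.σ s ∈ φ.source := by rwa [hfix]
  set x₀ := φ.extend (𝓡∂ 2) s with hx₀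
  set F := φ.extend (𝓡∂ 2) ∘ 𝒮.σ ∘ (φ.extend (𝓡∂ 2)).symm with hF
  have hsymm : (φ.extend (𝓡∂ 2)).symm x₀ = s := φ.extend_left_inv hsφ
  have h0 : x₀ 0 = 0 := extend_zero_of_mem_boundary (𝒮.orient.subset hφ) hsφ hs
  have htarget : ∀ᶠ x in 𝓝[range (𝓡∂ 2)] x₀, x ∈ (φ.extend (𝓡∂ 2)).target :=
    φ.extend_target_mem_nhdsWithin hsφ
  have hsource : ∀ᶠ x in 𝓝[range (𝓡∂ 2)] x₀, 𝒮.σ ((φ.extend (𝓡∂ 2)).symm x) ∈ φ.source := by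
    have h1 : ContinuousAt (𝒮.σ ∘ (φ.extend (𝓡∂ 2)).symm) x₀ :=
      𝒮.σ.continuous.continuousAt.comp (φ.continuousAt_extend_symm hsφ)
    refine mem_nhdsWithin_of_mem_nhds (h1.preimage_mem_nhds (φ.open_source.mem_nhds ?_))
    simpa only [Function.comp_apply, hsymm] using hsφ'
  have hinv : ∀ᶠ x in 𝓝[range (𝓡∂ 2)] x₀, F (F x) = x := by
    filter_upwards [htarget, hsource] with x hx hx'
    simp only [hF, Function.comp_apply]
    rw [φ.extend_left_inv hx', 𝒮.σ_σ, (φ.extend (𝓡∂ 2)).right_inv hx]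
  have hC : ContDiffWithinAt ℝ ∞ F (range (𝓡∂ 2)) x₀ := by
    have h1 : ContMDiffAt (𝓡∂ 2) (𝓡∂ 2) ∞ 𝒮.σ s := 𝒮.σ.contMDiff.contMDiffAt
    have h2 := (contMDiffWithinAt_iff_of_mem_maximalAtlas (s := univ)
      (𝒮.orient.subset hφ) (𝒮.orient.subset hφ) hsφ hsφ').1 h1
    have h3 := h2.2
    rwa [preimage_univ, univ_inter] at h3
  have hfix' : F x₀ = x₀ := by simp only [hF, Function.comp_apply, hsymm, hfix]; rfl
  have hmain := eventually_fixed_halfPlane (F := F) h0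
    (fun x => mem_range_halfPlane.1 ⟨φ (𝒮.σ ((φ.extend (𝓡∂ 2)).symm x)), rfl⟩) hfix' hinv hC
    (𝒮.σ_orient φ hφ φ hφ s hsφ hsφ')
  have hfin : {x | x ∈ (φ.extend (𝓡∂ 2)).target ∧
      𝒮.σ ((φ.extend (𝓡∂ 2)).symm x) = (φ.extend (𝓡∂ 2)).symm x}.Finite := by
    refine Set.Finite.of_finite_image (f := (φ.extend (𝓡∂ 2)).symm)
      (𝒮.fixed_finite.subset ?_) ?_
    · rintro _ ⟨x, hx, rfl⟩
      exact hx.2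
    · intro x hx y hy h
      exact (φ.extend (𝓡∂ 2)).symm.injOn hx.1 hy.1 h
  have hev : ∀ᶠ x in 𝓝[range (𝓡∂ 2)] x₀, x ∈ {x | x ∈ (φ.extend (𝓡∂ 2)).target ∧
      𝒮.σ ((φ.extend (𝓡∂ 2)).symm x) = (φ.extend (𝓡∂ 2)).symm x} := by
    filter_upwards [htarget, hsource, hmain] with x hx hx' hx''
    refine ⟨hx, ?_⟩
    conv_rhs => rw [← hx'']
    simp only [hF, Function.comp_apply]
    rw [φ.extend_left_inv hx']
  set c : ℝ → Plane := fun t => x₀ + t • EuclideanSpace.single 1 1 with hc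
  have hcinj : Function.Injective c := fun t t' h => by
    have := congrArg (fun v : Plane => v 1) h
    simpa [hc] using this
  have hcont : Tendsto c (𝓝 0) (𝓝[range (𝓡∂ 2)] x₀) := by
    refine tendsto_nhdsWithin_iff.2 ⟨?_, Filter.Eventually.of_forall fun t => ?_⟩
    · have : Continuous c := by fun_prop
      simpa [hc] using this.tendsto 0
    · rw [mem_range_halfPlane]; simp [hc, h0]
  exact infinite_of_mem_nhds (0 : ℝ) (hcont.eventually hev) (hfin.preimage hcinj.injOn)

/-- The freeness at marked points on which the lifting of sectors and the choice of lifts of arrows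
depend. -/
theorem GMarkedSurface.σ_ne_of_mem_marked (𝒮 : GMarkedSurface S) {s : S} (hs : s ∈ 𝒮.M ∪ 𝒮.P) :
    𝒮.σ s ≠ s :=
  hs.elim (fun h => 𝒮.σ_ne_of_mem_boundary (𝒮.M_subset h)) fun h h' => 𝒮.fixed_P s h' h

end Surface

end GSurf

/-! ### Sectors at marked points and their reparametrization. -/

namespace GSurf

open Set Filter Topology

/-- The polar coordinates of the closed sector of radius `ε`. -/
abbrev closedSector (ε : ℝ) : Set Plane := {z | z 0 ∈ Icc 0 ε ∧ z 1 ∈ Icc 0 1}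

/-- The polar coordinates of the open sector of radius `ε`. -/
abbrev openSector (ε : ℝ) : Set Plane := {z | z 0 ∈ Ioo 0 ε ∧ z 1 ∈ Ioo 0 1}

theorem closedSector_mono {ε ε' : ℝ} (h : ε ≤ ε') : closedSector ε ⊆ closedSector ε' :=
  fun _ hz => ⟨⟨hz.1.1, hz.1.2.trans h⟩, hz.2⟩

theorem openSector_mono {ε ε' : ℝ} (h : ε ≤ ε') : openSector ε ⊆ openSector ε' :=
  fun _ hz => ⟨⟨hz.1.1, hz.1.2.trans_le h⟩, hz.2⟩

theorem openSector_subset_closedSector (ε : ℝ) : openSector ε ⊆ closedSector ε :=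
  fun _ hz => ⟨Ioo_subset_Icc_self hz.1, Ioo_subset_Icc_self hz.2⟩

/-- A map on a sector that is continuous and sends the vertex into an open set sends a smaller
sector into this set. -/
theorem exists_closedSector_mapsTo {T : Type*} [TopologicalSpace T] {g : Plane → T} {ε : ℝ}
    (hε : 0 < ε) (hg : ContinuousOn g (closedSector ε)) {v : T}
    (hv : ∀ θ ∈ Icc (0 : ℝ) 1, g !₂[0, θ] = v) {U : Set T} (hU : IsOpen U) (hvU : v ∈ U) :
    ∃ δ, 0 < δ ∧ δ ≤ ε ∧ MapsTo g (closedSector δ) U := by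
  -- Clamping both coordinates turns `g`, continuous only on the sector, into a map continuous on
  -- the whole plane.
  let ρ : ℝ × ℝ → Plane := fun z => !₂[(projIcc 0 ε hε.le z.1 : ℝ), (projIcc 0 1 zero_le_one z.2 : ℝ)]
  have hρ : Continuous ρ := by
    refine (PiLp.continuous_toLp 2 _).comp (continuous_pi fun i => ?_)
    fin_cases i
    · exact continuous_subtype_val.comp (continuous_projIcc.comp continuous_fst)
    · exact continuous_subtype_val.comp (continuous_projIcc.comp continuous_snd)
  have hG : Continuous (g ∘ ρ) := hg.comp_continuous hρ fun z =>
    ⟨(projIcc 0 ε hε.le z.1).2, (projIcc 0 1 zero_le_one z.2).2⟩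
  -- The edge `r = 0` is sent to the vertex, so compactness of the interval of angles gives a
  -- uniform radius.
  have key : ∀ᶠ r in 𝓝 (0 : ℝ), ∀ θ ∈ Icc (0 : ℝ) 1, (g ∘ ρ) (r, θ) ∈ U := by
    refine isCompact_Icc.eventually_forall_of_forall_eventually fun θ hθ => ?_
    refine hG.continuousAt.preimage_mem_nhds (hU.mem_nhds ?_)
    have : ρ (0, θ) = !₂[0, θ] := by
      simp only [ρ]
      rw [projIcc_of_mem _ hθ, projIcc_of_mem _ (left_mem_Icc.2 hε.le)]
    rw [Function.comp_apply, this, hv θ hθ]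
    exact hvU
  obtain ⟨η, hη, h⟩ := Metric.eventually_nhds_iff.1 key
  refine ⟨min ε (η / 2), by positivity, min_le_left _ _, fun z hz => ?_⟩
  have h1 : z 0 ∈ Icc 0 ε := ⟨hz.1.1, hz.1.2.trans (min_le_left _ _)⟩
  have h2 := h (y := z 0) (by
    rw [Real.dist_eq, sub_zero, abs_of_nonneg hz.1.1]
    have := hz.1.2.trans (min_le_right _ _)
    linarith) (z 1) hz.2
  have h3 : ρ (z 0, z 1) = z := by
    simp only [ρ]
    rw [projIcc_of_mem _ hz.2, projIcc_of_mem _ h1]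
    ext i; fin_cases i <;> rfl
  rwa [Function.comp_apply, h3] at h2

namespace ArcSystem

variable {T : Type*} [TopologicalSpace T] (D : ArcSystem T)

/-- There is a sector at the marked point `v`, whose sides run along `c` and `c'` and whose
interior is embedded with the positive orientation and meets no arc of the system. -/
def Sector (v : T) (c c' : ℝ → T) : Prop :=
  v ∈ D.V ∧ ∃ ε : ℝ, 0 < ε ∧ ∃ g : Plane → T,
    ContinuousOn g (closedSector ε) ∧
    (∀ θ ∈ Icc (0 : ℝ) 1, g !₂[0, θ] = v) ∧
    (∀ r ∈ Icc 0 ε, g !₂[r, 0] = c r ∧ g !₂[r, 1] = c' r) ∧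
    InjOn g (openSector ε) ∧
    ∀ z ∈ openSector ε, D.posAt g z ∧ ∀ γ ∈ D.E, g z ∉ range γ

/-- A curve, extended to the real line. -/
abbrev ext (γ : C(unitInterval, T)) : ℝ → T := IccExtend zero_le_one γ

/-- `Sector` only involves the sides near the vertex and has no bound on the radius, which makes it
stable under changes of speed; the radius can be cut down to at most `1`. -/
theorem follows_iff_sector {h h' : C(unitInterval, T)} :
    D.Follows h h' ↔ D.Sector (h 0) (ext h) (ext h') := by
  constructor
  · rintro ⟨hv, ε, h0, h1, g, gc, gt, gs, gi, gp⟩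
    refine ⟨hv, ε, h0, g, gc, gt, fun r hr => ?_, gi, fun z hz => gp z hz.1 hz.2⟩
    have hr' : r ∈ Icc (0 : ℝ) 1 := ⟨hr.1, hr.2.trans h1⟩
    rw [ext, ext, IccExtend_of_mem _ _ hr', IccExtend_of_mem _ _ hr']
    exact gs ⟨r, hr'⟩ hr.2
  · rintro ⟨hv, ε, h0, g, gc, gt, gs, gi, gp⟩
    have hm := min_le_left ε 1
    refine ⟨hv, min ε 1, lt_min h0 one_pos, min_le_right _ _, g,
      gc.mono (closedSector_mono hm), gt, fun r hr => ?_, gi.mono (openSector_mono hm),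
      fun z hz hz' => gp z (openSector_mono hm ⟨hz, hz'⟩)⟩
    have := gs r ⟨r.2.1, hr.trans hm⟩
    rwa [ext, ext, IccExtend_val, IccExtend_val] at this

/-- The orientation datum of the system is compatible with changes of parameters. -/
def PosAtComp : Prop :=
  ∀ (g : Plane → T) (ρ : Plane → Plane) (z : Plane), D.posAt g (ρ z) → ContDiffAt ℝ ∞ ρ z →
    0 < (fderiv ℝ ρ z).det → D.posAt (g ∘ ρ) z

variable {D}

/-- Rescaling of the radius in polar coordinates. -/
def rescale (a b : ℝ) (z : Plane) : Plane := !₂[z 0 * (a + z 1 * (b - a)), z 1]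

theorem contDiff_rescale (a b : ℝ) : ContDiff ℝ ∞ (rescale a b) := by
  rw [contDiff_euclidean]
  intro i
  fin_cases i
  · have h0 : ContDiff ℝ ∞ fun z : Plane => z 0 := contDiff_piLp_apply 2
    have h1 : ContDiff ℝ ∞ fun z : Plane => z 1 := contDiff_piLp_apply 2
    exact h0.mul (contDiff_const.add (h1.mul contDiff_const))
  · exact contDiff_piLp_apply 2

/-- The angle is unchanged, so the Jacobian is triangular with entries the radial factor and `1`. -/
theorem det_fderiv_rescale (a b : ℝ) (z : Plane) :
    (fderiv ℝ (rescale a b) z).det = a + z 1 * (b - a) := by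
  have h0 : HasFDerivAt (fun z : Plane => z 0) (EuclideanSpace.proj 0 : Plane →L[ℝ] ℝ) z :=
    (EuclideanSpace.proj 0 : Plane →L[ℝ] ℝ).hasFDerivAt
  have h1 : HasFDerivAt (fun z : Plane => z 1) (EuclideanSpace.proj 1 : Plane →L[ℝ] ℝ) z :=
    (EuclideanSpace.proj 1 : Plane →L[ℝ] ℝ).hasFDerivAt
  have h2 := (contDiff_rescale a b).differentiable (by simp) z |>.hasFDerivAt
  have hc0 := ((EuclideanSpace.proj 0 : Plane →L[ℝ] ℝ).hasFDerivAt.comp z h2).unique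
    (h0.mul ((h1.mul_const (b - a)).const_add a))
  have hc1 := ((EuclideanSpace.proj 1 : Plane →L[ℝ] ℝ).hasFDerivAt.comp z h2).unique h1
  set L := fderiv ℝ (rescale a b) z
  have e00 := DFunLike.congr_fun hc0 (EuclideanSpace.single 0 1)
  have e10 := DFunLike.congr_fun hc1 (EuclideanSpace.single 0 1)
  have e11 := DFunLike.congr_fun hc1 (EuclideanSpace.single 1 1)
  simp at e00 e10 e11
  have : L.det = LinearMap.det (L : Plane →ₗ[ℝ] Plane) := rfl
  rw [this, ← LinearMap.det_toMatrix (EuclideanSpace.basisFun (Fin 2) ℝ).toBasis,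
    Matrix.det_fin_two]
  simp [LinearMap.toMatrix_apply, e00, e10, e11]

theorem scale_pos {a b θ : ℝ} (ha : 0 < a) (hb : 0 < b) (hθ : θ ∈ Icc (0 : ℝ) 1) :
    0 < a + θ * (b - a) := by
  rcases eq_or_lt_of_le hθ.1 with h | h
  · rw [← h]; linarith
  · nlinarith [mul_pos h hb, mul_nonneg (sub_nonneg.2 hθ.2) ha.le]

/-- The image of a reversed arc runs at half speed, so the two sides of a sector may be rescaled by
different factors. The radial factor interpolates linearly between them as the angle varies. -/
theorem Sector.rescale (hD : D.PosAtComp) {v : T} {c c' d d' : ℝ → T} (H : D.Sector v c c')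
    {a b δ : ℝ} (ha : 0 < a) (hb : 0 < b) (hδ : 0 < δ) (hd : ∀ r ∈ Icc 0 δ, d r = c (a * r))
    (hd' : ∀ r ∈ Icc 0 δ, d' r = c' (b * r)) : D.Sector v d d' := by
  obtain ⟨hv, ε, h0, g, gc, gt, gs, gi, gp⟩ := H
  have hs : 0 < a + b := by positivity
  -- The sum `a + b` bounds every interpolated factor.
  set ε' := min δ (ε / (a + b)) with hε'
  have hε'0 : 0 < ε' := by positivity
  have hle : ∀ {r θ : ℝ}, 0 ≤ r → θ ∈ Icc (0 : ℝ) 1 → r * (a + θ * (b - a)) ≤ r * (a + b) :=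
    fun hr hθ => mul_le_mul_of_nonneg_left
      (by nlinarith [mul_nonneg (sub_nonneg.2 hθ.2) hb.le, mul_nonneg hθ.1 ha.le]) hr
  have hε : ε' * (a + b) ≤ ε := (le_div_iff₀ hs).1 (min_le_right _ _)
  have hmaps : MapsTo (ArcSystem.rescale a b) (closedSector ε') (closedSector ε) := fun z hz => by
    refine ⟨⟨mul_nonneg hz.1.1 (scale_pos ha hb hz.2).le, (hle hz.1.1 hz.2).trans ?_⟩, hz.2⟩
    exact (mul_le_mul_of_nonneg_right hz.1.2 hs.le).trans hε
  have hmaps' : MapsTo (ArcSystem.rescale a b) (openSector ε') (openSector ε) := fun z hz => by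
    have hz2 := Ioo_subset_Icc_self hz.2
    refine ⟨⟨mul_pos hz.1.1 (scale_pos ha hb hz2), (hle hz.1.1.le hz2).trans_lt ?_⟩, hz.2⟩
    exact (mul_lt_mul_of_pos_right hz.1.2 hs).trans_le hε
  have hr0 : ∀ {r}, r ∈ Icc 0 ε' → r ∈ Icc 0 δ := fun hr => ⟨hr.1, hr.2.trans (min_le_left _ _)⟩
  refine ⟨hv, ε', hε'0, g ∘ ArcSystem.rescale a b,
    gc.comp (contDiff_rescale a b).continuous.continuousOn hmaps, fun θ hθ => ?_, fun r hr => ⟨?_, ?_⟩,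
    gi.comp ?_ hmaps', fun z hz => ⟨?_, ?_⟩⟩
  · simpa [ArcSystem.rescale] using gt θ hθ
  · have := (hmaps (x := !₂[r, 0]) ⟨hr, by simp⟩).1
    rw [hd r (hr0 hr), ← (gs (a * r) (by simpa [ArcSystem.rescale, mul_comm] using this)).1]
    simp [ArcSystem.rescale, mul_comm]
  · have := (hmaps (x := !₂[r, 1]) ⟨hr, by simp⟩).1
    rw [hd' r (hr0 hr), ← (gs (b * r) (by simpa [ArcSystem.rescale, mul_comm] using this)).2]
    simp [ArcSystem.rescale, mul_comm]
  · intro z hz w hw h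
    have h1 := congrArg (fun v : Plane => v 1) h
    have h2 := congrArg (fun v : Plane => v 0) h
    change z 1 = w 1 at h1
    change z 0 * (a + z 1 * (b - a)) = w 0 * (a + w 1 * (b - a)) at h2
    rw [← h1] at h2
    have h3 := mul_right_cancel₀ (scale_pos ha hb (Ioo_subset_Icc_self hz.2)).ne' h2
    ext i; fin_cases i <;> assumption
  · refine hD _ _ _ (gp _ (hmaps' hz)).1 (contDiff_rescale a b).contDiffAt ?_
    rw [det_fderiv_rescale]
    exact scale_pos ha hb (Ioo_subset_Icc_self hz.2)
  · exact (gp _ (hmaps' hz)).2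

end ArcSystem

end GSurf

/-! ### Projecting and lifting sectors along the quotient map. -/

namespace GSurf

open Set Filter Topology

section Surface

variable {S : Type*} [TopologicalSpace S] [ChartedSpace (EuclideanHalfSpace 2) S]

theorem SurfaceOrientation.PosAt.congr {O : SurfaceOrientation S} {g g' : Plane → S} {z : Plane}
    (h : O.PosAt g z) (hg : g' =ᶠ[𝓝 z] g) : O.PosAt g' z := by
  obtain ⟨hc, φ, hφ, hs, hd, hdet⟩ := h
  have h1 : (φ.extend (𝓡∂ 2) ∘ g') =ᶠ[𝓝 z] (φ.extend (𝓡∂ 2) ∘ g) := hg.fun_comp _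
  refine ⟨hc.congr hg.symm, φ, hφ, by rwa [hg.eq_of_nhds], hd.congr_of_eventuallyEq h1, ?_⟩
  rwa [h1.fderiv_eq]

theorem SurfaceOrientation.PosAt.comp {O : SurfaceOrientation S} {g : Plane → S} {ρ : Plane → Plane}
    {z : Plane} (h : O.PosAt g (ρ z)) (hρ : ContDiffAt ℝ ∞ ρ z) (hdet : 0 < (fderiv ℝ ρ z).det) :
    O.PosAt (g ∘ ρ) z := by
  obtain ⟨hc, φ, hφ, hs, hd, hdet'⟩ := h
  refine ⟨hc.comp hρ.continuousAt, φ, hφ, hs, hd.comp z hρ, ?_⟩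
  have h1 := fderiv_comp z (hd.differentiableAt (by simp)) (hρ.differentiableAt (by simp))
  rw [← Function.comp_assoc, h1]
  have h3 : ((fderiv ℝ (φ.extend (𝓡∂ 2) ∘ g) (ρ z)).comp (fderiv ℝ ρ z)).det =
      (fderiv ℝ (φ.extend (𝓡∂ 2) ∘ g) (ρ z)).det * (fderiv ℝ ρ z).det := LinearMap.det_comp _ _
  rw [h3]
  exact mul_pos hdet' hdet

variable {𝒮 : GMarkedSurface S} (D : GDissection 𝒮)

namespace GDissection

theorem posAtComp_quotArcs : D.quotArcs.PosAtComp := by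
  rintro g ρ z ⟨g', h, hne, hev⟩ hρ hdet
  exact ⟨g' ∘ ρ, h.comp hρ hdet, hne, hρ.continuousAt.eventually hev⟩

end GDissection

namespace GMarkedSurface

variable (𝒮)

theorem p_eq_p {s t : S} : 𝒮.p s = 𝒮.p t ↔ t = s ∨ t = 𝒮.σ s :=
  ⟨fun h => Quotient.exact h, fun h => Quotient.sound h⟩

theorem p_σ (s : S) : 𝒮.p (𝒮.σ s) = 𝒮.p s := (𝒮.p_eq_p.2 (Or.inr rfl)).symm

theorem isOpenMap_p : IsOpenMap 𝒮.p := by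
  intro U hU
  have : 𝒮.p ⁻¹' (𝒮.p '' U) = U ∪ 𝒮.σ ⁻¹' U := by
    ext s
    constructor
    · rintro ⟨t, ht, h⟩
      rcases 𝒮.p_eq_p.1 h with rfl | rfl
      · exact Or.inl ht
      · exact Or.inr (by rwa [mem_preimage, 𝒮.σ_σ])
    · rintro (h | h)
      · exact ⟨s, h, rfl⟩
      · exact ⟨_, h, 𝒮.p_σ s⟩
  have h : IsOpen (𝒮.p ⁻¹' (𝒮.p '' U)) := this ▸ hU.union (hU.preimage 𝒮.σ.continuous)
  exact h

variable [T2Space S]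

/-- Disjoint neighbourhoods of `v` and `σ v` cut out a neighbourhood that misses its translate, so
`p` is injective on it. -/
theorem exists_open_nhds {v : S} (hv : 𝒮.σ v ≠ v) :
    ∃ U : Set S, IsOpen U ∧ v ∈ U ∧ (∀ x ∈ U, 𝒮.σ x ∉ U) ∧ InjOn 𝒮.p U := by
  obtain ⟨W, U, hW, hU, hσ, hvU, hd⟩ := t2_separation hv
  have key : ∀ x ∈ U ∩ 𝒮.σ ⁻¹' W, 𝒮.σ x ∉ U ∩ 𝒮.σ ⁻¹' W := fun x hx hx' =>
    disjoint_left.1 hd hx.2 hx'.1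
  refine ⟨U ∩ 𝒮.σ ⁻¹' W, hU.inter (hW.preimage 𝒮.σ.continuous), ⟨hvU, hσ⟩, key, fun x hx y hy h => ?_⟩
  rcases 𝒮.p_eq_p.1 h with rfl | rfl
  · rfl
  · exact absurd hy (key x hx)

end GMarkedSurface

namespace GDissection

theorem p_comp_σC (γ : C(unitInterval, S)) : 𝒮.p.comp (𝒮.σC.comp γ) = 𝒮.p.comp γ := by
  ext t; exact 𝒮.p_σ _

/-- Halving loses no points: on a reversed arc, `σ` folds the second half onto the first. -/
theorem range_proj (γ : C(unitInterval, S)) : range (proj (𝒮 := 𝒮) γ) = 𝒮.p '' range γ := by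
  rw [← range_comp]
  unfold proj
  split_ifs with h
  · apply subset_antisymm
    · rintro _ ⟨t, rfl⟩
      exact ⟨_, rfl⟩
    · rintro _ ⟨t, rfl⟩
      rcases le_total (t : ℝ) (1 / 2) with ht | ht
      · refine ⟨⟨2 * t, by linarith [t.2.1], by linarith⟩, ?_⟩
        simp [GSurf.half]
      · refine ⟨⟨2 * (1 - t), by linarith [t.2.2], by linarith⟩, ?_⟩
        have h1 : 𝒮.σ (γ (unitInterval.symm t)) = γ t := by
          have := DFunLike.congr_fun h (unitInterval.symm t)
          simpa [rev, GMarkedSurface.σC] using this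
        rw [Function.comp_apply, ← h1, 𝒮.p_σ]
        simp [GSurf.half]
        rfl
  · rfl

/-- As the dissection is `σ`-invariant, the preimage of the arcs of the quotient is the union of the
arcs upstairs. -/
theorem forall_notMem_range_iff (s : S) :
    (∀ γ ∈ D.quotArcs.E, 𝒮.p s ∉ range γ) ↔ ∀ γ ∈ D.arcs.E, s ∉ range γ := by
  constructor
  · rintro h γ hγ ⟨t, rfl⟩
    refine h _ (Or.inl ⟨γ, hγ, rfl⟩) ?_
    rw [range_proj]
    exact ⟨_, ⟨t, rfl⟩, rfl⟩
  · intro h δ hδ hs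
    obtain ⟨γ, hγ, hr⟩ : ∃ γ ∈ D.E, range δ = 𝒮.p '' range γ := by
      rcases hδ with ⟨γ, hγ, rfl⟩ | ⟨_, ⟨γ, hγ, rfl⟩, rfl⟩
      · exact ⟨γ, hγ, range_proj γ⟩
      · refine ⟨γ, hγ, ?_⟩
        rw [← range_proj]
        exact (unitInterval.symm_bijective.surjective).range_comp _
    rw [hr] at hs
    obtain ⟨_, ⟨t, rfl⟩, h1⟩ := hs
    rcases 𝒮.p_eq_p.1 h1 with rfl | rfl
    · exact h γ hγ ⟨t, rfl⟩
    · exact h _ (D.σ_mem γ hγ) ⟨t, rfl⟩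

variable [T2Space S] [IsManifold (𝓡∂ 2) ∞ S] {D}

/-- The image of a sector is a sector. -/
theorem sector_quot {v : S} {c c' : ℝ → S} (H : D.arcs.Sector v c c') :
    D.quotArcs.Sector (𝒮.p v) (𝒮.p ∘ c) (𝒮.p ∘ c') := by
  obtain ⟨hv, ε, h0, g, gc, gt, gs, gi, gp⟩ := H
  obtain ⟨U, hU, hvU, hσU, hinj⟩ := 𝒮.exists_open_nhds (𝒮.σ_ne_of_mem_marked hv)
  obtain ⟨δ, hδ, hδε, hm⟩ := exists_closedSector_mapsTo h0 gc gt hU hvU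
  have hm' : MapsTo g (openSector δ) U := hm.mono_left (openSector_subset_closedSector _)
  refine ⟨⟨v, hv, rfl⟩, δ, hδ, 𝒮.p ∘ g,
    𝒮.p.continuous.comp_continuousOn (gc.mono (closedSector_mono hδε)),
    fun θ hθ => congrArg 𝒮.p (gt θ hθ), fun r hr => ?_,
    hinj.comp (gi.mono (openSector_mono hδε)) hm', fun z hz => ?_⟩
  · have := gs r ⟨hr.1, hr.2.trans hδε⟩
    exact ⟨congrArg 𝒮.p this.1, congrArg 𝒮.p this.2⟩
  · have hz' := gp z (openSector_mono hδε hz)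
    -- The orientation of the quotient is only given off the orbifold points. The neighbourhood `U`
    -- misses its translate and so contains no fixed point.
    refine ⟨⟨g, hz'.1, fun h => hσU _ (hm' hz) ?_, Filter.Eventually.of_forall fun _ => rfl⟩,
      (D.forall_notMem_range_iff _).2 hz'.2⟩
    rw [h]; exact hm' hz

/-- A sector of the quotient lifts to a sector. -/
theorem sector_lift {v : S} (hv : v ∈ 𝒮.M ∪ 𝒮.P) {c c' : ℝ → S} (hc : ContinuousAt c 0)
    (hc' : ContinuousAt c' 0) (hcv : c 0 = v)
    (H : D.quotArcs.Sector (𝒮.p v) (𝒮.p ∘ c) (𝒮.p ∘ c')) :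
    D.arcs.Sector v c c' ∨ D.arcs.Sector v c (𝒮.σ ∘ c') := by
  obtain ⟨-, ε, h0, g, gc, gt, gs, gi, gp⟩ := H
  obtain ⟨U, hU, hvU, hσU, hinj⟩ := 𝒮.exists_open_nhds (𝒮.σ_ne_of_mem_marked hv)
  obtain ⟨δ, hδ, hδε, hm⟩ := exists_closedSector_mapsTo h0 gc gt (𝒮.isOpenMap_p U hU) ⟨v, hvU, rfl⟩
  have hm' : MapsTo g (openSector δ) (𝒮.p '' U) :=
    hm.mono_left (openSector_subset_closedSector _)
  have : Nonempty S := ⟨v⟩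
  -- The local section of `p` near the vertex. It is continuous because `p` is open and injective on
  -- `U`, and the lifted sector is its composite with `g`.
  set q : 𝒮.Quot → S := Function.invFunOn 𝒮.p U with hq
  have hqU : ∀ y ∈ 𝒮.p '' U, q y ∈ U := fun y hy => Function.invFunOn_mem hy
  have hpq : ∀ y ∈ 𝒮.p '' U, 𝒮.p (q y) = y := fun y hy => Function.invFunOn_eq hy
  have hqp : ∀ x ∈ U, q (𝒮.p x) = x := fun x hx =>
    hinj (hqU _ ⟨x, hx, rfl⟩) hx (hpq _ ⟨x, hx, rfl⟩)
  have hqc : ContinuousOn q (𝒮.p '' U) := by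
    rintro _ ⟨x, hx, rfl⟩
    refine ContinuousAt.continuousWithinAt fun W hW => ?_
    rw [hqp x hx] at hW
    have h1 := 𝒮.isOpenMap_p.image_mem_nhds (inter_mem hW (hU.mem_nhds hx))
    refine mem_map.2 (mem_of_superset h1 ?_)
    rintro _ ⟨w, hw, rfl⟩
    rw [mem_preimage, hqp w hw.2]
    exact hw.1
  have hside : ∀ d : ℝ → S, ContinuousAt d 0 → d 0 = v →
      ∃ η, 0 < η ∧ ∀ r ∈ Icc 0 η, q (𝒮.p (d r)) = d r := fun d hd hdv => by
    have h1 : ∀ᶠ r in 𝓝 (0 : ℝ), d r ∈ U := hd (hU.mem_nhds (by rwa [hdv]))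
    obtain ⟨η, hη, h⟩ := Metric.eventually_nhds_iff.1 h1
    refine ⟨η / 2, by positivity, fun r hr => hqp _ (h ?_)⟩
    rw [Real.dist_eq, sub_zero, abs_of_nonneg hr.1]
    linarith [hr.2]
  -- The side `d` stands for whichever of `c'` and its translate starts at `v`; the section returns
  -- it near the vertex.
  have key : ∀ d : ℝ → S, ContinuousAt d 0 → d 0 = v → 𝒮.p ∘ d = 𝒮.p ∘ c' →
      D.arcs.Sector v c d := fun d hd hdv hdc => by
    obtain ⟨η, hη, hη'⟩ := hside c hc hcv
    obtain ⟨ζ, hζ, hζ'⟩ := hside d hd hdv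
    set ξ := min δ (min η ζ) with hξ
    have hξδ : ξ ≤ δ := min_le_left _ _
    have hξη : ξ ≤ η := (min_le_right _ _).trans (min_le_left _ _)
    have hξζ : ξ ≤ ζ := (min_le_right _ _).trans (min_le_right _ _)
    refine ⟨hv, ξ, by positivity, q ∘ g,
      hqc.comp (gc.mono (closedSector_mono (hξδ.trans hδε))) (hm.mono_left (closedSector_mono hξδ)),
      fun θ hθ => ?_, fun r hr => ⟨?_, ?_⟩, ?_, fun z hz => ?_⟩
    · rw [Function.comp_apply, gt θ hθ, hqp v hvU]
    · rw [Function.comp_apply, (gs r ⟨hr.1, hr.2.trans (hξδ.trans hδε)⟩).1]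
      exact hη' r ⟨hr.1, hr.2.trans hξη⟩
    · rw [Function.comp_apply, (gs r ⟨hr.1, hr.2.trans (hξδ.trans hδε)⟩).2, ← hdc]
      exact hζ' r ⟨hr.1, hr.2.trans hξζ⟩
    · intro z hz w hw h
      have hz' := openSector_mono hξδ hz
      have hw' := openSector_mono hξδ hw
      refine gi (openSector_mono hδε hz') (openSector_mono hδε hw') ?_
      have := congrArg 𝒮.p h
      rwa [Function.comp_apply, Function.comp_apply, hpq _ (hm' hz'), hpq _ (hm' hw')] at this
    · have hz' := openSector_mono hξδ hz
      obtain ⟨⟨g', hg', -, hev⟩, hav⟩ := gp z (openSector_mono hδε hz')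
      have hpz := hpq _ (hm' hz')
      refine ⟨?_, (D.forall_notMem_range_iff _).1 (by rwa [Function.comp_apply, hpz])⟩
      have hloc : ∀ f : Plane → S, 𝒮.orient.PosAt f z → f z = q (g z) → 𝒮.p ∘ f = 𝒮.p ∘ g' →
          𝒮.orient.PosAt (q ∘ g) z := fun f hf hfz hfg => by
        refine hf.congr ?_
        have h1 : ∀ᶠ w in 𝓝 z, f w ∈ U :=
          hf.1 (hU.mem_nhds (by rw [hfz]; exact hqU _ (hm' hz')))
        filter_upwards [hev, h1] with w hw hw'
        rw [Function.comp_apply, hw, ← hqp _ hw']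
        exact congrArg q (congrFun hfg w).symm
      rw [hev.self_of_nhds] at hpz
      -- The local lift `g'` that witnesses the orientation may land in the other sheet. It is then
      -- replaced by `σ ∘ g'`, which is positively oriented too.
      rcases 𝒮.p_eq_p.1 hpz with h | h
      · refine hloc g' hg' ?_ rfl
        rw [hev.self_of_nhds]
        exact h
      · refine hloc (𝒮.σ ∘ g') (𝒮.posAt_σ hg') ?_ (funext fun w => 𝒮.p_σ _)
        rw [Function.comp_apply, h, 𝒮.σ_σ, hev.self_of_nhds]
  have hc0 : 𝒮.p v = 𝒮.p (c' 0) := by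
    rw [← gt 1 (by simp), (gs 0 ⟨le_rfl, h0.le⟩).2]; rfl
  rcases 𝒮.p_eq_p.1 hc0 with h | h
  · exact Or.inl (key c' hc' h rfl)
  · refine Or.inr (key _ (𝒮.σ.continuous.continuousAt.comp hc') ?_ (funext fun r => 𝒮.p_σ _))
    rw [Function.comp_apply, h, 𝒮.σ_σ]

end GDissection

end Surface

end GSurf

/-! ### Images of arcs in the quotient, and which arcs have the same image. -/

namespace GSurf

open Set Filter Topology

theorem mem_Ioo_unitInterval {t : ℝ} (h0 : 0 < t) (h1 : t < 1) :
    (⟨t, h0.le, h1.le⟩ : unitInterval) ∈ Ioo (0 : unitInterval) 1 := ⟨h0, h1⟩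

theorem exists_symm_ne : ∃ t ∈ Ioo (0 : unitInterval) 1,
    unitInterval.symm t ∈ Ioo (0 : unitInterval) 1 ∧ unitInterval.symm t ≠ t := by
  refine ⟨⟨1 / 4, by norm_num, by norm_num⟩, mem_Ioo_unitInterval (by norm_num) (by norm_num),
    mem_Ioo_unitInterval (by norm_num) (by norm_num), fun h => ?_⟩
  have := congrArg Subtype.val h
  norm_num at this

theorem ArcSystem.Follows.start_eq {T : Type*} [TopologicalSpace T] {D : ArcSystem T}
    {h h' : C(unitInterval, T)} (H : D.Follows h h') : h' 0 = h 0 := by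
  obtain ⟨-, ε, h0, -, g, -, gt, gs, -⟩ := H
  rw [← (gs 0 h0.le).2, ← gt 1 (by simp)]
  rfl

section Surface

variable {S : Type*} [TopologicalSpace S] [ChartedSpace (EuclideanHalfSpace 2) S]
  {𝒮 : GMarkedSurface S}

namespace GDissection

theorem proj_of_special {γ : C(unitInterval, S)} (h : 𝒮.σC.comp γ = rev γ) :
    proj (𝒮 := 𝒮) γ = GSurf.half (𝒮.p.comp γ) := if_pos h

theorem proj_of_ne {γ : C(unitInterval, S)} (h : 𝒮.σC.comp γ ≠ rev γ) :
    proj (𝒮 := 𝒮) γ = 𝒮.p.comp γ := if_neg h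

theorem special_rev {γ : C(unitInterval, S)} :
    𝒮.σC.comp (rev γ) = rev (rev γ) ↔ 𝒮.σC.comp γ = rev γ := by
  rw [comp_rev]
  exact ⟨fun h => by rw [← rev_rev (𝒮.σC.comp γ), h, rev_rev], fun h => by rw [h]⟩

theorem special_σ {γ : C(unitInterval, S)} :
    𝒮.σC.comp (𝒮.σC.comp γ) = rev (𝒮.σC.comp γ) ↔ 𝒮.σC.comp γ = rev γ := by
  rw [σC_σC, ← comp_rev]
  exact ⟨fun h => by rw [h, σC_σC, ← h], fun h => by rw [← h, σC_σC]⟩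

theorem proj_σ (γ : C(unitInterval, S)) : proj (𝒮 := 𝒮) (𝒮.σC.comp γ) = proj γ := by
  by_cases h : 𝒮.σC.comp γ = rev γ
  · rw [proj_of_special h, proj_of_special (special_σ.2 h), p_comp_σC]
  · rw [proj_of_ne h, proj_of_ne (fun h' => h (special_σ.1 h')), p_comp_σC]

theorem proj_rev {γ : C(unitInterval, S)} (h : 𝒮.σC.comp γ ≠ rev γ) :
    proj (𝒮 := 𝒮) (rev γ) = rev (proj γ) := by
  rw [proj_of_ne h, proj_of_ne (fun h' => h (special_rev.1 h')), comp_rev]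

theorem proj_rev_of_special {γ : C(unitInterval, S)} (h : 𝒮.σC.comp γ = rev γ) :
    proj (𝒮 := 𝒮) (rev γ) = proj γ := by rw [← h, proj_σ]

theorem proj_zero (γ : C(unitInterval, S)) : proj (𝒮 := 𝒮) γ 0 = 𝒮.p (γ 0) := by
  unfold proj
  split_ifs
  · change 𝒮.p (γ _) = _
    congr 2
    exact Subtype.ext (zero_div 2)
  · rfl

theorem σ_midpoint {γ : C(unitInterval, S)} (h : 𝒮.σC.comp γ = rev γ) {t : unitInterval}
    (ht : (t : ℝ) = 1 / 2) : 𝒮.σ (γ t) = γ t := by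
  have h1 : 𝒮.σ (γ t) = γ (unitInterval.symm t) := DFunLike.congr_fun h t
  rw [h1]
  congr 1
  exact Subtype.ext (by rw [unitInterval.coe_symm_eq, ht]; norm_num)

variable (D : GDissection 𝒮)

theorem rev_proj_zero_mem {γ : C(unitInterval, S)} (h : 𝒮.σC.comp γ = rev γ) :
    rev (proj γ) 0 ∈ D.quotArcs.X := by
  rw [proj_of_special h]
  refine ⟨_, σ_midpoint h (t := ⟨1 / 2, by norm_num, by norm_num⟩) rfl, ?_⟩
  change 𝒮.p (γ _) = 𝒮.p (γ _)
  congr 2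
  exact Subtype.ext (by simp)

theorem proj_zero_mem {γ : C(unitInterval, S)} (h : γ ∈ D.E) : proj γ 0 ∈ D.quotArcs.V := by
  rw [proj_zero]
  exact ⟨_, D.start_mem γ h, rfl⟩

variable [IsManifold (𝓡∂ 2) ∞ S]

theorem σC_comp_ne {γ : C(unitInterval, S)} (hγ : γ ∈ D.E) : 𝒮.σC.comp γ ≠ γ := fun h =>
  𝒮.σ_ne_of_mem_marked (D.start_mem γ hγ) (DFunLike.congr_fun h 0)

/-- This tells the two ends of the image of a reversed arc apart. -/
theorem disjoint_quotArcs : Disjoint D.quotArcs.V D.quotArcs.X := by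
  rw [disjoint_left]
  rintro _ ⟨v, hv, rfl⟩ ⟨x, hx, h⟩
  have hx' : 𝒮.σ x = x := hx
  rcases 𝒮.p_eq_p.1 h with rfl | rfl
  · exact 𝒮.σ_ne_of_mem_marked hv hx'
  · rw [hx'] at hv
    exact 𝒮.σ_ne_of_mem_marked hv hx'

/-- If the images of two arcs meet in their interiors, the arcs are equal up to reversal and
`σ`. -/
theorem eq_of_p_eq {γ δ : C(unitInterval, S)} (hγ : γ ∈ D.E) (hδ : δ ∈ D.E) {t u : unitInterval}
    (ht : t ∈ Ioo 0 1) (hu : u ∈ Ioo 0 1) (h : 𝒮.p (γ t) = 𝒮.p (δ u)) :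
    (δ = γ ∨ δ = rev γ) ∨ (δ = 𝒮.σC.comp γ ∨ δ = rev (𝒮.σC.comp γ)) := by
  rcases 𝒮.p_eq_p.1 h with h | h
  · exact Or.inl (D.disjoint γ hγ δ hδ t ht u hu h.symm)
  · exact Or.inr (D.disjoint _ (D.σ_mem γ hγ) δ hδ t ht u hu h.symm)

theorem proj_ne_rev_proj {γ δ : C(unitInterval, S)} (hγ : γ ∈ D.E) (hδ : 𝒮.σC.comp δ = rev δ) :
    proj (𝒮 := 𝒮) γ ≠ rev (proj δ) := fun h =>
  disjoint_left.1 D.disjoint_quotArcs (D.proj_zero_mem hγ) (h ▸ D.rev_proj_zero_mem hδ)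

/-- The image of a reversed arc ends at an orbifold point, whereas both ends of the image of any
other arc are marked. -/
theorem not_special_of_proj_eq {γ δ : C(unitInterval, S)} (hγ : γ ∈ D.E)
    (hγδ : proj (𝒮 := 𝒮) γ = proj δ) (hδ : 𝒮.σC.comp δ = rev δ) : 𝒮.σC.comp γ = rev γ := by
  by_contra h
  refine D.proj_ne_rev_proj (D.rev_mem γ hγ) hδ ?_
  rw [proj_rev h, hγδ]

/-- Otherwise `γ t` and `γ (1 - t)` lie in one orbit for all `t`. At an interior `t ≠ 1 - t`,
injectivity excludes that they are equal, and disjointness of interiors would make `σ γ` equal to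
`γ` or to its reverse. -/
theorem p_comp_ne_rev {γ : C(unitInterval, S)} (hγ : γ ∈ D.E) (h : 𝒮.σC.comp γ ≠ rev γ) :
    𝒮.p.comp γ ≠ rev (𝒮.p.comp γ) := by
  intro h'
  obtain ⟨t, ht, ht', hne⟩ := exists_symm_ne
  have h1 : 𝒮.p (γ t) = 𝒮.p (γ (unitInterval.symm t)) := DFunLike.congr_fun h' t
  rcases 𝒮.p_eq_p.1 h1 with h3 | h3
  · exact hne (D.injOn γ hγ ht' ht h3)
  · rcases D.disjoint γ hγ _ (D.σ_mem γ hγ) _ ht' t ht h3 with h4 | h4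
    · exact D.σC_comp_ne hγ h4
    · exact h h4

/-- Comparison at one interior point leaves only `γ`, `σ γ` and their reverses. For a reversed arc
the reverses are already in the list; otherwise `p_comp_ne_rev` excludes them. -/
theorem proj_eq_proj {γ δ : C(unitInterval, S)} (hγ : γ ∈ D.E) (hδ : δ ∈ D.E) :
    proj (𝒮 := 𝒮) γ = proj δ ↔ δ = γ ∨ δ = 𝒮.σC.comp γ := by
  constructor
  · intro h
    -- On a halved arc the parameter `1 / 2` is the parameter `1 / 4` upstairs, so the point is
    -- interior in both cases.
    let t : unitInterval := ⟨1 / 2, by norm_num, by norm_num⟩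
    have ht : t ∈ Ioo (0 : unitInterval) 1 := mem_Ioo_unitInterval (by norm_num) (by norm_num)
    by_cases hs : 𝒮.σC.comp γ = rev γ
    · have hs' := D.not_special_of_proj_eq hδ h.symm hs
      rw [proj_of_special hs, proj_of_special hs'] at h
      have h1 := DFunLike.congr_fun h t
      have hu : ∃ u ∈ Ioo (0 : unitInterval) 1, 𝒮.p (γ u) = 𝒮.p (δ u) :=
        ⟨⟨(t : ℝ) / 2, by norm_num [t], by norm_num [t]⟩, mem_Ioo_unitInterval (by norm_num) (by norm_num), h1⟩
      obtain ⟨u, hu, h2⟩ := hu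
      rcases D.eq_of_p_eq hγ hδ hu hu h2 with (h3 | h3) | (h3 | h3)
      · exact Or.inl h3
      · exact Or.inr (by rw [h3, hs])
      · exact Or.inr h3
      · exact Or.inl (by rw [h3, hs, rev_rev])
    · have hs' : 𝒮.σC.comp δ ≠ rev δ := fun h' => hs (D.not_special_of_proj_eq hγ h h')
      rw [proj_of_ne hs, proj_of_ne hs'] at h
      rcases D.eq_of_p_eq hγ hδ ht ht (DFunLike.congr_fun h t) with (h3 | h3) | (h3 | h3)
      · exact Or.inl h3
      · exact absurd (by rw [h3, comp_rev] at h; exact h) (D.p_comp_ne_rev hγ hs)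
      · exact Or.inr h3
      · exact absurd (by rw [h3, comp_rev, p_comp_σC] at h; exact h) (D.p_comp_ne_rev hγ hs)
  · rintro (rfl | rfl)
    · rfl
    · rw [proj_σ]

/-! ### Arcs -/

/-- The image of an oriented arc. -/
def projE (γ : D.arcs.E) : D.quotArcs.E := ⟨proj γ.1, Or.inl ⟨γ.1, γ.2, rfl⟩⟩

/-- The image of an arc. -/
def projArc : D.arcs.Arcs → D.quotArcs.Arcs :=
  Quotient.map D.projE (by
    rintro γ δ (rfl | h)
    · exact Or.inl rfl
    · by_cases hs : 𝒮.σC.comp γ.1 = rev γ.1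
      · exact Or.inl (Subtype.ext (by simp only [projE, h]; exact proj_rev_of_special hs))
      · refine Or.inr ?_
        simp only [projE, h]
        exact proj_rev hs)

theorem projArc_arc (γ : D.arcs.E) : D.projArc (D.arcs.arc γ) = D.quotArcs.arc (D.projE γ) := rfl

theorem σArc_arc (γ : D.arcs.E) : D.σArc (D.arcs.arc γ) = D.arcs.arc (D.σE γ) := rfl

theorem _root_.GSurf.ArcSystem.arc_eq_arc {T : Type*} [TopologicalSpace T] (D : ArcSystem T)
    {γ δ : D.E} : D.arc γ = D.arc δ ↔ δ = γ ∨ (δ : C(unitInterval, T)) = rev γ :=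
  ⟨fun h => Quotient.exact h, fun h => Quotient.sound h⟩

theorem arcOver_iff {i : D.arcs.Arcs} {j : D.quotArcs.Arcs} : D.ArcOver i j ↔ D.projArc i = j := by
  constructor
  · rintro ⟨γ, δ, h, rfl, rfl⟩
    rw [projArc_arc]
    congr 1
    exact Subtype.ext h
  · rintro rfl
    induction i using Quotient.inductionOn with
    | h γ => exact ⟨γ, D.projE γ, rfl, rfl, rfl⟩

theorem projArc_surjective : Function.Surjective D.projArc := by
  rintro ⟨δ, hδ⟩
  rcases hδ with ⟨γ, hγ, rfl⟩ | ⟨_, ⟨γ, hγ, rfl⟩, rfl⟩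
  · exact ⟨D.arcs.arc ⟨γ, hγ⟩, rfl⟩
  · exact ⟨D.arcs.arc ⟨γ, hγ⟩, D.quotArcs.arc_eq_arc.2 (Or.inr rfl)⟩

theorem projArc_σArc (i : D.arcs.Arcs) : D.projArc (D.σArc i) = D.projArc i := by
  induction i using Quotient.inductionOn with
  | h γ => exact congrArg D.quotArcs.arc (Subtype.ext (proj_σ γ.1))

theorem σArc_σArc (i : D.arcs.Arcs) : D.σArc (D.σArc i) = i := D.σQ.onV_onV i

theorem σArc_arc_eq {γ : D.arcs.E} : D.σArc (D.arcs.arc γ) = D.arcs.arc γ ↔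
    𝒮.σC.comp γ.1 = rev γ.1 := by
  rw [σArc_arc, eq_comm, D.arcs.arc_eq_arc]
  constructor
  · rintro (h | h)
    · exact absurd (congrArg Subtype.val h) (D.σC_comp_ne γ.2)
    · exact h
  · exact Or.inr

/-- A coincidence up to reversal downstairs cannot involve a halved arc, whose ends are of different
kinds, and for the other arcs reversal commutes with projection. -/
theorem eq_of_projArc_eq {i j : D.arcs.Arcs} (h : D.projArc i = D.projArc j) :
    j = i ∨ j = D.σArc i := by
  induction i using Quotient.inductionOn with | h γ => ?_
  induction j using Quotient.inductionOn with | h δ => ?_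
  rcases D.quotArcs.arc_eq_arc.1 h with h1 | h1
  · rcases (D.proj_eq_proj γ.2 δ.2).1 (congrArg Subtype.val h1).symm with h2 | h2
    · exact Or.inl (congrArg D.arcs.arc (Subtype.ext h2))
    · exact Or.inr (congrArg D.arcs.arc (Subtype.ext h2))
  · have h1 : proj δ.1 = rev (proj γ.1) := h1
    have hs : 𝒮.σC.comp γ.1 ≠ rev γ.1 := fun hs => D.proj_ne_rev_proj δ.2 hs h1
    rw [← proj_rev hs] at h1
    rcases (D.proj_eq_proj (D.rev_mem _ γ.2) δ.2).1 h1.symm with h2 | h2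
    · exact Or.inl (D.arcs.arc_eq_arc.2 (Or.inr h2)).symm
    · exact Or.inr (D.arcs.arc_eq_arc.2 (Or.inr h2)).symm

/-- Among the oriented arcs of the quotient, the only ones that are not projections are the reversed
halved arcs, and these start at orbifold points. -/
theorem exists_proj_eq {δ : C(unitInterval, 𝒮.Quot)} (hδ : δ ∈ D.quotArcs.E)
    (hV : δ 0 ∈ D.quotArcs.V) : ∃ γ : D.arcs.E, proj γ.1 = δ := by
  rcases hδ with ⟨γ, hγ, rfl⟩ | ⟨_, ⟨γ, hγ, rfl⟩, rfl⟩
  · exact ⟨⟨γ, hγ⟩, rfl⟩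
  · by_cases hs : 𝒮.σC.comp γ = rev γ
    · exact absurd (D.rev_proj_zero_mem hs) (disjoint_left.1 D.disjoint_quotArcs hV)
    · exact ⟨⟨rev γ, D.rev_mem _ hγ⟩, proj_rev hs⟩

theorem exists_special (x : D.SpEnd) :
    ∃ γ : D.arcs.E, 𝒮.σC.comp γ.1 = rev γ.1 ∧ x.1.1 = rev (proj γ.1) := by
  obtain ⟨⟨δ, hδ⟩, hx⟩ := x
  have hx' : δ 0 ∈ D.quotArcs.X := hx
  have hV : δ 0 ∉ D.quotArcs.V := fun h => disjoint_left.1 D.disjoint_quotArcs h hx'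
  rcases hδ with ⟨γ, hγ, rfl⟩ | ⟨_, ⟨γ, hγ, rfl⟩, rfl⟩
  · exact absurd (D.proj_zero_mem hγ) hV
  · refine ⟨⟨γ, hγ⟩, ?_, rfl⟩
    by_contra hs
    exact hV (by rw [← proj_rev hs]; exact D.proj_zero_mem (D.rev_mem _ hγ))

theorem σArc_eq_of_spEnd {i : D.arcs.Arcs} {x : D.SpEnd}
    (h : D.projArc i = D.quotArcs.arc x.1) : D.σArc i = i := by
  obtain ⟨γ, hs, hx⟩ := D.exists_special x
  have h1 : D.projArc (D.arcs.arc γ) = D.quotArcs.arc x.1 :=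
    D.quotArcs.arc_eq_arc.2 (Or.inr hx)
  have h2 := D.σArc_arc_eq.2 hs
  rcases D.eq_of_projArc_eq (h1.trans h.symm) with h3 | h3
  · rw [h3, h2]
  · rw [h3, σArc_σArc, h2]

/-- An arc of the quotient has at most one end at an orbifold point, since its other end is then
marked. -/
theorem spEnd_injective {x y : D.SpEnd} (h : D.quotArcs.arc x.1 = D.quotArcs.arc y.1) : x = y := by
  rcases D.quotArcs.arc_eq_arc.1 h with h1 | h1
  · exact Subtype.ext h1.symm
  · obtain ⟨γ, -, hx⟩ := D.exists_special x
    rw [hx, rev_rev] at h1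
    have h2 := y.2
    rw [h1] at h2
    exact absurd h2 (disjoint_left.1 D.disjoint_quotArcs (D.proj_zero_mem γ.2))

theorem exists_spEnd {i : D.arcs.Arcs} (h : D.σArc i = i) :
    ∃ x : D.SpEnd, D.quotArcs.arc x.1 = D.projArc i := by
  induction i using Quotient.inductionOn with | h γ => ?_
  have hs := D.σArc_arc_eq.1 h
  exact ⟨⟨⟨rev (proj γ.1), D.quotArcs.rev_mem _ (D.projE γ).2⟩, D.rev_proj_zero_mem hs⟩,
    D.quotArcs.arc_eq_arc.2 (Or.inr (rev_rev _).symm)⟩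

end GDissection

end Surface

end GSurf

/-! ### Images and lifts of arrows, and the folding of a dissection. -/

namespace GSurf

open Set Filter Topology

section Surface

variable {S : Type*} [TopologicalSpace S] [ChartedSpace (EuclideanHalfSpace 2) S]
  {𝒮 : GMarkedSurface S}

namespace GDissection

theorem exists_scale (γ : C(unitInterval, S)) : ∃ a : ℝ, 0 < a ∧ a ≤ 1 ∧
    ∀ r ∈ Icc (0 : ℝ) 1, ArcSystem.ext (proj (𝒮 := 𝒮) γ) r = 𝒮.p (ArcSystem.ext γ (a * r)) := by
  unfold proj
  split_ifs
  · refine ⟨1 / 2, by norm_num, by norm_num, fun r hr => ?_⟩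
    have hr' : 1 / 2 * r ∈ Icc (0 : ℝ) 1 := ⟨by linarith [hr.1], by linarith [hr.2]⟩
    rw [ArcSystem.ext, ArcSystem.ext, IccExtend_of_mem _ _ hr, IccExtend_of_mem _ _ hr']
    change 𝒮.p (γ _) = 𝒮.p (γ _)
    congr 2
    exact Subtype.ext (by change r / 2 = 1 / 2 * r; ring)
  · exact ⟨1, one_pos, le_rfl, fun r hr => by rw [one_mul]; rfl⟩

variable (D : GDissection 𝒮)

/-- Undoes the halving: downstairs, consecutive ends can be tested on the full images of the arcs,
which is the form that lifts. -/
theorem follows_proj_iff_sector {γ δ : C(unitInterval, S)} :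
    D.quotArcs.Follows (proj γ) (proj δ) ↔
      D.quotArcs.Sector (𝒮.p (γ 0)) (𝒮.p ∘ ArcSystem.ext γ) (𝒮.p ∘ ArcSystem.ext δ) := by
  rw [ArcSystem.follows_iff_sector, proj_zero]
  obtain ⟨a, ha, ha1, hγ⟩ := exists_scale (𝒮 := 𝒮) γ
  obtain ⟨b, hb, hb1, hδ⟩ := exists_scale (𝒮 := 𝒮) δ
  constructor
  · intro H
    refine H.rescale D.posAtComp_quotArcs (inv_pos.2 ha) (inv_pos.2 hb) (lt_min ha hb) ?_ ?_
    · intro r hr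
      rw [hγ _ ⟨by have := hr.1; positivity, ?_⟩, mul_inv_cancel_left₀ ha.ne']
      · rfl
      · rw [inv_mul_le_one₀ ha]; exact hr.2.trans (min_le_left _ _)
    · intro r hr
      rw [hδ _ ⟨by have := hr.1; positivity, ?_⟩, mul_inv_cancel_left₀ hb.ne']
      · rfl
      · rw [inv_mul_le_one₀ hb]; exact hr.2.trans (min_le_right _ _)
  · exact fun H => H.rescale D.posAtComp_quotArcs ha hb one_pos hγ hδ

variable [T2Space S] [IsManifold (𝓡∂ 2) ∞ S]

variable {D}

theorem follows_proj {γ δ : C(unitInterval, S)} (H : D.arcs.Follows γ δ) :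
    D.quotArcs.Follows (proj γ) (proj δ) :=
  D.follows_proj_iff_sector.2 (sector_quot (D.arcs.follows_iff_sector.1 H))

theorem follows_lift {γ δ : C(unitInterval, S)} (hγ : γ ∈ D.E)
    (H : D.quotArcs.Follows (proj γ) (proj δ)) :
    D.arcs.Follows γ δ ∨ D.arcs.Follows γ (𝒮.σC.comp δ) := by
  rw [ArcSystem.follows_iff_sector, ArcSystem.follows_iff_sector]
  refine sector_lift (D.start_mem γ hγ) (Continuous.Icc_extend' γ.continuous).continuousAt
    (Continuous.Icc_extend' δ.continuous).continuousAt ?_ (D.follows_proj_iff_sector.1 H)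
  exact IccExtend_left _ _

variable (D)

/-- The image of an arrow. -/
def projCorner (α : D.arcs.Corner) : D.quotArcs.Corner :=
  ⟨(D.projE α.1.1, D.projE α.1.2), follows_proj α.2⟩

theorem cornerOver_iff {α : D.arcs.Corner} {a : D.quotArcs.Corner} :
    D.CornerOver α a ↔ D.projCorner α = a := by
  rw [Subtype.ext_iff, Prod.ext_iff, Subtype.ext_iff, Subtype.ext_iff]
  rfl

theorem projCorner_σCorner (α : D.arcs.Corner) : D.projCorner (D.σCorner α) = D.projCorner α :=
  D.cornerOver_iff.1 ⟨proj_σ _, proj_σ _⟩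

variable {D} {Vp : Set S} {Qp : Set D.arcs.Arcs}

/-- Two lifts of an end differ at most by `σ`, and only one of the two starting points is chosen. -/
theorem eq_of_projE_eq (hV : IsPointChoice 𝒮 Vp) {γ δ : D.arcs.E} (h : D.projE γ = D.projE δ)
    (hγ : γ.1 0 ∈ Vp) (hδ : δ.1 0 ∈ Vp) : γ = δ := by
  rcases (D.proj_eq_proj γ.2 δ.2).1 (congrArg Subtype.val h) with h1 | h1
  · exact (Subtype.ext h1).symm
  · rw [h1] at hδ
    exact absurd hδ ((hV.2 _ (D.start_mem _ γ.2)).1 hγ)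

theorem eq_of_projCorner_eq (hV : IsPointChoice 𝒮 Vp) {α β : D.arcs.Corner}
    (h : D.projCorner α = D.projCorner β) (hα : α.1.1.1 0 ∈ Vp) (hβ : β.1.1.1 0 ∈ Vp) : α = β := by
  have h1 := congrArg (fun q => q.1.1) h
  have h2 := congrArg (fun q => q.1.2) h
  refine Subtype.ext (Prod.ext (eq_of_projE_eq hV h1 hα hβ) (eq_of_projE_eq hV h2 ?_ ?_))
  · rwa [α.2.start_eq]
  · rwa [β.2.start_eq]

/-- The first end is lifted so as to start at a chosen point. The sector then lifts along it and
determines which translate of the second end follows. -/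
theorem exists_projCorner_eq (hV : IsPointChoice 𝒮 Vp) (a : D.quotArcs.Corner) :
    ∃ α : D.arcs.Corner, D.projCorner α = a ∧ α.1.1.1 0 ∈ Vp := by
  obtain ⟨⟨⟨x, hx⟩, ⟨y, hy⟩⟩, ha⟩ := a
  have hxV : x 0 ∈ D.quotArcs.V := ha.1
  have hyV : y 0 ∈ D.quotArcs.V := by
    have := ha.start_eq
    simp only at this
    rwa [this]
  obtain ⟨γ, rfl⟩ := D.exists_proj_eq hx hxV
  obtain ⟨δ, rfl⟩ := D.exists_proj_eq hy hyV
  obtain ⟨γ', hγ', hv⟩ : ∃ γ' : D.arcs.E, proj γ'.1 = proj (𝒮 := 𝒮) γ.1 ∧ γ'.1 0 ∈ Vp := by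
    by_cases hv : γ.1 0 ∈ Vp
    · exact ⟨γ, rfl, hv⟩
    · refine ⟨D.σE γ, proj_σ _, ?_⟩
      by_contra hv'
      exact hv ((hV.2 _ (D.start_mem _ γ.2)).2 hv')
  have ha' : D.quotArcs.Follows (proj γ'.1) (proj δ.1) := by rw [hγ']; exact ha
  rcases follows_lift γ'.2 ha' with h | h
  · exact ⟨⟨(γ', δ), h⟩, D.cornerOver_iff.1 ⟨hγ', rfl⟩, hv⟩
  · exact ⟨⟨(γ', D.σE δ), h⟩, D.cornerOver_iff.1 ⟨hγ', proj_σ _⟩, hv⟩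

theorem exists_projArc_eq (hQ : D.IsArcChoice Qp) (j : D.quotArcs.Arcs) :
    ∃ i, D.projArc i = j ∧ (i ∈ Qp ∨ D.σArc i = i) := by
  obtain ⟨i, rfl⟩ := D.projArc_surjective j
  by_cases h : D.σArc i = i
  · exact ⟨i, rfl, Or.inr h⟩
  · by_cases hi : i ∈ Qp
    · exact ⟨i, rfl, Or.inl hi⟩
    · refine ⟨D.σArc i, D.projArc_σArc i, Or.inl ?_⟩
      by_contra h'
      exact hi ((hQ.2 i h).2 h')

theorem eq_of_projArc_eq_of_choice (hQ : D.IsArcChoice Qp) {i j : D.arcs.Arcs}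
    (h : D.projArc i = D.projArc j) (hi : i ∈ Qp ∨ D.σArc i = i) (hj : j ∈ Qp ∨ D.σArc j = j) :
    i = j := by
  rcases D.eq_of_projArc_eq h with rfl | rfl
  · rfl
  · rw [σArc_σArc] at hj
    rcases hj with hj | hj
    · rcases hi with hi | hi
      · exact absurd hj ((hQ.2 i (hQ.1 i hi)).1 hi)
      · exact hi.symm
    · exact hj

/-- The quiver of the quotient as a quotient of the quiver of the dissection. -/
def folding (hV : IsPointChoice 𝒮 Vp) (hQ : D.IsArcChoice Qp) :
    Folding D.arcs.triple D.σQ D.quotArcs.triple where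
  Ord := D.quotArcs.Corner
  Loop := D.SpEnd
  arrEquiv := Equiv.refl _
  mem_sp a := ⟨fun ⟨l, hl⟩ => ⟨l, hl.symm⟩, fun ⟨l, hl⟩ => ⟨l, hl.symm⟩⟩
  sp_empty := by rintro _ ⟨⟨h, hh⟩, rfl⟩; exact hh
  down := D.projArc
  sec j := (exists_projArc_eq hQ j).choose
  down_sec j := (exists_projArc_eq hQ j).choose_spec.1
  down_onV := D.projArc_σArc
  eq_or i := D.eq_of_projArc_eq (exists_projArc_eq hQ (D.projArc i)).choose_spec.1
  loop_fixed l := D.σArc_eq_of_spEnd (exists_projArc_eq hQ (D.quotArcs.arc l.1)).choose_spec.1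
  loop_injective _ _ h := D.spEnd_injective h
  exists_loop _ h := D.exists_spEnd h
  up a := Sum.inl (exists_projCorner_eq hV a).choose
  down_src_up a := congrArg (fun q : D.quotArcs.Corner => D.quotArcs.arc q.1.1)
    (exists_projCorner_eq hV a).choose_spec.1
  down_tgt_up a := congrArg (fun q : D.quotArcs.Corner => D.quotArcs.arc q.1.2)
    (exists_projCorner_eq hV a).choose_spec.1
  base := Sum.elim D.projCorner fun h => h.2.elim
  pos := Sum.elim (fun α => α.1.1.1 0 ∈ Vp) fun _ => False
  pos_up a := (exists_projCorner_eq hV a).choose_spec.2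
  base_up a := (exists_projCorner_eq hV a).choose_spec.1
  pos_onA := by
    rintro (α | h)
    · have h1 := hV.2 _ (D.start_mem _ α.1.1.2)
      exact ⟨fun h2 h3 => h1.1 h3 h2, fun h2 => by_contra fun h3 => h2 (h1.2 h3)⟩
    · exact h.2.elim
  base_onA := by
    rintro (α | h)
    · exact D.projCorner_σCorner α
    · exact h.2.elim
  up_base := by
    rintro (α | h) hp
    · have h1 := (exists_projCorner_eq hV (D.projCorner α)).choose_spec
      exact congrArg Sum.inl (eq_of_projCorner_eq hV h1.1 h1.2 hp)
    · exact h.2.elim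
  rel_up := by
    rintro b a ⟨q, q', rfl, rfl, h⟩
    refine ⟨q', q, rfl, rfl, _, _, rfl, rfl, ?_⟩
    have h1 := (exists_projCorner_eq hV q).choose_spec
    have h2 := (exists_projCorner_eq hV q').choose_spec
    -- The middle end is lifted twice, once for each arrow, both times at a chosen point, so the two
    -- lifts agree and the lifted arrows are consecutive.
    refine eq_of_projE_eq hV ?_ ?_ h2.2
    · exact (congrArg (fun q => q.1.2) h1.1).trans
        (h.trans (congrArg (fun q => q.1.1) h2.1).symm)
    · rw [(exists_projCorner_eq hV q).choose.2.start_eq]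
      exact h1.2
  rel_base := by
    rintro b a ⟨q, q', rfl, rfl, h⟩
    refine ⟨?_, _, _, rfl, rfl, congrArg D.projE h⟩
    change q'.1.1.1 0 ∈ Vp ↔ q.1.1.1 0 ∈ Vp
    -- All ends of a relation start at the same marked point.
    rw [← h, q.2.start_eq]

section Formulas

variable (hV : IsPointChoice 𝒮 Vp) (hQ : D.IsArcChoice Qp)

theorem folding_sec {i : D.arcs.Arcs} {j : D.quotArcs.Arcs} (h : D.ArcOver i j)
    (hi : i ∈ Qp ∨ D.σArc i = i) : (folding hV hQ).sec j = i := by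
  have h1 := (exists_projArc_eq hQ j).choose_spec
  exact eq_of_projArc_eq_of_choice hQ (h1.1.trans (D.arcOver_iff.1 h).symm) h1.2 hi

theorem folding_up {α : D.arcs.Corner} {a : D.quotArcs.Corner} (h : D.CornerOver α a)
    (hα : α.1.1.1 0 ∈ Vp) : (folding hV hQ).up a = Sum.inl α := by
  rw [← D.cornerOver_iff.1 h]
  exact (folding hV hQ).up_base (Sum.inl α) hα

variable (k : Type*) [Field k]

/-- The path algebra of the quiver of the dissection. -/
def gentleEquiv (D : GDissection 𝒮) : D.arcs.triple.Alg k ≃ₐ[k] GentleAlg k D := AlgEquiv.refl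

theorem actsBy_gentleEquiv (D : GDissection 𝒮) : Folding.ActsBy (gentleEquiv k D) D.σQ :=
  fun _ => if_neg gen_ne_one

theorem tens_gen (a : GentleAlg k D) : tens a gen = tens a 1 * Folding.σB (GentleAlg k D) :=
  single_eq_mul_gen a

theorem folding_η : (folding hV hQ).η (gentleEquiv k D) = D.eta k Qp := by
  have h : {i | i ∈ Qp ∨ D.σArc i = i} = range (folding hV hQ).sec := by
    ext i
    constructor
    · exact fun hi => ⟨D.projArc i, folding_sec hV hQ (D.arcOver_iff.2 rfl) hi⟩
    · rintro ⟨j, rfl⟩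
      exact (exists_projArc_eq hQ j).choose_spec.2
  rw [eta, h]
  exact (finsum_mem_range (f := fun i => tens (D.eA k i) 1) (folding hV hQ).sec_injective).symm

theorem eHalf_eq (i : D.arcs.Arcs) (ε : Fin 2) :
    D.eHalf k i ε = Folding.half (gentleEquiv k D) i ε := by
  rw [eHalf, tens_gen]
  rfl

theorem isExplicit_folding (h2 : (2 : k) ≠ 0) : D.IsExplicit k Vp Qp fun x =>
    ((folding hV hQ).Φ h2 (actsBy_gentleEquiv k D) x).1 := by
  set φ := folding hV hQ
  have hs := actsBy_gentleEquiv k D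
  -- An arc lying over one with an orbifold end is fixed by `σ`, so it is the representative of its
  -- orbit without any choice.
  have hloop : ∀ {i j} {x : D.SpEnd}, D.ArcOver i j → D.quotArcs.arc x.1 = j → D.σArc i = i :=
    fun hi hx => D.σArc_eq_of_spEnd ((D.arcOver_iff.1 hi).trans hx.symm)
  constructor
  · intro i j hij hi
    rw [← folding_sec hV hQ hij (Or.inl hi)]
    exact φ.Φ_e h2 hs j
  · intro i x ε hi
    rw [eHalf_eq, ← folding_sec hV hQ hi (Or.inr (hloop hi rfl))]
    exact φ.Φ_eSp h2 hs x ε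
  · intro a α i j ha hα hi hiQ hj hjQ
    have hi' := folding_sec hV hQ hi (Or.inl hiQ)
    have hj' := folding_sec hV hQ hj (Or.inl hjQ)
    have h := φ.Φ_ord h2 hs a (by change D.σArc (φ.sec _) ≠ φ.sec _; exact hi'.symm ▸ hQ.1 i hiQ)
      (by change D.σArc (φ.sec _) ≠ φ.sec _; exact hj'.symm ▸ hQ.1 j hjQ)
    rw [folding_up hV hQ ha hα] at h
    rw [tens_gen, ← hi', ← hj']
    simp only [tens, SkewMonoidAlgebra.single_add]
    exact h
  · intro a α i j x ε ha hα hi hx hj hjQ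
    have hi' := folding_sec hV hQ hi (Or.inr (hloop hi hx))
    have hj' := folding_sec hV hQ hj (Or.inl hjQ)
    have h := φ.Φ_ord_mul_eSp h2 hs a x ε hx
      (by change D.σArc (φ.sec _) ≠ φ.sec _; exact hj'.symm ▸ hQ.1 j hjQ)
    rw [folding_up hV hQ ha hα] at h
    rw [eHalf_eq, ← hi', ← hj']
    exact h
  · intro a α i j y ε ha hα hi hiQ hj hy
    have hi' := folding_sec hV hQ hi (Or.inl hiQ)
    have hj' := folding_sec hV hQ hj (Or.inr (hloop hj hy))
    have h := φ.Φ_eSp_mul_ord h2 hs a y ε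
      (by change D.σArc (φ.sec _) ≠ φ.sec _; exact hi'.symm ▸ hQ.1 i hiQ) hy
    rw [folding_up hV hQ ha hα] at h
    rw [eHalf_eq, ← hi', ← hj']
    exact h
  · intro a α i j x y ε ε' ha hα hi hx hj hy
    have hi' := folding_sec hV hQ hi (Or.inr (hloop hi hx))
    have hj' := folding_sec hV hQ hj (Or.inr (hloop hj hy))
    have h := φ.Φ_eSp_mul_ord_mul_eSp h2 hs a x y ε ε' hx hy
    rw [folding_up hV hQ ha hα] at h
    rw [eHalf_eq, eHalf_eq, ← hi', ← hj']
    exact h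

end Formulas

end GDissection

/-- An involution admits a choice of a representative in each orbit with two elements. -/
theorem exists_orbit_choice {X : Type*} {f : X → X} (hf : ∀ x, f (f x) = x) :
    ∃ C : Set X, ∀ x, f x ≠ x → (x ∈ C ↔ f x ∉ C) := by
  -- The smaller element of each orbit for some well-order.
  refine ⟨{x | WellOrderingRel x (f x)}, fun x hx => ?_⟩
  rw [mem_ofPred_eq, mem_ofPred_eq, hf]
  constructor
  · exact fun h => asymm_of WellOrderingRel h
  · intro h
    rcases trichotomous_of WellOrderingRel x (f x) with h1 | h1 | h1
    · exact h1
    · exact absurd h1.symm hx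
    · exact absurd h1 h

theorem GDissection.exists_isPointChoice [IsManifold (𝓡∂ 2) ∞ S] (𝒮 : GMarkedSurface S) :
    ∃ Vp, GDissection.IsPointChoice 𝒮 Vp := by
  obtain ⟨C, hC⟩ := exists_orbit_choice 𝒮.σ_σ
  refine ⟨C ∩ (𝒮.M ∪ 𝒮.P), inter_subset_right, fun v hv => ?_⟩
  have hσv : 𝒮.σ v ∈ 𝒮.M ∪ 𝒮.P := hv.imp (𝒮.σ_M v) (𝒮.σ_P v)
  have h := hC v (𝒮.σ_ne_of_mem_marked hv)
  exact ⟨fun h1 h3 => h.1 h1.1 h3.1, fun h1 => ⟨h.2 fun h3 => h1 ⟨h3, hσv⟩, hv⟩⟩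

theorem GDissection.exists_isArcChoice [IsManifold (𝓡∂ 2) ∞ S] (D : GDissection 𝒮) :
    ∃ Qp, D.IsArcChoice Qp := by
  obtain ⟨C, hC⟩ := exists_orbit_choice D.σArc_σArc
  refine ⟨C ∩ {i | D.σArc i ≠ i}, fun i hi => hi.2, fun i hi => ?_⟩
  have hi' : D.σArc (D.σArc i) ≠ D.σArc i := by rw [D.σArc_σArc]; exact hi.symm
  have h := hC i hi
  exact ⟨fun h1 h3 => h.1 h1.1 h3.1, fun h1 => ⟨h.2 fun h3 => h1 ⟨h3, hi'⟩, hi⟩⟩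

end Surface

end GSurf
end

/-! ### The comparison theorem. -/

open GSurf

theorem proposition4p3 {k : Type*} [Field k] (h2 : (2 : k) ≠ 0)
    {S : Type*} [TopologicalSpace S] [T2Space S] [CompactSpace S]
    [ChartedSpace (EuclideanHalfSpace 2) S] [IsManifold (𝓡∂ 2) ∞ S]
    (𝒮 : GMarkedSurface S) (D : GDissection 𝒮) :
    IsBasicAlgebraOf k (SkewGroupAlg k D) (SkewGentleAlg k D) ∧
    ∀ (Vp : Set S) (Qp : Set D.arcs.Arcs),
      GDissection.IsPointChoice 𝒮 Vp → D.IsArcChoice Qp →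
      ∃ hη : IsIdempotentElem (D.eta k Qp), IsBasicIdem (D.eta k Qp) ∧
        ∃ Φ : SkewGentleAlg k D ≃ₐ[k] hη.Corner, D.IsExplicit k Vp Qp (fun x => (Φ x).1) := by
  have main : ∀ (Vp : Set S) (Qp : Set D.arcs.Arcs),
      GDissection.IsPointChoice 𝒮 Vp → D.IsArcChoice Qp →
      ∃ hη : IsIdempotentElem (D.eta k Qp), IsBasicIdem (D.eta k Qp) ∧
        ∃ Φ : SkewGentleAlg k D ≃ₐ[k] hη.Corner,
          D.IsExplicit k Vp Qp (fun x => (Φ x).1) := fun Vp Qp hV hQ => by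
    rw [← GDissection.folding_η hV hQ k]
    exact ⟨_, (GDissection.folding hV hQ).isBasicIdem_η h2 (GDissection.actsBy_gentleEquiv k D),
      (GDissection.folding hV hQ).equiv h2 (GDissection.actsBy_gentleEquiv k D),
      GDissection.isExplicit_folding hV hQ k h2⟩
  -- The basic-algebra claim follows from the explicit one once some choice of representatives
  -- exists.
  obtain ⟨Vp, hV⟩ := GDissection.exists_isPointChoice 𝒮
  obtain ⟨Qp, hQ⟩ := D.exists_isArcChoice
  obtain ⟨hη, hb, Φ, -⟩ := main Vp Qp hV hQ
  exact ⟨⟨_, hη, hb, ⟨Φ⟩⟩, main⟩
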